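/- **Setting.** Let $T,K\in C^\infty([0,\infty))$ be positive with $K(0)=1$, $T'(0)=K'(0)=0$, and, as $r\to\infty$, $T(r)=1+O(1/r)$, $K(r)=1+O(1/r)$, $\frac{T'(r)}{T(r)}+\frac{K'(r)}{K(r)}=O(1/r^2)$. Let $u(r)=-\int_r^\infty \frac{K(x)T(x)}{x^2}\,dx$, with inverse $r(u)$, $u\in(-\infty,0)$, and $s(u)=\int_{-\infty}^u r(x)^2\,dx\in(0,\infty)$. Fix an integer $l\ge 0$, put $\lambda=l+\frac12$, and let $\omega\in\mathbb C$. With $r=r(s)$ let $$W(s)=l(l+1)\Big(\frac1{r^2T^2}-\frac1{s^2}\Big)-\frac1{rT^2K^2}\Big(\frac{T'}{T}+\frac{K'}{K}\Big).$$ *The solution $\eta^1$.* For $\mu=\pm\lambda$ let $\eta^1_0(\mu,\omega,s)=(2/\omega)^{\mu}\,\Gamma(\mu+1)\,s^{1/2}J_\mu(\omega s)$, with the branch for which $\eta^1_0\sim s^{\mu+1/2}$ as $s\to0$, and $\eta_0^1(\mu,0,s)=s^{\mu+1/2}$. For $0<y<s$ let $$G(s,y)=\tfrac1{2\lambda}\big(\eta^1_0(\lambda,\omega,s)\eta^1_0(-\lambda,\omega,y)-\eta^1_0(-\lambda,\omega,s)\eta^1_0(\lambda,\omega,y)\big),$$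 and put $\eta^1=\sum_{n\ge0}\eta^1_n$ with $\eta^1_0(s)=\eta^1_0(\lambda,\omega,s)$ and $\eta^1_{n+1}(s)=\int_0^sG(s,y)W(y)\eta^1_n(y)\,dy$. *The solution $\eta^2$.* For $\omega\ne0$ let $\eta^2_0(\omega,s)=(\frac12\pi\omega s)^{1/2}e^{-\frac{i\pi}2(\lambda+\frac12)}H^{(2)}_\lambda(\omega s)$ (single-valued in $\omega$), and for $0<s<y$ let $$B(s,y)=\tfrac{i}{2\omega}\big(\eta^2_0(\omega,y)\eta^2_0(-\omega,s)-\eta^2_0(\omega,s)\eta^2_0(-\omega,y)\big).$$ For $\omega=0$ use instead the limits as $\omega\to0$ of $\omega^{\lambda-1/2}\eta^2_0$ and of $B$, namely $\eta^2_0(0,s)=c_l s^{-l}$ with $c_l=(-i)^l\frac{(2l)!}{2^l\,l!}$, and $B(s,y)=\frac1{2\lambda}\big(y^{\lambda+\frac12}s^{-\lambda+\frac12}-s^{\lambda+\frac12}y^{-\lambda+\frac12}\big)$. For $\operatorname{Im}\omega\le0$ put $\eta^2=\sum_{n\ge0}\eta^2_n$ with $\eta^2_{n+1}(s)=\int_s^\infty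 B(s,y)W(y)\eta^2_n(y)\,dy$; for $\operatorname{Im}\omega>0$ put $\eta^2(\omega,s)=\overline{\eta^2(\bar\omega,s)}$. *The kernel.* Let $\gamma^i(u)=\eta^i(s(u))/r(u)$ for $i=1,2$, let $w(f,g)=fg'-f'g$, and $$h(\omega,u,v)=-\frac1{w(\gamma^1,\gamma^2)}\begin{cases}\gamma^1(u)\gamma^2(v),&u\le v,\\ \gamma^1(v)\gamma^2(u),&v<u.\end{cases}$$ **Proposition.** For every such $T,K$, every $l\ge 0$ and every $\omega\in\mathbb C$: 1. For every $s>0$, the integrals defining $\eta^1_n(s)$ and (for $\operatorname{Im}\omega\le0$) $\eta^2_n(s)$ converge absolutely, and so do the series $\sum_n\eta^1_n(s)$ and (for $\operatorname{Im}\omega\le0$) $\sum_n\eta^2_n(s)$. 2. $\eta^1(s)\,s^{-\lambda-1/2}\to1$ as $s\searrow0$. As $s\to\infty$: $\eta^2(s)e^{i\omega s}\to1$ if $\operatorname{Im}\omega\le0$, $\omega\neq0$; $\eta^2(s)e^{-i\omega s}\to1$ if $\operatorname{Im}\omega>0$; and $\eta^2(s)s^l\to c_l$ if $\omega=0$. 3.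 $\gamma^1,\gamma^2\in C^2(-\infty,0)$, and both solve $-\gamma''-\omega^2r^4\gamma+\frac{r^2}{T^2}l(l+1)\gamma=0$ on $(-\infty,0)$, where $r=r(u)$ and $T=T(r(u))$. 4. $w(\gamma^1,\gamma^2)$ is a nonzero constant on $(-\infty,0)$. 5. For every complex-valued $\gamma\in C_0^\infty(-\infty,0)$ and every $u<0$, the following integral converges absolutely and $$\int_{-\infty}^0h(\omega,u,v)\Big(-\partial_v^2-r^4(v)\omega^2+\frac{r^2(v)}{T^2(r(v))}l(l+1)\Big)\gamma(v)\,dv=\gamma(u).$$ -/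

import Mathlib

open Set Filter Topology MeasureTheory

noncomputable section

namespace ParticleLike

/-- The metric coefficients `T`, `K` of a particle-like geometry
`ds² = -T⁻² dt² + K² dr² + r² (dθ² + sin² θ dφ²)`: they are smooth and positive on `[0, ∞)`
(only their values there matter), even to first order at the centre with `K 0 = 1`, and
asymptotically flat. -/
structure IsParticleLike (T K : ℝ → ℝ) : Prop where
  smooth_T : ContDiffOn ℝ ((⊤ : ℕ∞) : WithTop ℕ∞) T (Ici 0)
  smooth_K : ContDiffOn ℝ ((⊤ : ℕ∞) : WithTop ℕ∞) K (Ici 0)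
  T_pos : ∀ r, 0 ≤ r → 0 < T r
  K_pos : ∀ r, 0 ≤ r → 0 < K r
  K_zero : K 0 = 1
  deriv_T_zero : derivWithin T (Ici 0) 0 = 0
  deriv_K_zero : derivWithin K (Ici 0) 0 = 0
  T_far : (fun r => T r - 1) =O[atTop] (fun r => 1 / r)
  K_far : (fun r => K r - 1) =O[atTop] (fun r => 1 / r)
  TK_far : (fun r => derivWithin T (Ici 0) r / T r + derivWithin K (Ici 0) r / K r)
    =O[atTop] (fun r => 1 / r ^ 2)

/-! ### Coordinates -/

/-- `u(r) = -∫_r^∞ K T / x² dx`, mapping `(0, ∞)` onto `(-∞, 0)`. -/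
def uCoord (T K : ℝ → ℝ) (r : ℝ) : ℝ := -∫ x in Ioi r, K x * T x / x ^ 2

/-- The radius `r(u) > 0` as a function of `u < 0`: the inverse of `uCoord`. -/
def rOfU (T K : ℝ → ℝ) (u : ℝ) : ℝ := Function.invFunOn (uCoord T K) (Ioi 0) u

/-- `s(u) = ∫_{-∞}^u r(x)² dx`, mapping `(-∞, 0)` onto `(0, ∞)`. -/
def sCoord (T K : ℝ → ℝ) (u : ℝ) : ℝ := ∫ x in Iic u, rOfU T K x ^ 2

/-- The radius `r > 0` as a function of `s > 0`: the inverse of `r ↦ s(u(r))`. -/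
def rOfS (T K : ℝ → ℝ) (s : ℝ) : ℝ :=
  Function.invFunOn (fun r => sCoord T K (uCoord T K r)) (Ioi 0) s

/-! ### Bessel and Hankel functions -/

/-- The Bessel function of the first kind `J_ν(z)`, principal branch.  (Where `Γ` has a pole,
Mathlib's `Complex.Gamma` is `0`, so that the coefficient is `0`, as it should be.) -/
def besselJ (ν z : ℂ) : ℂ :=
  (z / 2) ^ ν * ∑' k : ℕ, (-1) ^ k / ((k.factorial : ℂ) * Complex.Gamma (k + ν + 1))
    * (z / 2) ^ (2 * k)

/-- The Hankel function of the second kind `H_ν^{(2)}(z)`, principal branch, for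
non-integer order `ν` (only half-integer orders are used). -/
def hankel2 (ν z : ℂ) : ℂ :=
  (besselJ (-ν) z - Complex.exp (Real.pi * ν * Complex.I) * besselJ ν z)
    / (-Complex.I * Complex.sin (Real.pi * ν))

/-- `λ = l + 1/2`. -/
def lam (l : ℕ) : ℂ := (l : ℂ) + 1 / 2

/-! ### The mode equation in the variable `s` -/

/-- The perturbation
`W = l (l + 1) (1 / (r² T²) - 1 / s²) - (T' / T + K' / K) / (r T² K²)`, where `r = r(s)`.
In the variable `s` the mode equation is `η'' + (ω² - l (l + 1) / s²) η = W η`. -/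
def pertW (T K : ℝ → ℝ) (l : ℕ) (s : ℝ) : ℝ :=
  let r := rOfS T K s
  (l : ℝ) * (l + 1) * (1 / (r ^ 2 * T r ^ 2) - 1 / s ^ 2)
    - 1 / (r * T r ^ 2 * K r ^ 2)
      * (derivWithin T (Ici 0) r / T r + derivWithin K (Ici 0) r / K r)

/-- The unperturbed solution
`η¹₀(μ, ω, s) = (2/ω)^μ Γ(μ + 1) s^{1/2} J_μ(ω s)`, normalised by `η¹₀ ~ s^{μ + 1/2}` as `s → 0`;
at `ω = 0` its limit `s^{μ + 1/2}`.  The factor `(2/ω)^μ` is written `(ω/2)^{-μ}`: with principal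
branches its branch cut then cancels that of `J_μ`. -/
def eta1Lead (μ ω : ℂ) (s : ℝ) : ℂ :=
  if ω = 0 then (s : ℂ) ^ (μ + 1 / 2)
  else (ω / 2) ^ (-μ) * Complex.Gamma (μ + 1) * (s : ℂ) ^ (1 / 2 : ℂ) * besselJ μ (ω * s)

/-- The Green's function `G(λ, ω, s, y)`, in the range `0 < y < s`; it is `0` for `y > s`. -/
def greenG (l : ℕ) (ω : ℂ) (s y : ℝ) : ℂ :=
  1 / (2 * lam l) * (eta1Lead (lam l) ω s * eta1Lead (-lam l) ω y
    - eta1Lead (-lam l) ω s * eta1Lead (lam l) ω y)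

/-- The terms `η¹ₙ` of the perturbation series of `η¹`. -/
def eta1Term (T K : ℝ → ℝ) (l : ℕ) (ω : ℂ) : ℕ → ℝ → ℂ
  | 0, s => eta1Lead (lam l) ω s
  | n + 1, s => ∫ y in Ioo 0 s, greenG l ω s y * (pertW T K l y : ℂ) * eta1Term T K l ω n y

/-- The solution `η¹(λ, ω, s)`, with boundary condition at `s = 0`. -/
def eta1 (T K : ℝ → ℝ) (l : ℕ) (ω : ℂ) (s : ℝ) : ℂ := ∑' n, eta1Term T K l ω n s

/-- The limit as `ω → 0` of `ω^{λ - 1/2} η²₀(λ, ω, 1)`, namely `(-i)^l (2l)! / (2^l l!)`. -/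
def eta2ZeroConst (l : ℕ) : ℂ :=
  (-Complex.I) ^ l * ((2 * l).factorial : ℂ) / (2 ^ l * (l.factorial : ℂ))

/-- The unperturbed solution
`η²₀(λ, ω, s) = (π ω s / 2)^{1/2} e^{-iπ(λ + 1/2)/2} H_λ^{(2)}(ω s)`; at `ω = 0`, the limit
of `ω^{λ - 1/2} η²₀(λ, ω, s)`. -/
def eta2Lead (l : ℕ) (ω : ℂ) (s : ℝ) : ℂ :=
  if ω = 0 then eta2ZeroConst l / (s : ℂ) ^ l
  else (1 / 2 * Real.pi * ω * s) ^ (1 / 2 : ℂ)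
    * Complex.exp (-(Complex.I * Real.pi / 2) * (lam l + 1 / 2)) * hankel2 (lam l) (ω * s)

/-- The Green's function `B(λ, ω, s, y)`, in the range `0 < s < y`; it is `0` for `y < s`.
At `ω = 0` it is given by its limit. -/
def greenB (l : ℕ) (ω : ℂ) (s y : ℝ) : ℂ :=
  if ω = 0 then
    1 / (2 * lam l) * ((y : ℂ) ^ (lam l + 1 / 2) * (s : ℂ) ^ (-lam l + 1 / 2)
      - (s : ℂ) ^ (lam l + 1 / 2) * (y : ℂ) ^ (-lam l + 1 / 2))
  else Complex.I / (2 * ω) * (eta2Lead l ω y * eta2Lead l (-ω) s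
    - eta2Lead l ω s * eta2Lead l (-ω) y)

/-- The terms `η²ₙ` of the perturbation series of `η²` for `Im ω ≤ 0`. -/
def eta2Term (T K : ℝ → ℝ) (l : ℕ) (ω : ℂ) : ℕ → ℝ → ℂ
  | 0, s => eta2Lead l ω s
  | n + 1, s => ∫ y in Ioi s, greenB l ω s y * (pertW T K l y : ℂ) * eta2Term T K l ω n y

/-- The solution `η²(λ, ω, s)`, with boundary condition at `s = ∞`: the sum of the series for
`Im ω ≤ 0`, and the complex conjugate of `η²(λ, conj ω, s)` for `Im ω > 0`.  At `ω = 0`, where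
`η²` itself is singular, this is the extension of `ω^{λ - 1/2} η²`. -/
def eta2 (T K : ℝ → ℝ) (l : ℕ) (ω : ℂ) (s : ℝ) : ℂ :=
  if ω.im ≤ 0 then ∑' n, eta2Term T K l ω n s
  else starRingEnd ℂ (∑' n, eta2Term T K l (starRingEnd ℂ ω) n s)

/-! ### The mode equation in the variable `u` and the kernel `h` -/

/-- `γ¹`, given by `η¹(s(u)) = r(u) γ¹(u)`. -/
def gamma1 (T K : ℝ → ℝ) (l : ℕ) (ω : ℂ) (u : ℝ) : ℂ :=
  eta1 T K l ω (sCoord T K u) / (rOfU T K u : ℂ)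

/-- `γ²`, given by `η²(s(u)) = r(u) γ²(u)`. -/
def gamma2 (T K : ℝ → ℝ) (l : ℕ) (ω : ℂ) (u : ℝ) : ℂ :=
  eta2 T K l ω (sCoord T K u) / (rOfU T K u : ℂ)

/-- The operator `-∂² - r⁴ ω² + r² T⁻² l (l + 1)` on functions of `u < 0`. -/
def modeOp (T K : ℝ → ℝ) (l : ℕ) (ω : ℂ) (f : ℝ → ℂ) (u : ℝ) : ℂ :=
  -deriv (deriv f) u - (rOfU T K u : ℂ) ^ 4 * ω ^ 2 * f u
    + ((rOfU T K u ^ 2 / T (rOfU T K u) ^ 2 : ℝ) : ℂ) * ((l : ℂ) * (l + 1)) * f u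

/-- The Wronskian `w(f, g) = f g' - f' g`. -/
def wronskian (f g : ℝ → ℂ) (u : ℝ) : ℂ := f u * deriv g u - deriv f u * g u

/-- The kernel `h(ω, u, v)`. -/
def kernelH (T K : ℝ → ℝ) (l : ℕ) (ω : ℂ) (u v : ℝ) : ℂ :=
  -(1 / wronskian (gamma1 T K l ω) (gamma2 T K l ω) u)
    * (if u ≤ v then gamma1 T K l ω u * gamma2 T K l ω v
      else gamma1 T K l ω v * gamma2 T K l ω u)

end ParticleLike

end

/-!
The mode equation is a perturbation of a Bessel equation, solved by Volterra iteration from either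
end, and an energy comparison shows that the two solutions obtained are linearly independent.

*Unperturbed solutions.*  Only Bessel functions of half-integer order occur.  With the entire
functions `besselCore μ` they become `freeSol`, an integer power times an entire function, and
`outSol`, which contains no fractional powers either.  The derivative and the three-term recurrence
of `besselCore` give the differential equations, and the recurrence together with
`outSol 0 z = e^{-iz}` gives the behaviour of `outSol` at infinity by induction on `l`.  The
Wronskians of the unperturbed solutions are constant and are read off at the end where the
asymptotics are known.

*Perturbation series.*  Both series are instances of one statement about Volterra equations,
`IsVolterraBound.solution`: if the potential, weighted by the sizes of the two unperturbed
solutions, is bounded by `m / 2` and `m` has the primitive `Φ`, then the `n`-th term is at most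
a multiple of `Φ ^ n / n!`, the sum solves the perturbed equation, and its distance to the leading
term is controlled by `Φ`.  This applies because `∫_{-∞}^u r² = ∫_0^{r(u)} K T` (`sCoord_eq`), so that
`s - r T = O(r²)` at the centre (this uses `K 0 = 1`) and `s - r = O(√r)` at infinity; hence
`pertW` is `O(1 / s)` at the centre and `O(s^{-5/2})` at infinity (`isShortRange_pertW`).  The true
decay at infinity is slightly better, but an exponent below `-2` is all that is needed, and the
power avoids logarithms.

*Back to `u`.*  A direct computation (`isRadialSol_radial`) shows that `γ = η(s(u)) / r(u)` solves
the mode equation in `u`.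

*The Wronskian does not vanish.*  For a suitable constant `κ` depending on `ω` the energy
`Re (κ conj(γ) γ')` is nondecreasing along every solution `γ`.  It tends to `0` for `γ¹` as
`u → -∞`, so it is nonnegative there, whereas for `γ²` it is negative everywhere: its limit as
`u → 0` is negative if `ω` is real and nonzero (the flux of the outgoing wave), and is zero
otherwise, in which case it could vanish at a point only if `γ²` were constant, hence zero, from
there on (`exists_energy_multiplier`, `exists_energy_gamma2_neg`).  Proportional solutions have
energies of the same sign, so `γ¹` and `γ²` are independent (`wronskian_gamma_ne_zero`).

*The kernel.*  For a solution `f` of the mode equation, `f` times the mode operator applied to a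
test function `γ` is the derivative of `f' γ - f γ'`.  Integrating on both sides of `u` leaves the
boundary terms at `u`, which combine to the Wronskian (`kernelH_reproduces`).
-/

namespace ParticleLike

/-! ### The entire function underlying the Bessel functions -/

/-- The entire function `∑ (-1)^k x^k / (k! Γ(k + μ + 1))`, so that
`J_μ(z) = (z / 2)^μ besselCore μ ((z / 2)²)`. -/
noncomputable def besselCore (μ x : ℂ) : ℂ :=
  ∑' k : ℕ, (-1) ^ k / ((k.factorial : ℂ) * Complex.Gamma (k + μ + 1)) * x ^ k

theorem besselJ_eq (ν z : ℂ) : besselJ ν z = (z / 2) ^ ν * besselCore ν ((z / 2) ^ 2) := by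
  simp only [besselJ, besselCore, pow_mul]

/-- Differentiation of the power series shifts the index `μ` by one. -/
theorem besselCore_coeff_succ (μ : ℂ) (k : ℕ) :
    (-1 : ℂ) ^ (k + 1) / (((k + 1).factorial : ℂ) * Complex.Gamma ((k + 1 : ℕ) + μ + 1)) * (k + 1)
      = -((-1 : ℂ) ^ k / ((k.factorial : ℂ) * Complex.Gamma (k + (μ + 1) + 1))) := by
  have h1 : ((k + 1 : ℕ) : ℂ) + μ + 1 = k + (μ + 1) + 1 := by push_cast; ring
  rw [h1, Nat.factorial_succ]
  push_cast
  simp only [div_eq_mul_inv, mul_inv, pow_succ]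
  field_simp

theorem summable_besselCore (μ x : ℂ) :
    Summable fun k : ℕ =>
      (-1 : ℂ) ^ k / ((k.factorial : ℂ) * Complex.Gamma (k + μ + 1)) * x ^ k := by
  obtain ⟨N, hN⟩ := exists_nat_gt (‖μ‖ + 2 * ‖x‖)
  refine summable_of_ratio_norm_eventually_le (r := 1 / 2) (by norm_num) ?_
  filter_upwards [eventually_ge_atTop N] with k hk
  have hk' : ‖μ‖ + 2 * ‖x‖ < k := hN.trans_le (by exact_mod_cast hk)
  have h1 : 2 * ‖x‖ ≤ ‖(k : ℂ) + μ + 1‖ := by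
    have := norm_sub_norm_le ((k + 1 : ℕ) : ℂ) (-μ)
    rw [norm_neg, Complex.norm_natCast, sub_neg_eq_add] at this
    have e : ((k + 1 : ℕ) : ℂ) + μ = k + μ + 1 := by push_cast; ring
    rw [e] at this
    push_cast at this
    linarith
  have h3 : (Complex.Gamma (k + μ + 1))⁻¹
      = (k + μ + 1) * (Complex.Gamma ((k + 1 : ℕ) + μ + 1))⁻¹ := by
    rw [Complex.one_div_Gamma_eq_self_mul_one_div_Gamma_add_one]
    congr 3; push_cast; ring
  rw [norm_mul, norm_mul, norm_div, norm_div, norm_mul, norm_mul]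
  simp only [norm_pow, norm_neg, norm_one, one_pow, one_div, mul_inv, ← norm_inv]
  rw [h3, Nat.factorial_succ]
  simp only [norm_mul, norm_inv, Complex.norm_natCast, Nat.cast_mul, mul_inv]
  have hk1 : ((k + 1 : ℕ) : ℝ)⁻¹ ≤ 1 :=
    inv_le_one_of_one_le₀ (by push_cast; linarith [(Nat.cast_nonneg k : (0 : ℝ) ≤ k)])
  set A := ((k.factorial : ℝ))⁻¹
  set B := ‖Complex.Gamma ((k + 1 : ℕ) + μ + 1)‖⁻¹
  calc ((k + 1 : ℕ) : ℝ)⁻¹ * A * B * ‖x‖ ^ (k + 1)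
      = ((k + 1 : ℕ) : ℝ)⁻¹ * ((A * B * ‖x‖ ^ k) * ‖x‖) := by ring
    _ ≤ 1 * ((A * B * ‖x‖ ^ k) * ‖x‖) := by gcongr
    _ ≤ 1 * ((A * B * ‖x‖ ^ k) * (2⁻¹ * ‖(k : ℂ) + μ + 1‖)) := by gcongr; linarith
    _ = 2⁻¹ * (A * (‖(k : ℂ) + μ + 1‖ * B) * ‖x‖ ^ k) := by ring

theorem hasDerivAt_besselCore (μ x : ℂ) :
    HasDerivAt (besselCore μ) (-besselCore (μ + 1) x) x := by
  set c : ℕ → ℂ := fun k => (-1 : ℂ) ^ k / ((k.factorial : ℂ) * Complex.Gamma (k + μ + 1)) with hc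
  set U := Metric.ball (0 : ℂ) (‖x‖ + 1)
  have hx : x ∈ U := by simp [U]
  have hs : Summable fun k : ℕ => ‖c k‖ * (‖x‖ + 1) ^ k := by
    have := (summable_besselCore μ ((‖x‖ + 1 : ℝ) : ℂ)).norm
    refine this.congr fun k => ?_
    have h0 : (0 : ℝ) ≤ ‖x‖ + 1 := by positivity
    rw [norm_mul, norm_pow, Complex.norm_real, Real.norm_of_nonneg h0]
  have hd : ∀ k : ℕ, DifferentiableOn ℂ (fun w => c k * w ^ k) U := fun k =>
    ((differentiable_id.pow k).const_mul (c k)).differentiableOn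
  have hle : ∀ (k : ℕ) (w : ℂ), w ∈ U → ‖c k * w ^ k‖ ≤ ‖c k‖ * (‖x‖ + 1) ^ k := by
    intro k w hw
    rw [norm_mul, norm_pow]
    have : ‖w‖ ≤ ‖x‖ + 1 := (mem_ball_zero_iff.1 hw).le
    gcongr
  have h1 := Complex.differentiableOn_tsum_of_summable_norm hs hd Metric.isOpen_ball hle
  have h2 := Complex.hasSum_deriv_of_summable_norm hs hd Metric.isOpen_ball hle hx
  have h3 : HasDerivAt (besselCore μ) (deriv (besselCore μ) x) x :=
    ((h1 x hx).differentiableAt (Metric.isOpen_ball.mem_nhds hx)).hasDerivAt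
  have h4 : HasSum (fun k => deriv (fun w => c k * w ^ k) x) (-besselCore (μ + 1) x) := by
    rw [← hasSum_nat_add_iff' 1]
    have h5 : HasSum _ (-besselCore (μ + 1) x) := (summable_besselCore (μ + 1) x).hasSum.neg
    simp only [Finset.range_one, Finset.sum_singleton, pow_zero, mul_one, deriv_const, sub_zero]
    refine h5.congr_fun fun k => ?_
    rw [deriv_const_mul _ (differentiableAt_pow _)]
    simp only [deriv_pow_field, Nat.add_sub_cancel]
    rw [← neg_mul, ← besselCore_coeff_succ]
    simp only [hc]
    push_cast
    ring
  have h6 := h2.unique h4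
  have h7 : deriv (besselCore μ) x = -besselCore (μ + 1) x := h6
  rwa [h7] at h3

theorem continuous_besselCore (μ : ℂ) : Continuous (besselCore μ) :=
  continuous_iff_continuousAt.2 fun x => (hasDerivAt_besselCore μ x).continuousAt

/-- The three-term recurrence of the Bessel functions. -/
theorem besselCore_recurrence (μ x : ℂ) :
    besselCore μ x = (μ + 1) * besselCore (μ + 1) x - x * besselCore (μ + 2) x := by
  have h1 := (summable_besselCore (μ + 1) x).hasSum.mul_left (μ + 1)
  have h2 := (summable_besselCore (μ + 2) x).hasSum.mul_left x
  have h3 := (summable_besselCore μ x).hasSum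
  have h4 : HasSum (fun k : ℕ => (μ + 1) * ((-1 : ℂ) ^ k / ((k.factorial : ℂ)
      * Complex.Gamma (k + (μ + 1) + 1)) * x ^ k) - (-1 : ℂ) ^ k / ((k.factorial : ℂ)
      * Complex.Gamma (k + μ + 1)) * x ^ k) (x * besselCore (μ + 2) x) := by
    have key : ∀ k : ℕ, (μ + 1) * ((-1 : ℂ) ^ k / ((k.factorial : ℂ)
      * Complex.Gamma (k + (μ + 1) + 1)) * x ^ k) - (-1 : ℂ) ^ k / ((k.factorial : ℂ)
      * Complex.Gamma (k + μ + 1)) * x ^ k = -((-1 : ℂ) ^ k / ((k.factorial : ℂ)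
      * Complex.Gamma (k + (μ + 1) + 1)) * k * x ^ k) := by
      intro k
      have h := Complex.one_div_Gamma_eq_self_mul_one_div_Gamma_add_one (k + μ + 1)
      have e : (k : ℂ) + (μ + 1) + 1 = k + μ + 1 + 1 := by ring
      simp only [div_eq_mul_inv, mul_inv, e]
      rw [h]
      ring
    simp only [key]
    rw [← hasSum_nat_add_iff' 1]
    simp only [Finset.range_one, Finset.sum_singleton, Nat.cast_zero, mul_zero, zero_mul, neg_zero,
      sub_zero]
    refine h2.congr_fun fun k => ?_
    have := besselCore_coeff_succ (μ + 1) k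
    have e : μ + 1 + 1 = μ + 2 := by ring
    rw [e] at this
    push_cast at this ⊢
    linear_combination (-x ^ (k + 1)) * this
  have h5 := (h1.sub h3).unique h4
  have h5' : (μ + 1) * besselCore (μ + 1) x - besselCore μ x = x * besselCore (μ + 2) x := h5
  linear_combination -h5'

/-- The values of the Gamma function at half-integers, in the form in which they identify
`besselCore (-1 / 2)` with the cosine. -/
theorem Gamma_nat_add_half_mul_factorial (k : ℕ) :
    (k.factorial : ℂ) * Complex.Gamma (k + 1 / 2) * 4 ^ k
      = (2 * k).factorial * (Real.sqrt Real.pi : ℝ) := by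
  induction k with
  | zero =>
    simp only [Nat.factorial_zero, Nat.cast_one, Nat.cast_zero, zero_add, one_mul, pow_zero, mul_one,
      mul_zero]
    rw [Complex.Gamma_one_half_eq, Real.sqrt_eq_rpow, Complex.ofReal_cpow Real.pi_pos.le]
    norm_num
  | succ k ih =>
    have e : ((k + 1 : ℕ) : ℂ) + 1 / 2 = (k + 1 / 2) + 1 := by push_cast; ring
    have hne : (k : ℂ) + 1 / 2 ≠ 0 := by
      intro h
      have := congrArg Complex.re h
      simp at this
      linarith
    rw [e, Complex.Gamma_add_one _ hne, show 2 * (k + 1) = 2 * k + 1 + 1 by ring,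
      Nat.factorial_succ, Nat.factorial_succ, Nat.factorial_succ]
    push_cast
    linear_combination (4 * (k + 1) * (k + 1 / 2 : ℂ)) * ih

/-- The Bessel function of order `-1/2` is elementary. -/
theorem besselCore_neg_half (z : ℂ) :
    (Real.sqrt Real.pi : ℝ) * besselCore (-1 / 2) ((z / 2) ^ 2) = Complex.cos z := by
  have h1 := (summable_besselCore (-1 / 2) ((z / 2) ^ 2)).hasSum.mul_left
    ((Real.sqrt Real.pi : ℝ) : ℂ)
  refine h1.unique ?_
  refine (Complex.hasSum_cos' z).congr_fun fun k => ?_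
  have h2 := Gamma_nat_add_half_mul_factorial k
  have e : (k : ℂ) + -1 / 2 + 1 = k + 1 / 2 := by ring
  have hf : ((2 * k).factorial : ℂ) ≠ 0 := by exact_mod_cast Nat.factorial_ne_zero _
  have hp : ((Real.sqrt Real.pi : ℝ) : ℂ) ≠ 0 := by
    exact_mod_cast (Real.sqrt_pos.2 Real.pi_pos).ne'
  have h3 : (k.factorial : ℂ) * Complex.Gamma (k + 1 / 2) ≠ 0 := by
    intro h0
    rw [h0, zero_mul] at h2
    exact mul_ne_zero hf hp h2.symm
  rw [e, ← pow_mul, div_pow, mul_pow, pow_mul Complex.I, Complex.I_sq, pow_mul 2 2 k,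
    show (2 : ℂ) ^ 2 = 4 by norm_num]
  generalize (k.factorial : ℂ) * Complex.Gamma (k + 1 / 2) = P at h2 h3 ⊢
  field_simp
  linear_combination (-z ^ (2 * k)) * h2

/-! ### Unperturbed solutions at the centre -/

/-- The solution `z^p Γ(p + 1/2) besselCore (p - 1/2) ((ω z / 2)²)` of
`η'' = (p (p - 1) / z² - ω²) η`, normalised by `η ~ z^p` as `z → 0`.  The indices `p = l + 1`
and `p = -l` give `η¹₀(λ, ω, ·)` and `η¹₀(-λ, ω, ·)`. -/
noncomputable def freeSol (p : ℤ) (ω z : ℂ) : ℂ :=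
  z ^ p * (Complex.Gamma (p + 1 / 2) * besselCore (p - 1 / 2) ((ω * z / 2) ^ 2))

/-- The derivative of `freeSol p ω` away from `0`. -/
noncomputable def freeSolDeriv (p : ℤ) (ω z : ℂ) : ℂ :=
  z ^ (p - 1) * (Complex.Gamma (p + 1 / 2) * (p * besselCore (p - 1 / 2) ((ω * z / 2) ^ 2)
    - ω ^ 2 * z ^ 2 / 2 * besselCore (p + 1 / 2) ((ω * z / 2) ^ 2)))

theorem hasDerivAt_besselCore_sq (μ ω z : ℂ) :
    HasDerivAt (fun z => besselCore μ ((ω * z / 2) ^ 2))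
      (-(ω ^ 2 * z / 2) * besselCore (μ + 1) ((ω * z / 2) ^ 2)) z := by
  have h1 : HasDerivAt (fun z : ℂ => (ω * z / 2) ^ 2) (ω ^ 2 * z / 2) z := by
    have h0 : HasDerivAt (fun z : ℂ => ω * z / 2) (ω / 2) z := by
      simpa using ((hasDerivAt_id z).const_mul ω).div_const 2
    refine (h0.fun_pow 2).congr_deriv ?_
    push_cast; ring
  refine ((hasDerivAt_besselCore μ _).comp z h1).congr_deriv ?_
  ring

theorem hasDerivAt_freeSol (p : ℤ) (ω : ℂ) {z : ℂ} (hz : z ≠ 0) :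
    HasDerivAt (freeSol p ω) (freeSolDeriv p ω z) z := by
  have h1 := hasDerivAt_zpow p z (Or.inl hz)
  have h2 := (hasDerivAt_besselCore_sq (p - 1 / 2) ω z).const_mul (Complex.Gamma (p + 1 / 2))
  refine (h1.mul h2).congr_deriv ?_
  have e : z ^ p = z ^ (p - 1) * z := by rw [← zpow_add_one₀ hz]; congr 1; ring
  have e2 : (p : ℂ) - 1 / 2 + 1 = p + 1 / 2 := by ring
  rw [freeSolDeriv, e, e2]
  ring

theorem hasDerivAt_freeSolDeriv (p : ℤ) (ω : ℂ) {z : ℂ} (hz : z ≠ 0) :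
    HasDerivAt (freeSolDeriv p ω) ((p * (p - 1) / z ^ 2 - ω ^ 2) * freeSol p ω z) z := by
  have h1 := hasDerivAt_zpow (p - 1) z (Or.inl hz)
  have h2 := (hasDerivAt_besselCore_sq (p - 1 / 2) ω z).const_mul (p : ℂ)
  have h3 := hasDerivAt_besselCore_sq (p + 1 / 2) ω z
  have h4 : HasDerivAt (fun z : ℂ => ω ^ 2 * z ^ 2 / 2) (ω ^ 2 * z) z := by
    refine (((hasDerivAt_pow 2 z).const_mul (ω ^ 2)).div_const 2).congr_deriv ?_
    push_cast; ring
  refine (h1.mul ((h2.sub (h4.mul h3)).const_mul (Complex.Gamma (p + 1 / 2)))).congr_deriv ?_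
  have e0 : z ^ (p - 1) = z ^ (p - 1 - 1) * z := by rw [← zpow_add_one₀ hz]; congr 1; ring
  have e : z ^ p = z ^ (p - 1 - 1) * z * z := by
    rw [← e0, ← zpow_add_one₀ hz]; congr 1; ring
  have e2 : (p : ℂ) - 1 / 2 + 1 = p + 1 / 2 := by ring
  have e3 : (p : ℂ) - 1 / 2 + 2 = p + 1 / 2 + 1 := by ring
  have hr := besselCore_recurrence (p - 1 / 2) ((ω * z / 2) ^ 2)
  rw [e2, e3] at hr
  rw [freeSol, e, e0, e2, hr]
  push_cast
  simp only [Pi.sub_apply, Pi.mul_apply]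
  rw [hr]
  field_simp
  ring

theorem besselCore_zero (μ : ℂ) : besselCore μ 0 = (Complex.Gamma (μ + 1))⁻¹ := by
  rw [besselCore, tsum_eq_single 0]
  · simp
  · intro k hk; simp [hk]

theorem Gamma_int_add_half_ne_zero (p : ℤ) : Complex.Gamma (p + 1 / 2) ≠ 0 := by
  refine Complex.Gamma_ne_zero fun m h => ?_
  have h1 : (2 * p + 1 : ℂ) = -(2 * m) := by linear_combination 2 * h
  have h2 : (2 * p + 1 : ℤ) = -(2 * m) := by exact_mod_cast h1
  omega

theorem eta1Lead_eq_freeSol (p : ℤ) (ω : ℂ) {s : ℝ} (hs : 0 < s) :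
    eta1Lead (p - 1 / 2) ω s = freeSol p ω s := by
  have hs0 : (s : ℂ) ≠ 0 := by exact_mod_cast hs.ne'
  have e1 : (p : ℂ) - 1 / 2 + 1 = p + 1 / 2 := by ring
  rw [eta1Lead, freeSol]
  split_ifs with h
  · rw [h, zero_mul, zero_div, zero_pow two_ne_zero, besselCore_zero, e1,
      mul_inv_cancel₀ (Gamma_int_add_half_ne_zero p), mul_one, sub_add_cancel,
      Complex.cpow_intCast]
  · have hw : ω / 2 ≠ 0 := div_ne_zero h two_ne_zero
    have e2 : (ω * s / 2) ^ ((p : ℂ) - 1 / 2)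
        = (ω / 2) ^ ((p : ℂ) - 1 / 2) * (s : ℂ) ^ ((p : ℂ) - 1 / 2) := by
      have e3 : ω * s / 2 = s * (ω / 2) := by ring
      rw [e3, Complex.cpow_def_of_ne_zero (mul_ne_zero hs0 hw), Complex.log_ofReal_mul hs hw,
        Complex.cpow_def_of_ne_zero hw, Complex.cpow_def_of_ne_zero hs0, ← Complex.exp_add,
        Complex.ofReal_log hs.le]
      congr 1; ring
    have e4 : (s : ℂ) ^ (1 / 2 : ℂ) * (s : ℂ) ^ ((p : ℂ) - 1 / 2) = (s : ℂ) ^ p := by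
      rw [← Complex.cpow_add _ _ hs0, add_sub_cancel, Complex.cpow_intCast]
    have e5 : (ω / 2) ^ (-((p : ℂ) - 1 / 2)) * (ω / 2) ^ ((p : ℂ) - 1 / 2) = 1 := by
      rw [← Complex.cpow_add _ _ hw, neg_add_cancel, Complex.cpow_zero]
    rw [besselJ_eq, e2, e1, ← e4]
    linear_combination ((s : ℂ) ^ (1 / 2 : ℂ) * (s : ℂ) ^ ((p : ℂ) - 1 / 2)
      * Complex.Gamma (p + 1 / 2) * besselCore (p - 1 / 2) ((ω * s / 2) ^ 2)) * e5

theorem eta1Lead_lam (l : ℕ) (ω : ℂ) {s : ℝ} (hs : 0 < s) :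
    eta1Lead (lam l) ω s = freeSol (l + 1) ω s := by
  rw [← eta1Lead_eq_freeSol _ _ hs, lam]
  congr 1; push_cast; ring

theorem eta1Lead_neg_lam (l : ℕ) (ω : ℂ) {s : ℝ} (hs : 0 < s) :
    eta1Lead (-lam l) ω s = freeSol (-l) ω s := by
  rw [← eta1Lead_eq_freeSol _ _ hs, lam]
  congr 1; push_cast; ring

theorem continuous_besselCore_sq (μ ω : ℂ) :
    Continuous fun s : ℝ => besselCore μ ((ω * s / 2) ^ 2) :=
  (continuous_besselCore μ).comp (by fun_prop)

theorem exists_bound_freeSol (p : ℤ) (ω : ℂ) (R : ℝ) :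
    ∃ C : ℝ, 0 < C ∧ ∀ s : ℝ, 0 < s → s ≤ R →
      ‖freeSol p ω s‖ ≤ C * s ^ p ∧ ‖freeSolDeriv p ω s‖ ≤ C * s ^ (p - 1) := by
  have c1 : Continuous fun s : ℝ =>
      Complex.Gamma (p + 1 / 2) * besselCore (p - 1 / 2) ((ω * s / 2) ^ 2) :=
    continuous_const.mul (continuous_besselCore_sq _ _)
  have c2 : Continuous fun s : ℝ => Complex.Gamma (p + 1 / 2)
      * (p * besselCore (p - 1 / 2) ((ω * s / 2) ^ 2)
        - ω ^ 2 * (s : ℂ) ^ 2 / 2 * besselCore (p + 1 / 2) ((ω * s / 2) ^ 2)) := by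
    have h1 := continuous_besselCore_sq (p - 1 / 2) ω
    have h2 := continuous_besselCore_sq (p + 1 / 2) ω
    fun_prop
  obtain ⟨C1, h1⟩ := (isCompact_Icc (a := (0 : ℝ)) (b := R)).exists_bound_of_continuousOn
    c1.continuousOn
  obtain ⟨C2, h2⟩ := (isCompact_Icc (a := (0 : ℝ)) (b := R)).exists_bound_of_continuousOn
    c2.continuousOn
  refine ⟨max 1 (max C1 C2), by positivity, fun s hs hR => ⟨?_, ?_⟩⟩
  · rw [freeSol, norm_mul, norm_zpow, Complex.norm_real, Real.norm_of_nonneg hs.le, mul_comm]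
    gcongr
    exact (h1 s ⟨hs.le, hR⟩).trans (by simp)
  · rw [freeSolDeriv, norm_mul, norm_zpow, Complex.norm_real, Real.norm_of_nonneg hs.le, mul_comm]
    gcongr
    exact (h2 s ⟨hs.le, hR⟩).trans (by simp)

theorem tendsto_freeSol_div (p : ℤ) (ω : ℂ) :
    Tendsto (fun s : ℝ => freeSol p ω s * (s : ℂ) ^ (-p)) (𝓝[>] 0) (𝓝 1) := by
  have h0 := ((continuous_besselCore_sq (p - 1 / 2) ω).tendsto 0).const_mul
    (Complex.Gamma (p + 1 / 2))
  have e1 : (p : ℂ) - 1 / 2 + 1 = p + 1 / 2 := by ring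
  rw [Complex.ofReal_zero, mul_zero, zero_div, zero_pow two_ne_zero, besselCore_zero, e1,
      mul_inv_cancel₀ (Gamma_int_add_half_ne_zero p)] at h0
  refine (h0.mono_left nhdsWithin_le_nhds).congr' ?_
  filter_upwards [self_mem_nhdsWithin] with s hs
  have hs0 : (s : ℂ) ≠ 0 := by exact_mod_cast (ne_of_gt hs)
  rw [freeSol, mul_right_comm, zpow_neg, mul_inv_cancel₀ (zpow_ne_zero p hs0), one_mul]

/-! ### Unperturbed solutions at infinity -/

/-- The function `(π z / 2)^{1/2} e^{-iπ(λ + 1/2)/2} H_λ^{(2)}(z)` with `λ = l + 1/2`, written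
without fractional powers.  It equals `e^{-iz}` times a polynomial in `1 / z`, which is
why `outSol l (ω s)` is single-valued in `ω`. -/
noncomputable def outSol (l : ℕ) (z : ℂ) : ℂ :=
  (Real.sqrt Real.pi : ℝ) * (Complex.I ^ l * ((z / 2) ^ l)⁻¹ * besselCore (-l - 1 / 2) ((z / 2) ^ 2)
    + (-Complex.I) ^ (l + 1) * (z / 2) ^ (l + 1) * besselCore (l + 1 / 2) ((z / 2) ^ 2))

/-- The three-term recurrence of the Hankel functions of half-integer order; together with
`outSol_zero` and `outSol_one` it determines the behaviour of `outSol` at infinity. -/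
theorem outSol_recurrence (l : ℕ) {z : ℂ} (hz : z ≠ 0) :
    outSol (l + 2) z = outSol l z - Complex.I * (2 * l + 3) / z * outSol (l + 1) z := by
  have h1 := besselCore_recurrence (-l - 1 / 2 - 2) ((z / 2) ^ 2)
  have h2 := besselCore_recurrence (l + 1 / 2) ((z / 2) ^ 2)
  have e1 : -((l + 2 : ℕ) : ℂ) - 1 / 2 = -l - 1 / 2 - 2 := by push_cast; ring
  have e2 : -((l + 1 : ℕ) : ℂ) - 1 / 2 = -l - 1 / 2 - 2 + 1 := by push_cast; ring
  have e3 : ((l + 2 : ℕ) : ℂ) + 1 / 2 = l + 1 / 2 + 2 := by push_cast; ring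
  have e4 : ((l + 1 : ℕ) : ℂ) + 1 / 2 = l + 1 / 2 + 1 := by push_cast; ring
  rw [sub_add_cancel] at h1
  simp only [outSol, e1, e2, e3, e4]
  rw [h1, h2]
  simp only [pow_succ]
  have hI : Complex.I ^ 2 = -1 := Complex.I_sq
  have hI3 : Complex.I ^ 3 = -Complex.I := by rw [pow_succ, hI]; ring
  field_simp
  ring_nf
  simp only [hI, hI3]
  ring

theorem outSol_zero (z : ℂ) : outSol 0 z = Complex.exp (-(Complex.I * z)) := by
  have h : ∀ w : ℂ,
      (Real.sqrt Real.pi : ℝ) * besselCore (-1 / 2) ((1 * w / 2) ^ 2) = Complex.cos w := by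
    intro w; rw [one_mul]; exact besselCore_neg_half w
  have h1 := (hasDerivAt_besselCore_sq (-1 / 2) 1 z).const_mul ((Real.sqrt Real.pi : ℝ) : ℂ)
  simp only [h] at h1
  have h2 := h1.unique (Complex.hasDerivAt_cos z)
  have h3 := h z
  simp only [one_mul, one_pow] at h2 h3
  have e : (-1 / 2 : ℂ) + 1 = 1 / 2 := by norm_num
  have e' : (-0 - 1 / 2 : ℂ) = -1 / 2 := by norm_num
  rw [e] at h2
  rw [show -(Complex.I * z) = (-z) * Complex.I by ring, Complex.exp_mul_I, Complex.cos_neg,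
    Complex.sin_neg, outSol]
  simp only [pow_zero, inv_one, Nat.cast_zero, zero_add, pow_one, e']
  linear_combination h3 + Complex.I * h2

theorem hasDerivAt_outSol (l : ℕ) {z : ℂ} (hz : z ≠ 0) :
    HasDerivAt (outSol l) ((l + 1) / z * outSol l z - Complex.I * outSol (l + 1) z) z := by
  have hd (μ : ℂ) : HasDerivAt (fun z => besselCore μ ((z / 2) ^ 2))
      (-(z / 2) * besselCore (μ + 1) ((z / 2) ^ 2)) z := by
    have := hasDerivAt_besselCore_sq μ 1 z
    simpa only [one_mul, one_pow] using this
  have hz2 : z / 2 ≠ 0 := div_ne_zero hz two_ne_zero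
  have h0 : HasDerivAt (fun z : ℂ => z / 2) (1 / 2) z := (hasDerivAt_id z).div_const 2
  have h1 := ((h0.fun_pow l).fun_inv (pow_ne_zero l hz2)).const_mul (Complex.I ^ l)
  have h2 := (h0.fun_pow (l + 1)).const_mul ((-Complex.I) ^ (l + 1))
  refine (((h1.mul (hd (-l - 1 / 2))).add (h2.mul (hd (l + 1 / 2)))).const_mul
    ((Real.sqrt Real.pi : ℝ) : ℂ)).congr_deriv ?_
  have h3 := besselCore_recurrence (-l - 1 / 2 - 1) ((z / 2) ^ 2)
  have e1 : -((l + 1 : ℕ) : ℂ) - 1 / 2 = -l - 1 / 2 - 1 := by push_cast; ring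
  have e2 : -(l : ℂ) - 1 / 2 - 1 + 2 = -l - 1 / 2 + 1 := by ring
  have e4 : ((l + 1 : ℕ) : ℂ) + 1 / 2 = l + 1 / 2 + 1 := by push_cast; ring
  rw [sub_add_cancel, e2] at h3
  simp only [outSol, e1, e4]
  rw [h3]
  have hI : Complex.I ^ 2 = -1 := Complex.I_sq
  have hI3 : Complex.I ^ 3 = -Complex.I := by rw [pow_succ, hI]; ring
  -- the derivative of `z ^ l` involves `l - 1`, which truncates at `l = 0`
  rcases l with _ | l
  · simp
    field_simp
    ring_nf
    simp only [hI]
    ring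
  · simp only [Nat.add_sub_cancel, pow_succ]
    push_cast
    field_simp
    ring_nf
    simp only [hI, hI3]
    ring

/-- The derivative in terms of the lower index, obtained from the recurrence; `hasDerivAt_outSol`
and this formula combine to the second-order equation. -/
theorem hasDerivAt_outSol_succ (l : ℕ) {z : ℂ} (hz : z ≠ 0) :
    HasDerivAt (outSol (l + 1)) (-((l + 1) / z * outSol (l + 1) z) - Complex.I * outSol l z) z := by
  refine (hasDerivAt_outSol (l + 1) hz).congr_deriv ?_
  rw [outSol_recurrence l hz]
  push_cast
  have hI : Complex.I ^ 2 = -1 := Complex.I_sq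
  field_simp
  ring_nf
  simp only [hI]
  ring

theorem outSol_one {z : ℂ} (hz : z ≠ 0) :
    outSol 1 z = (1 - Complex.I / z) * outSol 0 z := by
  have h1 := hasDerivAt_outSol 0 hz
  have h2 : HasDerivAt (outSol 0) (-Complex.I * outSol 0 z) z := by
    have h3 : outSol 0 = fun z => Complex.exp (-(Complex.I * z)) := funext outSol_zero
    rw [h3]
    have h4 := (((hasDerivAt_id z).const_mul Complex.I).neg).cexp
    refine h4.congr_deriv ?_
    simp [mul_comm]
  have h5 := h1.unique h2
  have hI : Complex.I ^ 2 = -1 := Complex.I_sq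
  rw [Nat.cast_zero, zero_add, zero_add] at h5
  linear_combination Complex.I * h5 - (outSol 0 z - outSol 1 z) * hI

/-- The derivative of `z ↦ outSol l (ω z)` away from `0`, for `ω ≠ 0`. -/
noncomputable def outSolDeriv (l : ℕ) (ω z : ℂ) : ℂ :=
  ((l + 1) / (ω * z) * outSol l (ω * z) - Complex.I * outSol (l + 1) (ω * z)) * ω

theorem hasDerivAt_outSol_mul (l : ℕ) {ω z : ℂ} (hω : ω ≠ 0) (hz : z ≠ 0) :
    HasDerivAt (fun z => outSol l (ω * z)) (outSolDeriv l ω z) z := by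
  have h := (hasDerivAt_id z).const_mul ω
  rw [mul_one] at h
  exact (hasDerivAt_outSol l (mul_ne_zero hω hz)).comp z h

theorem hasDerivAt_outSolDeriv (l : ℕ) {ω z : ℂ} (hω : ω ≠ 0) (hz : z ≠ 0) :
    HasDerivAt (outSolDeriv l ω) ((l * (l + 1) / z ^ 2 - ω ^ 2) * outSol l (ω * z)) z := by
  have h := (hasDerivAt_id z).const_mul ω
  rw [mul_one] at h
  have hne := mul_ne_zero hω hz
  have h1 : HasDerivAt (fun z => ((l : ℂ) + 1) / (ω * z)) (-((l + 1) * ω) / (ω * z) ^ 2) z :=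
    ((hasDerivAt_const z ((l : ℂ) + 1)).fun_div h hne).congr_deriv (by simp)
  have h2 := (hasDerivAt_outSol_succ l hne).comp z h
  refine (((h1.mul (hasDerivAt_outSol_mul l hω hz)).sub (h2.const_mul Complex.I)).mul_const
    ω).congr_deriv ?_
  have hI : Complex.I ^ 2 = -1 := Complex.I_sq
  simp only [outSolDeriv]
  generalize outSol l (ω * z) = A
  generalize outSol (l + 1) (ω * z) = B
  field_simp
  ring_nf
  simp only [hI]
  ring

theorem tendsto_inv_mul_ofReal (ω : ℂ) :
    Tendsto (fun s : ℝ => (ω * (s : ℂ))⁻¹) atTop (𝓝 0) := by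
  have h1 : Tendsto (fun s : ℝ => ((s⁻¹ : ℝ) : ℂ)) atTop (𝓝 ((0 : ℝ) : ℂ)) :=
    (Complex.continuous_ofReal.tendsto 0).comp tendsto_inv_atTop_zero
  have h2 := h1.const_mul ω⁻¹
  simp only [Complex.ofReal_zero, mul_zero] at h2
  refine h2.congr fun s => ?_
  rw [mul_inv]; push_cast; rfl

theorem tendsto_outSol (l : ℕ) {ω : ℂ} (hω : ω ≠ 0) :
    Tendsto (fun s : ℝ => outSol l (ω * s) * Complex.exp (Complex.I * ω * s)) atTop (𝓝 1) := by
  have h0 : ∀ z : ℂ, outSol 0 (ω * z) * Complex.exp (Complex.I * ω * z) = 1 := by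
    intro z
    rw [outSol_zero, ← Complex.exp_add, mul_assoc, neg_add_cancel, Complex.exp_zero]
  have hinv := tendsto_inv_mul_ofReal ω
  have hne : ∀ᶠ s : ℝ in atTop, ω * (s : ℂ) ≠ 0 := by
    filter_upwards [eventually_gt_atTop 0] with s hs
    exact mul_ne_zero hω (by exact_mod_cast hs.ne')
  suffices H : ∀ l, Tendsto (fun s : ℝ => outSol l (ω * s) * Complex.exp (Complex.I * ω * s))
      atTop (𝓝 1) ∧ Tendsto (fun s : ℝ => outSol (l + 1) (ω * s)
        * Complex.exp (Complex.I * ω * s)) atTop (𝓝 1) from (H l).1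
  intro l
  induction l with
  | zero =>
    refine ⟨by simp only [h0]; exact tendsto_const_nhds, ?_⟩
    have h1 := (hinv.const_mul Complex.I).const_sub 1
    rw [mul_zero, sub_zero] at h1
    refine h1.congr' ?_
    filter_upwards [hne] with s hs
    rw [zero_add, outSol_one hs, mul_assoc, h0, mul_one, div_eq_mul_inv]
  | succ l ih =>
    refine ⟨ih.2, ?_⟩
    have h1 := ih.1.sub ((hinv.const_mul (Complex.I * (2 * l + 3))).mul ih.2)
    rw [mul_zero, zero_mul, sub_zero] at h1
    refine h1.congr' ?_
    filter_upwards [hne] with s hs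
    rw [outSol_recurrence l hs]
    ring

theorem tendsto_outSolDeriv (l : ℕ) {ω : ℂ} (hω : ω ≠ 0) :
    Tendsto (fun s : ℝ => outSolDeriv l ω s * Complex.exp (Complex.I * ω * s)) atTop
      (𝓝 (-(Complex.I * ω))) := by
  have h1 := ((((tendsto_inv_mul_ofReal ω).const_mul ((l : ℂ) + 1)).mul
    (tendsto_outSol l hω)).sub ((tendsto_outSol (l + 1) hω).const_mul Complex.I)).mul_const ω
  rw [mul_zero, zero_mul, zero_sub, mul_one, neg_mul] at h1
  refine h1.congr fun s => ?_
  rw [outSolDeriv]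
  ring

theorem exp_pi_mul_half (l : ℕ) :
    Complex.exp (-(Complex.I * Real.pi / 2) * (lam l + 1 / 2)) = (-Complex.I) ^ (l + 1) := by
  have : -(Complex.I * Real.pi / 2) * (lam l + 1 / 2)
      = ((l + 1 : ℕ) : ℂ) * (-Real.pi / 2 * Complex.I) := by
    rw [lam]; push_cast; ring
  rw [this, Complex.exp_nat_mul, Complex.exp_neg_pi_div_two_mul_I]

theorem exp_pi_mul_lam (l : ℕ) :
    Complex.exp (Real.pi * lam l * Complex.I) = (-1) ^ l * Complex.I := by
  have : Real.pi * lam l * Complex.I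
      = (l : ℂ) * (Real.pi * Complex.I) + Real.pi / 2 * Complex.I := by
    rw [lam]; ring
  rw [this, Complex.exp_add, Complex.exp_nat_mul, Complex.exp_pi_mul_I,
    Complex.exp_pi_div_two_mul_I]

theorem sin_pi_mul_lam (l : ℕ) : Complex.sin (Real.pi * lam l) = (-1) ^ l := by
  have h : Real.pi * lam l = (l : ℂ) * Real.pi + Real.pi / 2 := by rw [lam]; ring
  rw [h, Complex.sin_add_pi_div_two]
  exact_mod_cast Real.cos_nat_mul_pi l

theorem eta2Lead_eq_outSol (l : ℕ) {ω : ℂ} (hω : ω ≠ 0) {s : ℝ} (hs : 0 < s) :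
    eta2Lead l ω s = outSol l (ω * s) := by
  have hs0 : (s : ℂ) ≠ 0 := by exact_mod_cast hs.ne'
  set t := ω * s / 2 with ht
  have ht0 : t ≠ 0 := div_ne_zero (mul_ne_zero hω hs0) two_ne_zero
  have e1 : (1 / 2 * Real.pi * ω * s : ℂ) ^ (1 / 2 : ℂ)
      = (Real.sqrt Real.pi : ℝ) * t ^ (1 / 2 : ℂ) := by
    have e : (1 / 2 * Real.pi * ω * s : ℂ) = Real.pi * t := by rw [ht]; ring
    have hp : (Real.pi : ℂ) ≠ 0 := by exact_mod_cast Real.pi_ne_zero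
    rw [e, Real.sqrt_eq_rpow, Complex.ofReal_cpow Real.pi_pos.le,
      Complex.cpow_def_of_ne_zero (mul_ne_zero hp ht0), Complex.log_ofReal_mul Real.pi_pos ht0,
        Complex.cpow_def_of_ne_zero ht0, Complex.cpow_def_of_ne_zero hp, ← Complex.exp_add,
        Complex.ofReal_log Real.pi_pos.le]
    congr 1; push_cast; ring
  have e2 : t ^ (1 / 2 : ℂ) * t ^ lam l = t ^ (l + 1) := by
    rw [← Complex.cpow_add _ _ ht0, lam, ← Complex.cpow_natCast]
    congr 1; push_cast; ring
  have e3 : t ^ (1 / 2 : ℂ) * t ^ (-lam l) = (t ^ l)⁻¹ := by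
    rw [← Complex.cpow_add _ _ ht0, lam, ← Complex.cpow_natCast, ← Complex.cpow_neg]
    congr 1; ring
  have e4 : -lam l = -l - 1 / 2 := by rw [lam]; ring
  rw [eta2Lead, if_neg hω, e1, exp_pi_mul_half, hankel2, exp_pi_mul_lam, sin_pi_mul_lam, besselJ_eq,
    besselJ_eq, outSol, ← ht, ← e2, ← e3, ← e4, ← lam]
  have hI1 : (-Complex.I) ^ (l + 1) = -((-1) ^ l * Complex.I ^ l * Complex.I) := by
    rw [neg_pow, pow_succ, pow_succ]; ring
  rw [hI1]
  generalize t ^ (1 / 2 : ℂ) = A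
  generalize t ^ lam l = B
  generalize t ^ (-lam l) = B'
  generalize Complex.I ^ l = J
  field_simp
  ring

/-! ### Volterra equations -/

/-- The sets `D s ⊆ U` over which a Volterra equation on the open set `U` integrates:
`s ↦ ∫_{D s} g` is a primitive of `ε g`.  This covers `D s = (0, s)` with `ε = 1` and
`D s = (s, ∞)` with `ε = -1`. -/
structure IsVolterraDomain (U : Set ℝ) (D : ℝ → Set ℝ) (ε : ℂ) : Prop where
  isOpen : IsOpen U
  subset : ∀ s ∈ U, D s ⊆ U
  measurableSet : ∀ s, MeasurableSet (D s)
  hasDerivAt : ∀ g : ℝ → ℂ, ContinuousOn g U → (∀ s ∈ U, IntegrableOn g (D s)) →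
    ∀ s ∈ U, HasDerivAt (fun s => ∫ y in D s, g y) (ε * g s) s

/-- Bounds under which the Volterra equation with kernel `(a s * b y - b s * a y) * V y` is solved
by its perturbation series: `ρ` and `σ` dominate `a` and `b`, the ratio `ρ / σ` does not increase
from `s` into `D s`, and `|V| ρ σ` is dominated by half a weight `m` with primitive `Φ`. -/
structure IsVolterraBound (U : Set ℝ) (D : ℝ → Set ℝ) (a b V : ℝ → ℂ) (ρ σ m Φ : ℝ → ℝ) (R : ℝ) :
    Prop where
  cont_a : ContinuousOn a U
  cont_b : ContinuousOn b U
  cont_V : ContinuousOn V U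
  ρ_pos : ∀ s ∈ U, 0 < ρ s
  σ_pos : ∀ s ∈ U, 0 < σ s
  norm_a_le : ∀ s ∈ U, ‖a s‖ ≤ ρ s
  norm_b_le : ∀ s ∈ U, ‖b s‖ ≤ σ s
  ratio_le : ∀ s ∈ U, ∀ y ∈ D s, ρ y * σ s ≤ ρ s * σ y
  weight_le : ∀ y ∈ U, ‖V y‖ * (ρ y * σ y) ≤ m y / 2
  Φ_nonneg : ∀ s ∈ U, 0 ≤ Φ s
  ρ_le : ∀ s ∈ U, ρ s ≤ R
  Φ_le : ∀ s ∈ U, Φ s ≤ R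
  integrableOn_pow : ∀ (n : ℕ), ∀ s ∈ U, IntegrableOn (fun y => m y * Φ y ^ n) (D s)
  integral_pow : ∀ (n : ℕ), ∀ s ∈ U, ∫ y in D s, m y * Φ y ^ n = Φ s ^ (n + 1) / (n + 1)

section Volterra

variable {U : Set ℝ} {D : ℝ → Set ℝ} {ε : ℂ} {a b V : ℝ → ℂ} {ρ σ m Φ : ℝ → ℝ} {R : ℝ}

theorem IsVolterraBound.norm_b_mul_le (hB : IsVolterraBound U D a b V ρ σ m Φ R) {y : ℝ}
    (hy : y ∈ U) : ‖b y * V y‖ * ρ y ≤ m y / 2 := by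
  refine le_trans ?_ (hB.weight_le y hy)
  have h2 := hB.ρ_pos y hy
  have h3 := hB.norm_b_le y hy
  rw [norm_mul]
  calc ‖b y‖ * ‖V y‖ * ρ y ≤ σ y * ‖V y‖ * ρ y := by gcongr
    _ = _ := by ring

theorem IsVolterraBound.norm_a_mul_le (hB : IsVolterraBound U D a b V ρ σ m Φ R) {s y : ℝ}
    (hs : s ∈ U) (hy : y ∈ U) (hsy : y ∈ D s) : ‖a y * V y‖ * ρ y ≤ ρ s / σ s * (m y / 2) := by
  have h1 := hB.σ_pos s hs
  have h2 := hB.ρ_pos y hy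
  have h3 := hB.norm_a_le y hy
  have h4 := hB.ρ_pos s hs
  have h5 : ρ y ≤ ρ s / σ s * σ y := by
    rw [div_mul_eq_mul_div, le_div_iff₀ h1]; exact hB.ratio_le s hs y hsy
  rw [norm_mul]
  calc ‖a y‖ * ‖V y‖ * ρ y ≤ ρ y * ‖V y‖ * ρ y := by gcongr
    _ ≤ (ρ s / σ s * σ y) * ‖V y‖ * ρ y := by gcongr
    _ = ρ s / σ s * (‖V y‖ * (ρ y * σ y)) := by ring
    _ ≤ _ := by
      have := hB.weight_le y hy
      gcongr

theorem IsVolterraBound.norm_kernel_le (hB : IsVolterraBound U D a b V ρ σ m Φ R) {s y : ℝ}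
    (hs : s ∈ U) (hy : y ∈ U) (hsy : y ∈ D s) :
    ‖(a s * b y - b s * a y) * V y‖ * ρ y ≤ ρ s * m y := by
  have h1 := hB.norm_b_mul_le hy
  have h2 := hB.norm_a_mul_le hs hy hsy
  have h3 := hB.norm_a_le s hs
  have h4 := hB.norm_b_le s hs
  have h5 := hB.σ_pos s hs
  have h6 := hB.ρ_pos s hs
  have h7 := hB.ρ_pos y hy
  calc ‖(a s * b y - b s * a y) * V y‖ * ρ y = ‖a s * (b y * V y) - b s * (a y * V y)‖ * ρ y := by
        congr 2; ring
    _ ≤ (‖a s‖ * ‖b y * V y‖ + ‖b s‖ * ‖a y * V y‖) * ρ y := by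
        gcongr
        exact (norm_sub_le _ _).trans (by rw [norm_mul, norm_mul (b s)])
    _ = ‖a s‖ * (‖b y * V y‖ * ρ y) + ‖b s‖ * (‖a y * V y‖ * ρ y) := by ring
    _ ≤ ρ s * (m y / 2) + σ s * (ρ s / σ s * (m y / 2)) := by gcongr
    _ = ρ s * m y := by field_simp; ring

/-- A function bounded by `ρ h` may be integrated against the kernel. -/
theorem IsVolterraBound.integrable (hD : IsVolterraDomain U D ε)
    (hB : IsVolterraBound U D a b V ρ σ m Φ R) {g : ℝ → ℂ} {h : ℝ → ℝ}
    (hg : ContinuousOn g U) (hgh : ∀ y ∈ U, ‖g y‖ ≤ ρ y * h y) {s : ℝ} (hs : s ∈ U)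
    (hi : IntegrableOn (fun y => m y * h y) (D s)) :
    IntegrableOn (fun y => b y * V y * g y) (D s) ∧
    IntegrableOn (fun y => a y * V y * g y) (D s) ∧
    IntegrableOn (fun y => (a s * b y - b s * a y) * V y * g y) (D s) ∧
    (∀ y ∈ D s, ‖b y * V y * g y‖ ≤ 1 / 2 * (m y * h y)) ∧
    (∀ y ∈ D s, ‖a y * V y * g y‖ ≤ ρ s / σ s * (1 / 2) * (m y * h y)) ∧
    (∀ y ∈ D s, ‖(a s * b y - b s * a y) * V y * g y‖ ≤ ρ s * (m y * h y)) := by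
  have hsub := hD.subset s hs
  have h0 : ∀ y ∈ U, 0 ≤ h y := fun y hy =>
    nonneg_of_mul_nonneg_right ((norm_nonneg _).trans (hgh y hy)) (hB.ρ_pos y hy)
  have key : ∀ (k : ℝ → ℂ) (A : ℝ), (∀ y ∈ D s, ‖k y‖ * ρ y ≤ A * m y) →
      ∀ y ∈ D s, ‖k y * g y‖ ≤ A * (m y * h y) := by
    intro k A hk y hy
    have hyU := hsub hy
    have h1 := hgh y hyU
    have h2 := h0 y hyU
    have h3 := hk y hy
    rw [norm_mul]
    calc ‖k y‖ * ‖g y‖ ≤ ‖k y‖ * (ρ y * h y) := by gcongr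
      _ = ‖k y‖ * ρ y * h y := by ring
      _ ≤ A * m y * h y := by gcongr
      _ = _ := by ring
  have key2 : ∀ (k : ℝ → ℂ) (A : ℝ), ContinuousOn k U →
      (∀ y ∈ D s, ‖k y * g y‖ ≤ A * (m y * h y)) → IntegrableOn (fun y => k y * g y) (D s) := by
    intro k A hk hle
    refine Integrable.mono' (hi.const_mul A) (((hk.mul hg).mono hsub).aestronglyMeasurable
      (hD.measurableSet s)) ?_
    exact (ae_restrict_iff' (hD.measurableSet s)).2 (ae_of_all _ hle)
  have k1 := key (fun y => b y * V y) (1 / 2) fun y hy =>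
    (hB.norm_b_mul_le (hsub hy)).trans_eq (by ring)
  have k2 := key (fun y => a y * V y) (ρ s / σ s * (1 / 2)) fun y hy =>
    (hB.norm_a_mul_le hs (hsub hy) hy).trans_eq (by ring)
  have k3 := key (fun y => (a s * b y - b s * a y) * V y) (ρ s) fun y hy =>
    hB.norm_kernel_le hs (hsub hy) hy
  have ca := hB.cont_a
  have cb := hB.cont_b
  have cV := hB.cont_V
  exact ⟨key2 _ _ (cb.mul cV) k1, key2 _ _ (ca.mul cV) k2,
    key2 _ _ (((continuousOn_const.mul cb).sub (continuousOn_const.mul ca)).mul cV) k3, k1, k2, k3⟩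

/-- The kernel splits into two products, so that its integral against `g` is a combination of two
primitives. -/
theorem integral_kernel_eq {E : Set ℝ} (α β : ℂ) {g : ℝ → ℂ}
    (hb : IntegrableOn (fun y => b y * V y * g y) E)
    (ha : IntegrableOn (fun y => a y * V y * g y) E) :
    ∫ y in E, (α * b y - β * a y) * V y * g y
      = α * (∫ y in E, b y * V y * g y) - β * ∫ y in E, a y * V y * g y := by
  rw [← integral_const_mul, ← integral_const_mul, ← integral_sub (hb.const_mul _) (ha.const_mul _)]
  congr 1; ext y; ring

variable {F : ℕ → ℝ → ℂ} {c : ℂ}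

/-- The factorial bound on the terms of the perturbation series. -/
theorem IsVolterraBound.term_bound (hD : IsVolterraDomain U D ε)
    (hB : IsVolterraBound U D a b V ρ σ m Φ R) (hF0 : ∀ s ∈ U, F 0 s = c * a s)
    (hF : ∀ n, ∀ s ∈ U, F (n + 1) s = ∫ y in D s, (a s * b y - b s * a y) * V y * F n y) (n : ℕ) :
    ContinuousOn (F n) U ∧ ∀ s ∈ U, ‖F n s‖ ≤ ρ s * (‖c‖ * Φ s ^ n / n.factorial) := by
  induction n with
  | zero =>
    refine ⟨(continuousOn_const.mul hB.cont_a).congr hF0, fun s hs => ?_⟩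
    rw [hF0 s hs, norm_mul, pow_zero, Nat.factorial_zero, Nat.cast_one, mul_one, div_one, mul_comm]
    gcongr
    exact hB.norm_a_le s hs
  | succ n ih =>
    obtain ⟨hc, hle⟩ := ih
    have hi : ∀ s ∈ U, IntegrableOn (fun y => m y * (‖c‖ * Φ y ^ n / n.factorial)) (D s) := by
      intro s hs
      refine IntegrableOn.congr_fun ((hB.integrableOn_pow n s hs).const_mul (‖c‖ / n.factorial))
        (fun y _ => ?_) (hD.measurableSet s)
      ring
    have hI := fun s hs => hB.integrable hD hc hle (hs : s ∈ U) (hi s hs)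
    constructor
    · have h1 : ContinuousOn (fun s => ∫ y in D s, b y * V y * F n y) U := fun s hs =>
        (hD.hasDerivAt _ ((hB.cont_b.mul hB.cont_V).mul hc) (fun s hs => (hI s hs).1) s
          hs).continuousAt.continuousWithinAt
      have h2 : ContinuousOn (fun s => ∫ y in D s, a y * V y * F n y) U := fun s hs =>
        (hD.hasDerivAt _ ((hB.cont_a.mul hB.cont_V).mul hc) (fun s hs => (hI s hs).2.1) s
          hs).continuousAt.continuousWithinAt
      refine ((hB.cont_a.mul h1).sub (hB.cont_b.mul h2)).congr fun s hs => ?_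
      rw [hF n s hs, integral_kernel_eq _ _ (hI s hs).1 (hI s hs).2.1]
      rfl
    · intro s hs
      rw [hF n s hs]
      refine (norm_integral_le_of_norm_le ((hi s hs).const_mul (ρ s))
        ((ae_restrict_iff' (hD.measurableSet s)).2 (ae_of_all _ (hI s hs).2.2.2.2.2))).trans_eq ?_
      rw [integral_const_mul]
      have e : ∀ y, m y * (‖c‖ * Φ y ^ n / n.factorial) = ‖c‖ / n.factorial * (m y * Φ y ^ n) := by
        intro y; ring
      simp only [e]
      rw [integral_const_mul, hB.integral_pow n s hs, Nat.factorial_succ]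
      push_cast
      field_simp

/-- The sum of the perturbation series of a Volterra equation whose kernel is the Green's function
of `η'' = q η` solves `η'' = (q + V) η`, and is close to the unperturbed solution where `Φ` is
small. -/
theorem IsVolterraBound.solution (hD : IsVolterraDomain U D ε)
    (hB : IsVolterraBound U D a b V ρ σ m Φ R) (hF0 : ∀ s ∈ U, F 0 s = c * a s)
    (hF : ∀ n, ∀ s ∈ U, F (n + 1) s = ∫ y in D s, (a s * b y - b s * a y) * V y * F n y)
    {a' b' q : ℝ → ℂ}
    (ha : ∀ s ∈ U, HasDerivAt a (a' s) s) (hb : ∀ s ∈ U, HasDerivAt b (b' s) s)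
    (ha' : ∀ s ∈ U, HasDerivAt a' (q s * a s) s) (hb' : ∀ s ∈ U, HasDerivAt b' (q s * b s) s)
    (hW : ∀ s ∈ U, ε * (a' s * b s - b' s * a s) = 1) :
    (∀ n, ∀ s ∈ U, IntegrableOn (fun y => (a s * b y - b s * a y) * V y * F n y) (D s)) ∧
    (∀ s ∈ U, Summable fun n => F n s) ∧
    (∀ s ∈ U, HasDerivAt (fun s => ∑' n, F n s) (deriv (fun s => ∑' n, F n s) s) s) ∧
    (∀ s ∈ U, HasDerivAt (deriv (fun s => ∑' n, F n s)) ((q s + V s) * ∑' n, F n s) s) ∧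
    ∃ C : ℝ, ∀ s ∈ U, ‖(∑' n, F n s) - c * a s‖ ≤ C * (ρ s * Φ s) ∧
      ‖deriv (fun s => ∑' n, F n s) s - c * a' s‖
        ≤ C * (Φ s * (‖a' s‖ + ‖b' s‖ * (ρ s / σ s))) := by
  have hT := hB.term_bound hD hF0 hF
  have hi : ∀ n, ∀ s ∈ U, IntegrableOn (fun y => m y * (‖c‖ * Φ y ^ n / n.factorial)) (D s) := by
    intro n s hs
    refine IntegrableOn.congr_fun ((hB.integrableOn_pow n s hs).const_mul (‖c‖ / n.factorial))
      (fun y _ => ?_) (hD.measurableSet s)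
    ring
  have hI := fun n s hs => hB.integrable hD (hT n).1 (hT n).2 (hs : s ∈ U) (hi n s hs)
  have hsumR : ∀ x A : ℝ, Summable fun n : ℕ => A * (‖c‖ * x ^ n / n.factorial) := by
    intro x A
    have := (Real.summable_pow_div_factorial x).mul_left (A * ‖c‖)
    refine this.congr fun n => by ring
  have hsum : ∀ s ∈ U, Summable fun n => F n s := fun s hs =>
    Summable.of_norm_bounded (hsumR (Φ s) (ρ s)) fun n => (hT n).2 s hs
  set f : ℝ → ℂ := fun s => ∑' n, F n s with hf
  have hfc : ContinuousOn f U := by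
    refine continuousOn_tsum (fun n => (hT n).1) (hsumR R R) fun n s hs => ?_
    refine ((hT n).2 s hs).trans ?_
    have h1 := hB.Φ_nonneg s hs
    have h2 := hB.Φ_le s hs
    have h3 := hB.ρ_le s hs
    gcongr
    exact (h1.trans h2)
  set C := ∑' n : ℕ, ‖c‖ * R ^ n / n.factorial with hC
  have hsum1 : Summable fun n : ℕ => ‖c‖ * R ^ n / n.factorial := by
    simpa using hsumR R 1
  have hfle : ∀ s ∈ U, ‖f s‖ ≤ ρ s * C := by
    intro s hs
    rw [hC, ← tsum_mul_left]
    refine tsum_of_norm_bounded (hsum1.mul_left (ρ s)).hasSum fun n => ?_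
    refine ((hT n).2 s hs).trans ?_
    have h1 := hB.Φ_nonneg s hs
    have h2 := hB.Φ_le s hs
    have h3 := hB.ρ_pos s hs
    gcongr
  have hmi : ∀ s ∈ U, IntegrableOn m (D s) := fun s hs => by
    simpa using hB.integrableOn_pow 0 s hs
  have hmI : ∀ s ∈ U, ∫ y in D s, m y = Φ s := fun s hs => by
    simpa using hB.integral_pow 0 s hs
  have hJ := fun s hs => hB.integrable hD hfc hfle (hs : s ∈ U) ((hmi s hs).mul_const C)
  -- summation and integration are interchanged
  have heq : ∀ s ∈ U, f s = c * a s + ∫ y in D s, (a s * b y - b s * a y) * V y * f y := by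
    intro s hs
    have hnorm : ∀ n, ∫ y in D s, ‖(a s * b y - b s * a y) * V y * F n y‖
        ≤ ρ s * (‖c‖ * Φ s ^ (n + 1) / (n + 1).factorial) := by
      intro n
      refine (integral_mono_ae (hI n s hs).2.2.1.norm ((hi n s hs).const_mul (ρ s))
        ((ae_restrict_iff' (hD.measurableSet s)).2
          (ae_of_all _ (hI n s hs).2.2.2.2.2))).trans_eq ?_
      rw [integral_const_mul]
      have e : ∀ y, m y * (‖c‖ * Φ y ^ n / n.factorial) = ‖c‖ / n.factorial * (m y * Φ y ^ n) := by
        intro y; ring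
      simp only [e]
      rw [integral_const_mul, hB.integral_pow n s hs, Nat.factorial_succ]
      push_cast
      field_simp
    have hsn : Summable fun n => ∫ y in D s, ‖(a s * b y - b s * a y) * V y * F n y‖ :=
      Summable.of_nonneg_of_le (fun n => integral_nonneg fun y => norm_nonneg _) hnorm
        ((summable_nat_add_iff 1).2 (hsumR (Φ s) (ρ s)))
    have h1 := MeasureTheory.hasSum_integral_of_summable_integral_norm
      (fun n => (hI n s hs).2.2.1) hsn
    have h2 : f s = F 0 s + ∑' n, F (n + 1) s := (hsum s hs).tsum_eq_zero_add
    rw [h2, hF0 s hs]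
    congr 1
    rw [tsum_congr fun n => hF n s hs, h1.tsum_eq]
    refine setIntegral_congr_fun (hD.measurableSet s) fun y hy => ?_
    exact tsum_mul_left
  set P : ℝ → ℂ := fun s => ∫ y in D s, b y * V y * f y with hP
  set Q : ℝ → ℂ := fun s => ∫ y in D s, a y * V y * f y with hQ
  have heq2 : ∀ s ∈ U, f s = c * a s + (a s * P s - b s * Q s) := by
    intro s hs
    rw [heq s hs, integral_kernel_eq _ _ (hJ s hs).1 (hJ s hs).2.1]
  have hPd : ∀ s ∈ U, HasDerivAt P (ε * (b s * V s * f s)) s :=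
    hD.hasDerivAt _ ((hB.cont_b.mul hB.cont_V).mul hfc) fun s hs => (hJ s hs).1
  have hQd : ∀ s ∈ U, HasDerivAt Q (ε * (a s * V s * f s)) s :=
    hD.hasDerivAt _ ((hB.cont_a.mul hB.cont_V).mul hfc) fun s hs => (hJ s hs).2.1
  have hnhds : ∀ s ∈ U, U ∈ 𝓝 s := fun s hs => hD.isOpen.mem_nhds hs
  set f' : ℝ → ℂ := fun s => c * a' s + (a' s * P s - b' s * Q s) with hf'
  have hfd : ∀ s ∈ U, HasDerivAt f (f' s) s := by
    intro s hs
    have h1 := ((ha s hs).const_mul c).add (((ha s hs).mul (hPd s hs)).sub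
      ((hb s hs).mul (hQd s hs)))
    refine (h1.congr_of_eventuallyEq ?_).congr_deriv ?_
    · filter_upwards [hnhds s hs] with y hy using heq2 y hy
    · simp only [hf']; ring
  have hfd' : ∀ s ∈ U, deriv f s = f' s := fun s hs => (hfd s hs).deriv
  refine ⟨fun n s hs => (hI n s hs).2.2.1, hsum, fun s hs => by rw [hfd' s hs]; exact hfd s hs,
    fun s hs => ?_, C, fun s hs => ?_⟩
  · have h1 := ((ha' s hs).const_mul c).add (((ha' s hs).mul (hPd s hs)).sub
      ((hb' s hs).mul (hQd s hs)))
    refine (h1.congr_of_eventuallyEq ?_).congr_deriv ?_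
    · filter_upwards [hnhds s hs] with y hy using hfd' y hy
    · change _ = (q s + V s) * f s
      linear_combination (-q s) * heq2 s hs + (V s * f s) * hW s hs
  · have hPle : ‖P s‖ ≤ C / 2 * Φ s := by
      refine (norm_integral_le_of_norm_le (((hmi s hs).mul_const C).const_mul (1 / 2))
        ((ae_restrict_iff' (hD.measurableSet s)).2 (ae_of_all _ (hJ s hs).2.2.2.1))).trans_eq ?_
      rw [integral_const_mul, integral_mul_const, hmI s hs]; ring
    have hQle : ‖Q s‖ ≤ C / 2 * Φ s * (ρ s / σ s) := by
      refine (norm_integral_le_of_norm_le (((hmi s hs).mul_const C).const_mul (ρ s / σ s * (1 / 2)))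
        ((ae_restrict_iff' (hD.measurableSet s)).2 (ae_of_all _ (hJ s hs).2.2.2.2.1))).trans_eq ?_
      rw [integral_const_mul, integral_mul_const, hmI s hs]; ring
    have hab : ∀ x y : ℂ, ‖x * P s - y * Q s‖
        ≤ C / 2 * Φ s * (‖x‖ + ‖y‖ * (ρ s / σ s)) := by
      intro x y
      refine (norm_sub_le _ _).trans ?_
      rw [norm_mul, norm_mul]
      calc ‖x‖ * ‖P s‖ + ‖y‖ * ‖Q s‖
          ≤ ‖x‖ * (C / 2 * Φ s) + ‖y‖ * (C / 2 * Φ s * (ρ s / σ s)) := by gcongr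
        _ = _ := by ring
    have hρ := hB.ρ_pos s hs
    have hσ := hB.σ_pos s hs
    have hΦ := hB.Φ_nonneg s hs
    have hC0 : 0 ≤ C := nonneg_of_mul_nonneg_right ((norm_nonneg _).trans (hfle s hs)) hρ
    constructor
    · have e : (∑' n, F n s) - c * a s = a s * P s - b s * Q s := by
        linear_combination heq2 s hs
      rw [e]
      refine (hab _ _).trans ?_
      have h1 := hB.norm_a_le s hs
      have h2 := hB.norm_b_le s hs
      calc C / 2 * Φ s * (‖a s‖ + ‖b s‖ * (ρ s / σ s))
          ≤ C / 2 * Φ s * (ρ s + σ s * (ρ s / σ s)) := by gcongr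
        _ = _ := by field_simp; ring
    · rw [hfd' s hs, hf']
      simp only [add_sub_cancel_left]
      refine (hab _ _).trans ?_
      have : 0 ≤ Φ s * (‖a' s‖ + ‖b' s‖ * (ρ s / σ s)) := by positivity
      nlinarith

end Volterra

/-! ### The two domains of integration and their weights -/

theorem isVolterraDomain_Ioo (R : ℝ) :
    IsVolterraDomain (Ioo 0 R) (fun s => Ioo 0 s) 1 where
  isOpen := isOpen_Ioo
  subset s hs := Ioo_subset_Ioo_right hs.2.le
  measurableSet s := measurableSet_Ioo
  hasDerivAt g hg hi s hs := by
    have h1 : IntervalIntegrable g volume 0 s :=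
      (intervalIntegrable_iff_integrableOn_Ioo_of_le hs.1.le).2 (hi s hs)
    have h2 := intervalIntegral.integral_hasDerivAt_right h1
      (hg.stronglyMeasurableAtFilter isOpen_Ioo s hs) (hg.continuousAt (isOpen_Ioo.mem_nhds hs))
    rw [one_mul]
    refine h2.congr_of_eventuallyEq ?_
    filter_upwards [lt_mem_nhds hs.1] with x hx
    rw [intervalIntegral.integral_of_le hx.le, integral_Ioc_eq_integral_Ioo]

/-- Differentiation of an improper integral in its lower limit. -/
theorem hasDerivAt_integral_Ioi {E : Type*} [NormedAddCommGroup E] [NormedSpace ℝ E]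
    [CompleteSpace E] {g : ℝ → E} {s₀ s : ℝ} (hg : ContinuousOn g (Ioi s₀))
    (hi : ∀ s ∈ Ioi s₀, IntegrableOn g (Ioi s)) (hs : s₀ < s) :
    HasDerivAt (fun s => ∫ y in Ioi s, g y) (-g s) s := by
  obtain ⟨a, ha, has⟩ := exists_between hs
  have h1 : IntervalIntegrable g volume a s :=
    (intervalIntegrable_iff_integrableOn_Ioc_of_le has.le).2 ((hi a ha).mono_set
      Ioc_subset_Ioi_self)
  have h2 := intervalIntegral.integral_hasDerivAt_right h1
    (hg.stronglyMeasurableAtFilter isOpen_Ioi s hs) (hg.continuousAt (isOpen_Ioi.mem_nhds hs))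
  refine (h2.const_sub (∫ y in Ioi a, g y)).congr_of_eventuallyEq ?_
  filter_upwards [lt_mem_nhds hs] with x hx
  rw [← intervalIntegral.integral_interval_add_Ioi (hi a ha) (hi x hx), add_sub_cancel_left]

theorem isVolterraDomain_Ioi (s₀ : ℝ) : IsVolterraDomain (Ioi s₀) Ioi (-1) where
  isOpen := isOpen_Ioi
  subset s hs := Ioi_subset_Ioi (le_of_lt hs)
  measurableSet s := measurableSet_Ioi
  hasDerivAt g hg hi s hs := (hasDerivAt_integral_Ioi hg hi hs).congr_deriv (by ring)

/-- The weight `M` on `(0, s)`, with primitive `M s`. -/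
theorem const_weight_pow (M : ℝ) (n : ℕ) {s : ℝ} (hs : 0 < s) :
    IntegrableOn (fun y => M * (M * y) ^ n) (Ioo 0 s) ∧
      ∫ y in Ioo 0 s, M * (M * y) ^ n = (M * s) ^ (n + 1) / (n + 1) := by
  constructor
  · exact (Continuous.integrableOn_Icc (by fun_prop)).mono_set Ioo_subset_Icc_self
  · rw [← integral_Ioc_eq_integral_Ioo, ← intervalIntegral.integral_of_le hs.le]
    simp only [mul_pow, ← mul_assoc]
    rw [intervalIntegral.integral_const_mul, integral_pow]
    simp; ring

/-- The weight `M s^{-3/2}` on `(s, ∞)`, with primitive `2 M s^{-1/2}`. -/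
theorem rpow_weight_pow (M : ℝ) (n : ℕ) {s : ℝ} (hs : 0 < s) :
    IntegrableOn (fun y => M * y ^ (-3 / 2 : ℝ) * (2 * M * y ^ (-1 / 2 : ℝ)) ^ n) (Ioi s) ∧
      ∫ y in Ioi s, M * y ^ (-3 / 2 : ℝ) * (2 * M * y ^ (-1 / 2 : ℝ)) ^ n
        = (2 * M * s ^ (-1 / 2 : ℝ)) ^ (n + 1) / (n + 1) := by
  have e : ∀ y ∈ Ioi s, M * y ^ (-3 / 2 : ℝ) * (2 * M * y ^ (-1 / 2 : ℝ)) ^ n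
      = M * (2 * M) ^ n * y ^ (-3 / 2 + -1 / 2 * n : ℝ) := by
    intro y hy
    have hy0 : 0 < y := hs.trans hy
    rw [mul_pow, ← Real.rpow_mul_natCast hy0.le, Real.rpow_add hy0]
    ring
  have hlt : (-3 / 2 + -1 / 2 * n : ℝ) < -1 := by linarith
  constructor
  · refine IntegrableOn.congr_fun ?_ (fun y hy => (e y hy).symm) measurableSet_Ioi
    exact (integrableOn_Ioi_rpow_of_lt hlt hs).const_mul _
  · have e0 : (2 * M * s ^ (-1 / 2 : ℝ)) ^ (n + 1)
        = (2 * M) ^ (n + 1) * s ^ (-1 / 2 * ((n + 1 : ℕ) : ℝ) : ℝ) := by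
      rw [mul_pow, ← Real.rpow_mul_natCast hs.le]
    rw [setIntegral_congr_fun measurableSet_Ioi e, integral_const_mul,
      integral_Ioi_rpow_of_lt hlt hs, e0]
    have e1 : (-3 / 2 + -1 / 2 * n + 1 : ℝ) = -((n + 1) / 2) := by ring
    have e2 : (-1 / 2 * ((n + 1 : ℕ) : ℝ) : ℝ) = -((n + 1) / 2) := by push_cast; ring
    rw [e1, e2]
    field_simp
    ring

/-- A continuous function on `[s₀, ∞)` with a limit at infinity is bounded. -/
theorem exists_bound_of_tendsto_atTop {f : ℝ → ℂ} {c : ℂ} {s₀ : ℝ}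
    (hf : ContinuousOn f (Ici s₀)) (h : Tendsto f atTop (𝓝 c)) :
    ∃ C : ℝ, 0 < C ∧ ∀ s, s₀ ≤ s → ‖f s‖ ≤ C := by
  have h1 : ∀ᶠ s in atTop, ‖f s‖ < ‖c‖ + 1 := h.norm.eventually_lt_const (by linarith)
  obtain ⟨b, hb⟩ := eventually_atTop.1 h1
  obtain ⟨C, hC⟩ := (isCompact_Icc (a := s₀) (b := b)).exists_bound_of_continuousOn
    (hf.mono Icc_subset_Ici_self)
  refine ⟨max C (‖c‖ + 1), lt_max_of_lt_right (by positivity), fun s hs => ?_⟩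
  rcases le_total s b with h2 | h2
  · exact (hC s ⟨hs, h2⟩).trans (le_max_left _ _)
  · exact (hb s h2).le.trans (le_max_right _ _)

/-! ### Wronskians of the unperturbed solutions -/

theorem hasDerivAt_wronskian_zero {f f' g g' : ℝ → ℂ} {q : ℂ} {s : ℝ}
    (hf : HasDerivAt f (f' s) s) (hf' : HasDerivAt f' (q * f s) s)
    (hg : HasDerivAt g (g' s) s) (hg' : HasDerivAt g' (q * g s) s) :
    HasDerivAt (fun s => f' s * g s - f s * g' s) 0 s :=
  ((hf'.mul hg).sub (hf.mul hg')).congr_deriv (by ring)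

theorem eq_of_hasDerivAt_zero {f : ℝ → ℂ} {U : Set ℝ} (hU : IsOpen U) (hc : Convex ℝ U)
    (hf : ∀ s ∈ U, HasDerivAt f 0 s) {s t : ℝ} (hs : s ∈ U) (ht : t ∈ U) : f s = f t := by
  refine hU.is_const_of_deriv_eq_zero hc.isPreconnected
    (fun x hx => (hf x hx).differentiableAt.differentiableWithinAt) (fun x hx => ?_) hs ht
  exact (hf x hx).deriv

theorem hasDerivAt_freeSol_ofReal (p : ℤ) (ω : ℂ) {s : ℝ} (hs : 0 < s) :
    HasDerivAt (fun s : ℝ => freeSol p ω s) (freeSolDeriv p ω s) s :=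
  (hasDerivAt_freeSol p ω (by exact_mod_cast hs.ne')).comp_ofReal

theorem hasDerivAt_freeSolDeriv_ofReal (p : ℤ) (ω : ℂ) {s : ℝ} (hs : 0 < s) :
    HasDerivAt (fun s : ℝ => freeSolDeriv p ω s)
      ((p * (p - 1) / (s : ℂ) ^ 2 - ω ^ 2) * freeSol p ω s) s :=
  (hasDerivAt_freeSolDeriv p ω (by exact_mod_cast hs.ne')).comp_ofReal

/-- The Wronskian of the two unperturbed solutions at the centre is constant, and its value is read
off as `s → 0`. -/
theorem freeSol_wronskian (l : ℕ) (ω : ℂ) {s : ℝ} (hs : 0 < s) :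
    freeSolDeriv (l + 1) ω s * freeSol (-l) ω s - freeSol (l + 1) ω s * freeSolDeriv (-l) ω s
      = 2 * l + 1 := by
  -- `freeSol p` and its derivative are `s ^ p` and `s ^ (p - 1)` times functions continuous at `0`
  set A : ℤ → ℝ → ℂ := fun p s =>
    Complex.Gamma (p + 1 / 2) * besselCore (p - 1 / 2) ((ω * s / 2) ^ 2) with hA
  set A' : ℤ → ℝ → ℂ := fun p s =>
    Complex.Gamma (p + 1 / 2) * (p * besselCore (p - 1 / 2) ((ω * s / 2) ^ 2)
      - ω ^ 2 * (s : ℂ) ^ 2 / 2 * besselCore (p + 1 / 2) ((ω * s / 2) ^ 2)) with hA'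
  have cA : ∀ p, Continuous (A p) := fun p => continuous_const.mul (continuous_besselCore_sq _ _)
  have cA' : ∀ p, Continuous (A' p) := fun p => by
    have h1 := continuous_besselCore_sq (p - 1 / 2) ω
    have h2 := continuous_besselCore_sq (p + 1 / 2) ω
    simp only [hA']
    fun_prop
  have e1 (p : ℤ) : (p : ℂ) - 1 / 2 + 1 = p + 1 / 2 := by ring
  have A0 : ∀ p, A p 0 = 1 := fun p => by
    simp only [hA, Complex.ofReal_zero, mul_zero, zero_div, zero_pow two_ne_zero]
    rw [besselCore_zero, e1, mul_inv_cancel₀ (Gamma_int_add_half_ne_zero p)]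
  have A'0 : ∀ p : ℤ, A' p 0 = p := fun p => by
    simp only [hA', Complex.ofReal_zero, mul_zero, zero_div, zero_pow two_ne_zero, zero_mul,
      sub_zero]
    rw [besselCore_zero, e1, mul_comm (p : ℂ), ← mul_assoc,
      mul_inv_cancel₀ (Gamma_int_add_half_ne_zero p), one_mul]
  set w : ℝ → ℂ := fun s => freeSolDeriv (l + 1) ω s * freeSol (-l) ω s
    - freeSol (l + 1) ω s * freeSolDeriv (-l) ω s with hw
  have hwA : ∀ s : ℝ, 0 < s → w s = A' (l + 1) s * A (-l) s - A (l + 1) s * A' (-l) s := by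
    intro s hs
    have hs0 : (s : ℂ) ≠ 0 := by exact_mod_cast hs.ne'
    have h1 : (s : ℂ) ^ (l + 1 - 1 : ℤ) * (s : ℂ) ^ (-l : ℤ) = 1 := by
      rw [← zpow_add₀ hs0]; simp
    have h2 : (s : ℂ) ^ (l + 1 : ℤ) * (s : ℂ) ^ (-l - 1 : ℤ) = 1 := by
      rw [← zpow_add₀ hs0]; simp
    simp only [hw, freeSol, freeSolDeriv, hA, hA']
    linear_combination (A' (l + 1) s * A (-l) s) * h1 - (A (l + 1) s * A' (-l) s) * h2
  have hwd : ∀ s ∈ Ioi (0 : ℝ), HasDerivAt w 0 s := by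
    intro s hs
    refine hasDerivAt_wronskian_zero (q := l * (l + 1) / (s : ℂ) ^ 2 - ω ^ 2)
      (hasDerivAt_freeSol_ofReal _ _ hs)
      ((hasDerivAt_freeSolDeriv_ofReal _ _ hs).congr_deriv ?_) (hasDerivAt_freeSol_ofReal _ _ hs)
      ((hasDerivAt_freeSolDeriv_ofReal _ _ hs).congr_deriv ?_)
    · push_cast; ring
    · push_cast; ring
  have hlim : Tendsto w (𝓝[>] 0) (𝓝 (2 * l + 1)) := by
    have h1 : Tendsto (fun s => A' (l + 1) s * A (-l) s - A (l + 1) s * A' (-l) s) (𝓝 0)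
        (𝓝 (A' (l + 1) 0 * A (-l) 0 - A (l + 1) 0 * A' (-l) 0)) :=
      (((cA' _).mul (cA _)).sub ((cA _).mul (cA' _))).tendsto 0
    have e : A' (l + 1) 0 * A (-l) 0 - A (l + 1) 0 * A' (-l) 0 = 2 * l + 1 := by
      simp only [A0, A'0]; push_cast; ring
    rw [e] at h1
    refine (h1.mono_left nhdsWithin_le_nhds).congr' ?_
    filter_upwards [self_mem_nhdsWithin] with s hs using (hwA s hs).symm
  have hconst : Tendsto w (𝓝[>] 0) (𝓝 (w s)) := by
    refine tendsto_const_nhds.congr' ?_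
    filter_upwards [self_mem_nhdsWithin] with t ht
    exact eq_of_hasDerivAt_zero isOpen_Ioi (convex_Ioi 0) hwd hs ht
  exact tendsto_nhds_unique hconst hlim

theorem hasDerivAt_outSol_ofReal (l : ℕ) {ω : ℂ} (hω : ω ≠ 0) {s : ℝ} (hs : 0 < s) :
    HasDerivAt (fun s : ℝ => outSol l (ω * s)) (outSolDeriv l ω s) s :=
  (hasDerivAt_outSol_mul l hω (by exact_mod_cast hs.ne' : (s : ℂ) ≠ 0)).comp_ofReal

theorem hasDerivAt_outSolDeriv_ofReal (l : ℕ) {ω : ℂ} (hω : ω ≠ 0) {s : ℝ} (hs : 0 < s) :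
    HasDerivAt (fun s : ℝ => outSolDeriv l ω s)
      ((l * (l + 1) / (s : ℂ) ^ 2 - ω ^ 2) * outSol l (ω * s)) s :=
  (hasDerivAt_outSolDeriv l hω (by exact_mod_cast hs.ne')).comp_ofReal

/-- The Wronskian of the two unperturbed solutions at infinity is constant, and its value is read
off as `s → ∞`. -/
theorem outSol_wronskian (l : ℕ) {ω : ℂ} (hω : ω ≠ 0) {s : ℝ} (hs : 0 < s) :
    outSolDeriv l ω s * outSol l (-ω * s) - outSol l (ω * s) * outSolDeriv l (-ω) s
      = -(2 * Complex.I * ω) := by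
  have hω' := neg_ne_zero.2 hω
  set w : ℝ → ℂ := fun s =>
    outSolDeriv l ω s * outSol l (-ω * s) - outSol l (ω * s) * outSolDeriv l (-ω) s with hw
  have hwd : ∀ s ∈ Ioi (0 : ℝ), HasDerivAt w 0 s := by
    intro s hs
    refine hasDerivAt_wronskian_zero (q := l * (l + 1) / (s : ℂ) ^ 2 - ω ^ 2)
      (hasDerivAt_outSol_ofReal l hω hs) (hasDerivAt_outSolDeriv_ofReal l hω hs)
      (hasDerivAt_outSol_ofReal l hω' hs)
      ((hasDerivAt_outSolDeriv_ofReal l hω' hs).congr_deriv (by ring))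
  have hlim : Tendsto w atTop (𝓝 (-(2 * Complex.I * ω))) := by
    have h1 := ((tendsto_outSolDeriv l hω).mul (tendsto_outSol l hω')).sub
      ((tendsto_outSol l hω).mul (tendsto_outSolDeriv l hω'))
    have e : -(Complex.I * ω) * 1 - 1 * -(Complex.I * -ω) = -(2 * Complex.I * ω) := by ring
    rw [e] at h1
    refine h1.congr fun s => ?_
    have h2 : Complex.exp (Complex.I * ω * s) * Complex.exp (Complex.I * -ω * s) = 1 := by
      rw [← Complex.exp_add, ← Complex.exp_zero]; congr 1; ring
    simp only [hw]
    linear_combination (outSolDeriv l ω s * outSol l (-ω * s)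
      - outSol l (ω * s) * outSolDeriv l (-ω) s) * h2
  have hconst : Tendsto w atTop (𝓝 (w s)) := by
    refine tendsto_const_nhds.congr' ?_
    filter_upwards [eventually_gt_atTop 0] with t ht
    exact eq_of_hasDerivAt_zero isOpen_Ioi (convex_Ioi 0) hwd hs ht
  exact tendsto_nhds_unique hconst hlim

/-! ### The perturbation series of `η¹` -/

/-- A continuous potential on `(0, ∞)` that is `O(1 / s)` at the centre and `O(s^{-5/2})` at
infinity. -/
structure IsShortRange (V : ℝ → ℝ) : Prop where
  continuousOn : ContinuousOn V (Ioi 0)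
  near : ∀ R : ℝ, ∃ M : ℝ, 0 < M ∧ ∀ s, 0 < s → s ≤ R → |V s| * s ≤ M
  far : ∀ s₀ : ℝ, 0 < s₀ → ∃ M : ℝ, 0 < M ∧ ∀ s, s₀ ≤ s → |V s| * s ≤ M * s ^ (-3 / 2 : ℝ)

/-- The perturbation series of `η¹` converges on `(0, R)` and solves the mode equation there. -/
theorem eta1_on_Ioo {T K : ℝ → ℝ} {l : ℕ} (hV : IsShortRange (pertW T K l)) (ω : ℂ) (R : ℝ) :
    (∀ n, ∀ s ∈ Ioo 0 R, IntegrableOn (fun y : ℝ => greenG l ω s y * (pertW T K l y : ℂ)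
      * eta1Term T K l ω n y) (Ioo 0 s)) ∧
    (∀ s ∈ Ioo 0 R, Summable fun n => eta1Term T K l ω n s) ∧
    (∀ s ∈ Ioo 0 R, HasDerivAt (eta1 T K l ω) (deriv (eta1 T K l ω) s) s) ∧
    (∀ s ∈ Ioo 0 R, HasDerivAt (deriv (eta1 T K l ω))
      ((l * (l + 1) / (s : ℂ) ^ 2 - ω ^ 2 + pertW T K l s) * eta1 T K l ω s) s) ∧
    ∃ C : ℝ, ∀ s ∈ Ioo 0 R,
      ‖eta1 T K l ω s - freeSol (l + 1) ω s‖ ≤ C * s ^ (l + 1 : ℤ) * s ∧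
      ‖deriv (eta1 T K l ω) s - freeSolDeriv (l + 1) ω s‖ ≤ C * s ^ (l : ℤ) * s := by
  obtain ⟨M, hM, hMle⟩ := hV.near R
  obtain ⟨A, hA, hAle⟩ := exists_bound_freeSol (l + 1) ω R
  obtain ⟨B, hB, hBle⟩ := exists_bound_freeSol (-l) ω R
  have hl : (0 : ℝ) < 2 * l + 1 := by positivity
  have hlc : (2 * l + 1 : ℂ) ≠ 0 := by exact_mod_cast hl.ne'
  have hln : ‖(2 * l + 1 : ℂ)‖ = 2 * l + 1 := by
    have : (2 * l + 1 : ℂ) = ((2 * l + 1 : ℝ) : ℂ) := by push_cast; rfl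
    rw [this, Complex.norm_real, Real.norm_of_nonneg hl.le]
  -- since `|V| s ≤ M` and `ρ σ = A B s`, the product `|V| ρ σ` is at most `m / 2`
  set m : ℝ := 2 * (M * A * B) with hm
  have hm0 : 0 < m := by positivity
  have hda : ∀ s ∈ Ioo 0 R, HasDerivAt (fun s : ℝ => freeSol (l + 1) ω s)
      (freeSolDeriv (l + 1) ω s) s := fun s hs => hasDerivAt_freeSol_ofReal _ _ hs.1
  have hdb : ∀ s ∈ Ioo 0 R, HasDerivAt (fun s : ℝ => freeSol (-l) ω s / (2 * l + 1))
      (freeSolDeriv (-l) ω s / (2 * l + 1)) s :=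
    fun s hs => (hasDerivAt_freeSol_ofReal _ _ hs.1).div_const _
  have hdvd : ∀ (z : ℂ) (x : ℝ), ‖z‖ ≤ x → ‖z / (2 * l + 1)‖ ≤ x := by
    intro z x hz
    rw [norm_div, hln]
    refine (div_le_self (norm_nonneg _) ?_).trans hz
    linarith
  have hzp : ∀ s : ℝ, 0 < s → s ^ (l + 1 : ℤ) * s ^ (-l : ℤ) = s := fun s hs => by
    rw [← zpow_add₀ hs.ne']; simp
  have hVB : IsVolterraBound (Ioo 0 R) (fun s => Ioo 0 s) (fun s : ℝ => freeSol (l + 1) ω s)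
      (fun s : ℝ => freeSol (-l) ω s / (2 * l + 1)) (fun s => (pertW T K l s : ℂ))
      (fun s => A * s ^ (l + 1 : ℤ)) (fun s => B * s ^ (-l : ℤ)) (fun _ => m) (fun s => m * s)
      (max (A * R ^ (l + 1 : ℤ)) (m * R)) :=
    { cont_a := fun s hs => (hda s hs).continuousAt.continuousWithinAt
      cont_b := fun s hs => (hdb s hs).continuousAt.continuousWithinAt
      cont_V := Complex.continuous_ofReal.comp_continuousOn
        (hV.continuousOn.mono Ioo_subset_Ioi_self)
      ρ_pos := fun s hs => mul_pos hA (zpow_pos hs.1 _)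
      σ_pos := fun s hs => mul_pos hB (zpow_pos hs.1 _)
      norm_a_le := fun s hs => (hAle s hs.1 hs.2.le).1
      norm_b_le := fun s hs => hdvd _ _ (hBle s hs.1 hs.2.le).1
      ratio_le := by
        intro s hs y hy
        have h1 : y ^ (l + 1 : ℤ) ≤ s ^ (l + 1 : ℤ) := zpow_le_zpow_left₀ (by omega) hy.1.le hy.2.le
        have h2 : s ^ (-l : ℤ) ≤ y ^ (-l : ℤ) := by
          rw [zpow_neg, zpow_neg]
          exact inv_anti₀ (zpow_pos hy.1 _) (zpow_le_zpow_left₀ (by omega) hy.1.le hy.2.le)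
        have h3 := zpow_pos hs.1 (-l : ℤ)
        have h4 := zpow_pos hs.1 (l + 1 : ℤ)
        gcongr
      weight_le := by
        intro s hs
        have := hMle s hs.1 hs.2.le
        rw [Complex.norm_real, Real.norm_eq_abs]
        calc |pertW T K l s| * (A * s ^ (l + 1 : ℤ) * (B * s ^ (-l : ℤ)))
            = |pertW T K l s| * (s ^ (l + 1 : ℤ) * s ^ (-l : ℤ)) * (A * B) := by ring
          _ = |pertW T K l s| * s * (A * B) := by rw [hzp s hs.1]
          _ ≤ M * (A * B) := by gcongr
          _ = m / 2 := by rw [hm]; ring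
      Φ_nonneg := fun s hs => mul_nonneg hm0.le hs.1.le
      ρ_le := fun s hs => le_max_of_le_left (by
        have := zpow_le_zpow_left₀ (by omega : (0 : ℤ) ≤ l + 1) hs.1.le hs.2.le
        gcongr)
      Φ_le := fun s hs => le_max_of_le_right (by
        have := hs.2.le
        gcongr)
      integrableOn_pow := fun n s hs => (const_weight_pow m n hs.1).1
      integral_pow := fun n s hs => (const_weight_pow m n hs.1).2 }
  have hgreen : ∀ s y : ℝ, 0 < s → 0 < y → greenG l ω s y = freeSol (l + 1) ω s
      * (freeSol (-l) ω y / (2 * l + 1)) - freeSol (-l) ω s / (2 * l + 1) * freeSol (l + 1) ω y := by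
    intro s y hs hy
    have e : 2 * lam l = 2 * l + 1 := by rw [lam]; ring
    rw [greenG, eta1Lead_lam l ω hs, eta1Lead_lam l ω hy, eta1Lead_neg_lam l ω hs,
      eta1Lead_neg_lam l ω hy, e]
    ring
  have key := hVB.solution (isVolterraDomain_Ioo R) (F := eta1Term T K l ω) (c := 1)
    (q := fun s => l * (l + 1) / (s : ℂ) ^ 2 - ω ^ 2)
    (fun s hs => by rw [one_mul]; exact eta1Lead_lam l ω hs.1)
    (fun n s hs => setIntegral_congr_fun measurableSet_Ioo fun y hy => by
      simp only [hgreen s y hs.1 hy.1]) hda hdb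
    (fun s hs => (hasDerivAt_freeSolDeriv_ofReal _ _ hs.1).congr_deriv (by push_cast; ring))
    (fun s hs => ((hasDerivAt_freeSolDeriv_ofReal _ _ hs.1).div_const _).congr_deriv
      (by push_cast; ring))
    (fun s hs => by
      have := freeSol_wronskian l ω hs.1
      field_simp
      linear_combination this)
  obtain ⟨k1, k2, k3, k4, C, hC⟩ := key
  refine ⟨fun n s hs => ?_, k2, k3, k4, ?_⟩
  · refine (k1 n s hs).congr_fun (fun y hy => ?_) measurableSet_Ioo
    simp only [hgreen s y hs.1 hy.1]
  · refine ⟨max (C * A * m) (C * m * (A + B * (A / B))), fun s hs => ⟨?_, ?_⟩⟩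
    · have := (hC s hs).1
      rw [one_mul] at this
      refine this.trans ?_
      have h1 := zpow_pos hs.1 (l + 1 : ℤ)
      have h2 := hs.1
      calc C * (A * s ^ (l + 1 : ℤ) * (m * s)) = C * A * m * s ^ (l + 1 : ℤ) * s := by ring
        _ ≤ _ := by gcongr; exact le_max_left _ _
    · have := (hC s hs).2
      rw [one_mul] at this
      refine this.trans ?_
      have h2 := hs.1
      have h3 := (hAle s hs.1 hs.2.le).2
      have h4 := hdvd _ _ (hBle s hs.1 hs.2.le).2
      rw [add_sub_cancel_right] at h3
      have hC0 : 0 ≤ C := by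
        have h7 := (norm_nonneg _).trans (hC s hs).1
        exact nonneg_of_mul_nonneg_left h7 (by positivity)
      have e1 : s ^ (-l - 1 : ℤ) * (s ^ (l + 1 : ℤ) / s ^ (-l : ℤ)) = s ^ (l : ℤ) := by
        rw [← zpow_sub₀ h2.ne', ← zpow_add₀ h2.ne']; congr 1; ring
      calc C * (m * s * (‖freeSolDeriv (l + 1) ω s‖ + ‖freeSolDeriv (-l) ω s / (2 * l + 1)‖
            * (A * s ^ (l + 1 : ℤ) / (B * s ^ (-l : ℤ)))))
          ≤ C * (m * s * (A * s ^ (l : ℤ) + B * s ^ (-l - 1 : ℤ)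
            * (A * s ^ (l + 1 : ℤ) / (B * s ^ (-l : ℤ))))) := by gcongr
        _ = C * (m * s * (A * s ^ (l : ℤ) + B * (A / B) *
            (s ^ (-l - 1 : ℤ) * (s ^ (l + 1 : ℤ) / s ^ (-l : ℤ))))) := by
          rw [mul_div_mul_comm]; ring
        _ = C * m * (A + B * (A / B)) * s ^ (l : ℤ) * s := by rw [e1]; ring
        _ ≤ _ := by gcongr; exact le_max_right _ _

/-- `η` is a twice differentiable solution of `η'' = (l (l + 1) / s² - ω² + V) η` on `(0, ∞)`. -/
structure IsModeSol (l : ℕ) (ω : ℂ) (V : ℝ → ℝ) (η : ℝ → ℂ) : Prop where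
  hasDerivAt : ∀ s : ℝ, 0 < s → HasDerivAt η (deriv η s) s
  hasDerivAt_deriv : ∀ s : ℝ, 0 < s →
    HasDerivAt (deriv η) ((l * (l + 1) / (s : ℂ) ^ 2 - ω ^ 2 + V s) * η s) s

section Eta1

variable {T K : ℝ → ℝ} {l : ℕ}

theorem eta1_converges (hV : IsShortRange (pertW T K l)) (ω : ℂ) {s : ℝ} (hs : 0 < s) :
    (∀ n, IntegrableOn (fun y : ℝ => greenG l ω s y * (pertW T K l y : ℂ)
      * eta1Term T K l ω n y) (Ioo 0 s)) ∧ Summable fun n => eta1Term T K l ω n s := by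
  have hs' : s ∈ Ioo 0 (s + 1) := ⟨hs, by linarith⟩
  obtain ⟨h1, h2, -⟩ := eta1_on_Ioo hV ω (s + 1)
  exact ⟨fun n => h1 n s hs', h2 s hs'⟩

theorem eta1_isModeSol (hV : IsShortRange (pertW T K l)) (ω : ℂ) :
    IsModeSol l ω (pertW T K l) (eta1 T K l ω) where
  hasDerivAt s hs := (eta1_on_Ioo hV ω (s + 1)).2.2.1 s ⟨hs, by linarith⟩
  hasDerivAt_deriv s hs := (eta1_on_Ioo hV ω (s + 1)).2.2.2.1 s ⟨hs, by linarith⟩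

theorem tendsto_eta1_zpow (hV : IsShortRange (pertW T K l)) (ω : ℂ) :
    Tendsto (fun s : ℝ => eta1 T K l ω s * (s : ℂ) ^ (-(l + 1) : ℤ)) (𝓝[>] 0) (𝓝 1) := by
  obtain ⟨C, hC⟩ := (eta1_on_Ioo hV ω 1).2.2.2.2
  have h1 := tendsto_freeSol_div (l + 1) ω
  have h2 : Tendsto (fun s : ℝ => (eta1 T K l ω s - freeSol (l + 1) ω s)
      * (s : ℂ) ^ (-(l + 1) : ℤ)) (𝓝[>] 0) (𝓝 0) := by
    refine squeeze_zero_norm' (a := fun s : ℝ => C * s) ?_ ?_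
    · filter_upwards [Ioo_mem_nhdsGT one_pos] with s hs
      rw [norm_mul, norm_zpow, Complex.norm_real, Real.norm_of_nonneg hs.1.le]
      have h3 := (hC s hs).1
      have h4 := zpow_pos hs.1 (-(l + 1) : ℤ)
      have h5 : s ^ (l + 1 : ℤ) * s ^ (-(l + 1) : ℤ) = 1 := by
        rw [← zpow_add₀ hs.1.ne', add_neg_cancel, zpow_zero]
      calc ‖eta1 T K l ω s - freeSol (l + 1) ω s‖ * s ^ (-(l + 1) : ℤ)
          ≤ C * s ^ (l + 1 : ℤ) * s * s ^ (-(l + 1) : ℤ) := by gcongr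
        _ = C * s * (s ^ (l + 1 : ℤ) * s ^ (-(l + 1) : ℤ)) := by ring
        _ = C * s := by rw [h5, mul_one]
    · have : Tendsto (fun s : ℝ => C * s) (𝓝 0) (𝓝 (C * 0)) := tendsto_id.const_mul C
      rw [mul_zero] at this
      exact this.mono_left nhdsWithin_le_nhds
  have h3 := h2.add h1
  rw [zero_add] at h3
  exact h3.congr fun s => by ring

theorem tendsto_eta1 (hV : IsShortRange (pertW T K l)) (ω : ℂ) :
    Tendsto (fun s : ℝ => eta1 T K l ω s * (s : ℂ) ^ (-lam l - 1 / 2)) (𝓝[>] 0) (𝓝 1) := by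
  refine (tendsto_eta1_zpow hV ω).congr' ?_
  filter_upwards [self_mem_nhdsWithin] with s hs
  rw [← Complex.cpow_intCast, lam]
  congr 2; push_cast; ring

/-- The case `l = 0` is the worst; these bounds are all that the energy of `γ¹` needs. -/
theorem exists_bound_eta1 (hV : IsShortRange (pertW T K l)) (ω : ℂ) :
    ∃ C : ℝ, ∀ s ∈ Ioo (0 : ℝ) 1,
    ‖eta1 T K l ω s‖ ≤ C * s ∧ ‖deriv (eta1 T K l ω) s‖ ≤ C := by
  obtain ⟨C, hC⟩ := (eta1_on_Ioo hV ω 1).2.2.2.2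
  obtain ⟨A, hA, hAle⟩ := exists_bound_freeSol (l + 1) ω 1
  refine ⟨max C 0 + A, fun s hs => ?_⟩
  obtain ⟨h1, h2⟩ := hC s hs
  obtain ⟨h3, h4⟩ := hAle s hs.1 hs.2.le
  have h0 := hs.1
  have h8 := hs.2.le
  have h5 : s ^ (l + 1 : ℤ) ≤ s := by
    rw [zpow_add_one₀ h0.ne', zpow_natCast]
    exact mul_le_of_le_one_left h0.le (pow_le_one₀ h0.le h8)
  have h6 : s ^ (l : ℤ) ≤ 1 := by
    rw [zpow_natCast]; exact pow_le_one₀ h0.le h8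
  rw [add_sub_cancel_right] at h4
  have hm : C ≤ max C 0 := le_max_left _ _
  constructor
  · calc ‖eta1 T K l ω s‖ = ‖(eta1 T K l ω s - freeSol (l + 1) ω s) + freeSol (l + 1) ω s‖ := by
          rw [sub_add_cancel]
      _ ≤ C * s ^ (l + 1 : ℤ) * s + A * s ^ (l + 1 : ℤ) := (norm_add_le _ _).trans (add_le_add h1 h3)
      _ ≤ max C 0 * s * 1 + A * s := by gcongr
      _ = _ := by ring
  · calc ‖deriv (eta1 T K l ω) s‖
        = ‖(deriv (eta1 T K l ω) s - freeSolDeriv (l + 1) ω s) + freeSolDeriv (l + 1) ω s‖ := by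
          rw [sub_add_cancel]
      _ ≤ C * s ^ (l : ℤ) * s + A * s ^ (l : ℤ) := (norm_add_le _ _).trans (add_le_add h2 h4)
      _ ≤ max C 0 * 1 * 1 + A * 1 := by gcongr
      _ = _ := by ring

end Eta1

/-! ### The perturbation series of `η²` -/

/-- The sum of the perturbation series of `η²`, which is `η²` itself if `Im ω ≤ 0`. -/
noncomputable def eta2Series (T K : ℝ → ℝ) (l : ℕ) (ω : ℂ) (s : ℝ) : ℂ :=
  ∑' n, eta2Term T K l ω n s

theorem norm_exp_I_mul (ω : ℂ) (s : ℝ) :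
    ‖Complex.exp (Complex.I * ω * s)‖ = Real.exp (-(ω.im * s)) := by
  rw [Complex.norm_exp]
  congr 1
  simp

theorem tendsto_rpow_neg_half (A : ℝ) :
    Tendsto (fun s : ℝ => A * s ^ (-1 / 2 : ℝ)) atTop (𝓝 0) := by
  have h := (tendsto_rpow_neg_atTop (by norm_num : (0 : ℝ) < 1 / 2)).const_mul A
  rw [mul_zero] at h
  refine h.congr fun s => ?_
  norm_num

theorem exists_bound_outSol (l : ℕ) {ω : ℂ} (hω : ω ≠ 0) {s₀ : ℝ} (hs₀ : 0 < s₀) :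
    ∃ C : ℝ, 0 < C ∧ ∀ s : ℝ, s₀ ≤ s → ‖outSol l (ω * s)‖ ≤ C * Real.exp (ω.im * s) ∧
      ‖outSolDeriv l ω s‖ ≤ C * Real.exp (ω.im * s) := by
  have hcE : Continuous fun s : ℝ => Complex.exp (Complex.I * ω * s) := by fun_prop
  have c1 : ContinuousOn (fun s : ℝ => outSol l (ω * s) * Complex.exp (Complex.I * ω * s))
      (Ici s₀) := ContinuousOn.mul (fun s hs => (hasDerivAt_outSol_ofReal l hω
        (hs₀.trans_le hs)).continuousAt.continuousWithinAt) hcE.continuousOn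
  have c2 : ContinuousOn (fun s : ℝ => outSolDeriv l ω s * Complex.exp (Complex.I * ω * s))
      (Ici s₀) := ContinuousOn.mul (fun s hs => (hasDerivAt_outSolDeriv_ofReal l hω
        (hs₀.trans_le hs)).continuousAt.continuousWithinAt) hcE.continuousOn
  obtain ⟨C1, h1, h1'⟩ := exists_bound_of_tendsto_atTop c1 (tendsto_outSol l hω)
  obtain ⟨C2, h2, h2'⟩ := exists_bound_of_tendsto_atTop c2 (tendsto_outSolDeriv l hω)
  have key : ∀ (z : ℂ) (C s : ℝ), ‖z * Complex.exp (Complex.I * ω * s)‖ ≤ C →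
      ‖z‖ ≤ C * Real.exp (ω.im * s) := by
    intro z C s h
    rw [norm_mul, norm_exp_I_mul, Real.exp_neg] at h
    rwa [← div_eq_mul_inv, div_le_iff₀ (Real.exp_pos _)] at h
  refine ⟨max C1 C2, by positivity, fun s hs => ⟨?_, ?_⟩⟩
  · exact key _ _ _ ((h1' s hs).trans (le_max_left _ _))
  · exact key _ _ _ ((h2' s hs).trans (le_max_right _ _))

/-- The perturbation series of `η²` converges on `(s₀, ∞)` and solves the mode equation there. -/
theorem eta2Series_on_Ioi {T K : ℝ → ℝ} {l : ℕ} (hV : IsShortRange (pertW T K l)) {ω : ℂ}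
    (hω : ω ≠ 0) (him : ω.im ≤ 0) {s₀ : ℝ} (hs₀ : 0 < s₀) :
    (∀ n, ∀ s ∈ Ioi s₀, IntegrableOn (fun y : ℝ => greenB l ω s y * (pertW T K l y : ℂ)
      * eta2Term T K l ω n y) (Ioi s)) ∧
    (∀ s ∈ Ioi s₀, Summable fun n => eta2Term T K l ω n s) ∧
    (∀ s ∈ Ioi s₀, HasDerivAt (eta2Series T K l ω) (deriv (eta2Series T K l ω) s) s) ∧
    (∀ s ∈ Ioi s₀, HasDerivAt (deriv (eta2Series T K l ω))
      ((l * (l + 1) / (s : ℂ) ^ 2 - ω ^ 2 + pertW T K l s) * eta2Series T K l ω s) s) ∧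
    ∃ C : ℝ, ∀ s ∈ Ioi s₀,
      ‖eta2Series T K l ω s - outSol l (ω * s)‖ ≤ C * s ^ (-1 / 2 : ℝ) * Real.exp (ω.im * s) ∧
      ‖deriv (eta2Series T K l ω) s - outSolDeriv l ω s‖
        ≤ C * s ^ (-1 / 2 : ℝ) * Real.exp (ω.im * s) := by
  have hω' := neg_ne_zero.2 hω
  obtain ⟨M, hM, hMle⟩ := hV.far s₀ hs₀
  obtain ⟨A, hA, hAle⟩ := exists_bound_outSol l hω hs₀
  obtain ⟨B', hB', hBle'⟩ := exists_bound_outSol l hω' hs₀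
  -- the factor that normalises the Wronskian of `outSol l (ω s)` and `outSol l (-ω s)`
  set k : ℂ := -Complex.I / (2 * ω) with hk
  have hk0 : 0 < ‖k‖ := norm_pos_iff.2 (div_ne_zero (neg_ne_zero.2 Complex.I_ne_zero)
    (mul_ne_zero two_ne_zero hω))
  set B : ℝ := ‖k‖ * B' with hBdef
  have hB : 0 < B := mul_pos hk0 hB'
  have hBle : ∀ s : ℝ, s₀ ≤ s → ‖k * outSol l (-ω * s)‖ ≤ B * Real.exp (-(ω.im * s)) ∧
      ‖k * outSolDeriv l (-ω) s‖ ≤ B * Real.exp (-(ω.im * s)) := by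
    intro s hs
    have h := hBle' s hs
    have e : (-ω).im * s = -(ω.im * s) := by rw [Complex.neg_im, neg_mul]
    rw [e] at h
    rw [norm_mul, norm_mul, hBdef, mul_assoc]
    exact ⟨mul_le_mul_of_nonneg_left h.1 hk0.le, mul_le_mul_of_nonneg_left h.2 hk0.le⟩
  set m₀ : ℝ := 2 * (M / s₀ * A * B) with hm
  have hpos : ∀ s ∈ Ioi s₀, 0 < s := fun s hs => hs₀.trans hs
  have hda : ∀ s ∈ Ioi s₀, HasDerivAt (fun s : ℝ => outSol l (ω * s)) (outSolDeriv l ω s) s :=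
    fun s hs => hasDerivAt_outSol_ofReal l hω (hpos s hs)
  have hdb : ∀ s ∈ Ioi s₀, HasDerivAt (fun s : ℝ => k * outSol l (-ω * s))
      (k * outSolDeriv l (-ω) s) s :=
    fun s hs => (hasDerivAt_outSol_ofReal l hω' (hpos s hs)).const_mul k
  have hexp : ∀ s : ℝ, Real.exp (ω.im * s) * Real.exp (-(ω.im * s)) = 1 := fun s => by
    rw [← Real.exp_add, add_neg_cancel, Real.exp_zero]
  have hVB : IsVolterraBound (Ioi s₀) Ioi (fun s : ℝ => outSol l (ω * s))
      (fun s : ℝ => k * outSol l (-ω * s)) (fun s => (pertW T K l s : ℂ))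
      (fun s => A * Real.exp (ω.im * s)) (fun s => B * Real.exp (-(ω.im * s)))
      (fun s => m₀ * s ^ (-3 / 2 : ℝ)) (fun s => 2 * m₀ * s ^ (-1 / 2 : ℝ))
      (max A (2 * m₀ * s₀ ^ (-1 / 2 : ℝ))) :=
    { cont_a := fun s hs => (hda s hs).continuousAt.continuousWithinAt
      cont_b := fun s hs => (hdb s hs).continuousAt.continuousWithinAt
      cont_V := Complex.continuous_ofReal.comp_continuousOn
        (hV.continuousOn.mono (Ioi_subset_Ioi hs₀.le))
      ρ_pos := fun s hs => mul_pos hA (Real.exp_pos _)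
      σ_pos := fun s hs => mul_pos hB (Real.exp_pos _)
      norm_a_le := fun s hs => (hAle s (le_of_lt hs)).1
      norm_b_le := fun s hs => (hBle s (le_of_lt hs)).1
      ratio_le := by
        intro s hs y hy
        have h1 : ω.im * y ≤ ω.im * s := mul_le_mul_of_nonpos_left (le_of_lt hy) him
        gcongr
      weight_le := by
        intro s hs
        have h1 := hMle s (le_of_lt hs)
        have h2 := hpos s hs
        have h3 : |pertW T K l s| ≤ M / s₀ * s ^ (-3 / 2 : ℝ) := by
          rw [div_mul_eq_mul_div, le_div_iff₀ hs₀]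
          refine le_trans ?_ h1
          have := le_of_lt (mem_Ioi.1 hs)
          gcongr
        rw [Complex.norm_real, Real.norm_eq_abs]
        calc |pertW T K l s| * (A * Real.exp (ω.im * s) * (B * Real.exp (-(ω.im * s))))
            = |pertW T K l s| * (Real.exp (ω.im * s) * Real.exp (-(ω.im * s))) * (A * B) := by ring
          _ = |pertW T K l s| * (A * B) := by rw [hexp, mul_one]
          _ ≤ M / s₀ * s ^ (-3 / 2 : ℝ) * (A * B) := by gcongr
          _ = m₀ * s ^ (-3 / 2 : ℝ) / 2 := by rw [hm]; ring
      Φ_nonneg := fun s hs => by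
        have := hpos s hs
        positivity
      ρ_le := fun s hs => le_max_of_le_left (by
        refine mul_le_of_le_one_right hA.le (Real.exp_le_one_iff.2 ?_)
        exact mul_nonpos_of_nonpos_of_nonneg him (hpos s hs).le)
      Φ_le := fun s hs => le_max_of_le_right (by
        have := Real.rpow_le_rpow_of_nonpos hs₀ (le_of_lt (mem_Ioi.1 hs))
          (by norm_num : (-1 / 2 : ℝ) ≤ 0)
        gcongr)
      integrableOn_pow := fun n s hs => (rpow_weight_pow m₀ n (hpos s hs)).1
      integral_pow := fun n s hs => (rpow_weight_pow m₀ n (hpos s hs)).2 }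
  have hgreen : ∀ s y : ℝ, 0 < s → 0 < y → greenB l ω s y = outSol l (ω * s)
      * (k * outSol l (-ω * y)) - k * outSol l (-ω * s) * outSol l (ω * y) := by
    intro s y hs hy
    rw [greenB, if_neg hω, eta2Lead_eq_outSol l hω hs, eta2Lead_eq_outSol l hω hy,
      eta2Lead_eq_outSol l hω' hs, eta2Lead_eq_outSol l hω' hy, hk]
    ring
  have key := hVB.solution (isVolterraDomain_Ioi s₀) (F := eta2Term T K l ω) (c := 1)
    (q := fun s => l * (l + 1) / (s : ℂ) ^ 2 - ω ^ 2)
    (fun s hs => by rw [one_mul]; exact eta2Lead_eq_outSol l hω (hpos s hs))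
    (fun n s hs => setIntegral_congr_fun measurableSet_Ioi fun y hy => by
      simp only [hgreen s y (hpos s hs) ((hpos s hs).trans hy)]) hda hdb
    (fun s hs => hasDerivAt_outSolDeriv_ofReal l hω (hpos s hs))
    (fun s hs => ((hasDerivAt_outSolDeriv_ofReal l hω' (hpos s hs)).const_mul k).congr_deriv
      (by ring))
    (fun s hs => by
      have h1 := outSol_wronskian l hω (hpos s hs)
      have h2 : k * (2 * Complex.I * ω) = 1 := by
        rw [hk]; field_simp; simp
      linear_combination (-k) * h1 + h2)
  obtain ⟨k1, k2, k3, k4, C, hC⟩ := key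
  refine ⟨fun n s hs => ?_, k2, k3, k4, ?_⟩
  · refine (k1 n s hs).congr_fun (fun y hy => ?_) measurableSet_Ioi
    simp only [hgreen s y (hpos s hs) ((hpos s hs).trans hy)]
  · refine ⟨max (C * A * (2 * m₀)) (C * (2 * m₀) * (A + B * (A / B))), fun s hs => ⟨?_, ?_⟩⟩
    · have := (hC s hs).1
      rw [one_mul] at this
      refine this.trans ?_
      have h2 := hpos s hs
      calc C * (A * Real.exp (ω.im * s) * (2 * m₀ * s ^ (-1 / 2 : ℝ)))
          = C * A * (2 * m₀) * s ^ (-1 / 2 : ℝ) * Real.exp (ω.im * s) := by ring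
        _ ≤ _ := by gcongr; exact le_max_left _ _
    · have := (hC s hs).2
      rw [one_mul] at this
      refine this.trans ?_
      have h2 := hpos s hs
      have h3 := (hAle s (le_of_lt hs)).2
      have h4 := (hBle s (le_of_lt hs)).2
      have hC0 : 0 ≤ C := by
        have h7 := (norm_nonneg _).trans (hC s hs).1
        exact nonneg_of_mul_nonneg_left h7 (by positivity)
      have e1 : Real.exp (-(ω.im * s)) * (Real.exp (ω.im * s) / Real.exp (-(ω.im * s)))
          = Real.exp (ω.im * s) := by
        field_simp
      calc C * (2 * m₀ * s ^ (-1 / 2 : ℝ) * (‖outSolDeriv l ω s‖ + ‖k * outSolDeriv l (-ω) s‖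
            * (A * Real.exp (ω.im * s) / (B * Real.exp (-(ω.im * s))))))
          ≤ C * (2 * m₀ * s ^ (-1 / 2 : ℝ) * (A * Real.exp (ω.im * s)
            + B * Real.exp (-(ω.im * s))
            * (A * Real.exp (ω.im * s) / (B * Real.exp (-(ω.im * s)))))) := by gcongr
        _ = C * (2 * m₀ * s ^ (-1 / 2 : ℝ) * (A * Real.exp (ω.im * s) + B * (A / B) *
            (Real.exp (-(ω.im * s)) * (Real.exp (ω.im * s) / Real.exp (-(ω.im * s)))))) := by
          rw [mul_div_mul_comm]; ring
        _ = C * (2 * m₀) * (A + B * (A / B)) * s ^ (-1 / 2 : ℝ) * Real.exp (ω.im * s) := by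
          rw [e1]; ring
        _ ≤ _ := by gcongr; exact le_max_right _ _

/-- At `ω = 0` the perturbation series of `η²` converges on `(s₀, ∞)` and solves the mode equation
there. -/
theorem eta2Series_zero_on_Ioi {T K : ℝ → ℝ} {l : ℕ} (hV : IsShortRange (pertW T K l))
    {s₀ : ℝ} (hs₀ : 0 < s₀) :
    (∀ n, ∀ s ∈ Ioi s₀, IntegrableOn (fun y : ℝ => greenB l 0 s y * (pertW T K l y : ℂ)
      * eta2Term T K l 0 n y) (Ioi s)) ∧
    (∀ s ∈ Ioi s₀, Summable fun n => eta2Term T K l 0 n s) ∧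
    (∀ s ∈ Ioi s₀, HasDerivAt (eta2Series T K l 0) (deriv (eta2Series T K l 0) s) s) ∧
    (∀ s ∈ Ioi s₀, HasDerivAt (deriv (eta2Series T K l 0))
      ((l * (l + 1) / (s : ℂ) ^ 2 - 0 ^ 2 + pertW T K l s) * eta2Series T K l 0 s) s) ∧
    ∃ C : ℝ, ∀ s ∈ Ioi s₀,
      ‖eta2Series T K l 0 s - eta2ZeroConst l * (s : ℂ) ^ (-l : ℤ)‖
        ≤ C * s ^ (-1 / 2 : ℝ) * s ^ (-l : ℤ) ∧
      ‖deriv (eta2Series T K l 0) s - eta2ZeroConst l * (-l * (s : ℂ) ^ (-l - 1 : ℤ))‖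
        ≤ C * s ^ (-1 / 2 : ℝ) * s ^ (-l - 1 : ℤ) := by
  obtain ⟨M, hM, hMle⟩ := hV.far s₀ hs₀
  have hl : (0 : ℝ) < 2 * l + 1 := by positivity
  have hlc : (2 * l + 1 : ℂ) ≠ 0 := by exact_mod_cast hl.ne'
  have hfs : ∀ (p : ℤ) (z : ℂ), freeSol p 0 z = z ^ p := by
    intro p z
    have e1 : (p : ℂ) - 1 / 2 + 1 = p + 1 / 2 := by ring
    rw [freeSol, zero_mul, zero_div, zero_pow two_ne_zero, besselCore_zero, e1,
      mul_inv_cancel₀ (Gamma_int_add_half_ne_zero p), mul_one]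
  have hfd : ∀ (p : ℤ) (z : ℂ), freeSolDeriv p 0 z = p * z ^ (p - 1) := by
    intro p z
    have e1 : (p : ℂ) - 1 / 2 + 1 = p + 1 / 2 := by ring
    rw [freeSolDeriv, zero_mul, zero_div, zero_pow two_ne_zero, besselCore_zero, e1, zero_mul,
      zero_div, zero_mul, sub_zero]
    linear_combination ((p : ℂ) * z ^ (p - 1)) * mul_inv_cancel₀ (Gamma_int_add_half_ne_zero p)
  have hl1 : 1 ≤ ‖(2 * l + 1 : ℂ)‖ := by
    have : (2 * l + 1 : ℂ) = ((2 * l + 1 : ℝ) : ℂ) := by push_cast; rfl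
    rw [this, Complex.norm_real, Real.norm_of_nonneg hl.le]
    linarith
  have hll : ‖(l + 1 : ℂ)‖ ≤ ‖(2 * l + 1 : ℂ)‖ := by
    have h1 : (2 * l + 1 : ℂ) = ((2 * l + 1 : ℝ) : ℂ) := by push_cast; rfl
    have h2 : (l + 1 : ℂ) = ((l + 1 : ℝ) : ℂ) := by push_cast; rfl
    rw [h1, h2, Complex.norm_real, Complex.norm_real, Real.norm_of_nonneg hl.le,
      Real.norm_of_nonneg (by positivity)]
    linarith
  set m₀ : ℝ := 2 * M with hm
  have hpos : ∀ s ∈ Ioi s₀, 0 < s := fun s hs => hs₀.trans hs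
  have hda : ∀ s ∈ Ioi s₀, HasDerivAt (fun s : ℝ => freeSol (-l) 0 s)
      (freeSolDeriv (-l) 0 s) s := fun s hs => hasDerivAt_freeSol_ofReal _ _ (hpos s hs)
  have hdb : ∀ s ∈ Ioi s₀, HasDerivAt (fun s : ℝ => freeSol (l + 1) 0 s / (2 * l + 1))
      (freeSolDeriv (l + 1) 0 s / (2 * l + 1)) s :=
    fun s hs => (hasDerivAt_freeSol_ofReal _ _ (hpos s hs)).div_const _
  have hnz : ∀ (p : ℤ) (s : ℝ), 0 < s → ‖(s : ℂ) ^ p‖ = s ^ p := fun p s hs => by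
    rw [norm_zpow, Complex.norm_real, Real.norm_of_nonneg hs.le]
  have hzp : ∀ s : ℝ, 0 < s → s ^ (-l : ℤ) * s ^ (l + 1 : ℤ) = s := fun s hs => by
    rw [← zpow_add₀ hs.ne']; simp
  have hanti : ∀ s y : ℝ, 0 < s → s ≤ y → y ^ (-l : ℤ) ≤ s ^ (-l : ℤ) := fun s y hs hsy => by
    rw [zpow_neg, zpow_neg]
    exact inv_anti₀ (zpow_pos hs _) (zpow_le_zpow_left₀ (by omega) hs.le hsy)
  have hVB : IsVolterraBound (Ioi s₀) Ioi (fun s : ℝ => freeSol (-l) 0 s)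
      (fun s : ℝ => freeSol (l + 1) 0 s / (2 * l + 1)) (fun s => (pertW T K l s : ℂ))
      (fun s => s ^ (-l : ℤ)) (fun s => s ^ (l + 1 : ℤ))
      (fun s => m₀ * s ^ (-3 / 2 : ℝ)) (fun s => 2 * m₀ * s ^ (-1 / 2 : ℝ))
      (max (s₀ ^ (-l : ℤ)) (2 * m₀ * s₀ ^ (-1 / 2 : ℝ))) :=
    { cont_a := fun s hs => (hda s hs).continuousAt.continuousWithinAt
      cont_b := fun s hs => (hdb s hs).continuousAt.continuousWithinAt
      cont_V := Complex.continuous_ofReal.comp_continuousOn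
        (hV.continuousOn.mono (Ioi_subset_Ioi hs₀.le))
      ρ_pos := fun s hs => zpow_pos (hpos s hs) _
      σ_pos := fun s hs => zpow_pos (hpos s hs) _
      norm_a_le := fun s hs => by rw [hfs, hnz _ _ (hpos s hs)]
      norm_b_le := fun s hs => by
        rw [hfs, norm_div, hnz _ _ (hpos s hs)]
        exact div_le_self (zpow_pos (hpos s hs) _).le hl1
      ratio_le := by
        intro s hs y hy
        have h0 := hpos s hs
        have h1 := hanti s y h0 (le_of_lt hy)
        have h2 : s ^ (l + 1 : ℤ) ≤ y ^ (l + 1 : ℤ) :=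
          zpow_le_zpow_left₀ (by omega) h0.le (le_of_lt hy)
        have h3 := zpow_pos h0 (l + 1 : ℤ)
        have h4 := zpow_pos h0 (-l : ℤ)
        gcongr
      weight_le := by
        intro s hs
        have h1 := hMle s (le_of_lt hs)
        rw [Complex.norm_real, Real.norm_eq_abs, hzp s (hpos s hs)]
        exact h1.trans_eq (by rw [hm]; ring)
      Φ_nonneg := fun s hs => by
        have := hpos s hs
        positivity
      ρ_le := fun s hs => le_max_of_le_left (hanti s₀ s hs₀ (le_of_lt hs))
      Φ_le := fun s hs => le_max_of_le_right (by
        have := Real.rpow_le_rpow_of_nonpos hs₀ (le_of_lt (mem_Ioi.1 hs))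
          (by norm_num : (-1 / 2 : ℝ) ≤ 0)
        gcongr)
      integrableOn_pow := fun n s hs => (rpow_weight_pow m₀ n (hpos s hs)).1
      integral_pow := fun n s hs => (rpow_weight_pow m₀ n (hpos s hs)).2 }
  have hgreen : ∀ s y : ℝ, greenB l 0 s y = freeSol (-l) 0 s
      * (freeSol (l + 1) 0 y / (2 * l + 1)) - freeSol (l + 1) 0 s / (2 * l + 1)
        * freeSol (-l) 0 y := by
    intro s y
    have e : 2 * lam l = 2 * l + 1 := by rw [lam]; ring
    have e1 : lam l + 1 / 2 = ((l + 1 : ℤ) : ℂ) := by rw [lam]; push_cast; ring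
    have e2 : -lam l + 1 / 2 = ((-l : ℤ) : ℂ) := by rw [lam]; push_cast; ring
    rw [greenB, if_pos rfl, e, e1, e2]
    simp only [Complex.cpow_intCast, hfs]
    ring
  have key := hVB.solution (isVolterraDomain_Ioi s₀) (F := eta2Term T K l 0)
    (c := eta2ZeroConst l) (q := fun s => l * (l + 1) / (s : ℂ) ^ 2 - 0 ^ 2)
    (fun s hs => by
      change eta2Lead l 0 s = _
      rw [eta2Lead, if_pos rfl, hfs, zpow_neg, zpow_natCast, div_eq_mul_inv])
    (fun n s hs => setIntegral_congr_fun measurableSet_Ioi fun y hy => by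
      simp only [hgreen s y]) hda hdb
    (fun s hs => (hasDerivAt_freeSolDeriv_ofReal _ _ (hpos s hs)).congr_deriv (by push_cast; ring))
    (fun s hs => ((hasDerivAt_freeSolDeriv_ofReal _ _ (hpos s hs)).div_const _).congr_deriv
      (by push_cast; ring))
    (fun s hs => by
      have := freeSol_wronskian l 0 (hpos s hs)
      field_simp
      linear_combination this)
  obtain ⟨k1, k2, k3, k4, C, hC⟩ := key
  refine ⟨fun n s hs => ?_, k2, k3, k4, ?_⟩
  · refine (k1 n s hs).congr_fun (fun y hy => ?_) measurableSet_Ioi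
    simp only [hgreen s y]
  · refine ⟨max (C * (2 * m₀)) (C * (2 * m₀) * (l + 1)), fun s hs => ⟨?_, ?_⟩⟩
    · have := (hC s hs).1
      simp only [hfs] at this
      refine this.trans ?_
      have h2 := hpos s hs
      have h3 := zpow_pos h2 (-l : ℤ)
      calc C * (s ^ (-l : ℤ) * (2 * m₀ * s ^ (-1 / 2 : ℝ)))
          = C * (2 * m₀) * s ^ (-1 / 2 : ℝ) * s ^ (-l : ℤ) := by ring
        _ ≤ _ := by gcongr; exact le_max_left _ _
    · have := (hC s hs).2
      simp only [hfd] at this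
      push_cast at this
      refine this.trans ?_
      have h2 := hpos s hs
      have hC0 : 0 ≤ C := by
        have h7 := (norm_nonneg _).trans (hC s hs).1
        exact nonneg_of_mul_nonneg_left h7 (by positivity)
      have e1 : s ^ (l : ℤ) * (s ^ (-l : ℤ) / s ^ (l + 1 : ℤ)) = s ^ (-l - 1 : ℤ) := by
        rw [← zpow_sub₀ h2.ne', ← zpow_add₀ h2.ne']; congr 1; ring
      have n1 : ‖-(l : ℂ) * (s : ℂ) ^ (-l - 1 : ℤ)‖ = l * s ^ (-l - 1 : ℤ) := by
        rw [norm_mul, norm_neg, Complex.norm_natCast, hnz _ _ h2]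
      have n2 : ‖(l + 1 : ℂ) * (s : ℂ) ^ (l + 1 - 1 : ℤ) / (2 * l + 1)‖ ≤ s ^ (l : ℤ) := by
        rw [norm_div, norm_mul, hnz _ _ h2, add_sub_cancel_right]
        refine div_le_of_le_mul₀ (norm_nonneg _) (zpow_pos h2 _).le ?_
        rw [mul_comm]
        exact mul_le_mul_of_nonneg_left hll (zpow_pos h2 _).le
      rw [n1]
      calc _ ≤ C * (2 * m₀ * s ^ (-1 / 2 : ℝ) * (l * s ^ (-l - 1 : ℤ) + s ^ (l : ℤ)
            * (s ^ (-l : ℤ) / s ^ (l + 1 : ℤ)))) := by gcongr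
        _ = C * (2 * m₀) * (l + 1) * s ^ (-1 / 2 : ℝ) * s ^ (-l - 1 : ℤ) := by rw [e1]; ring
        _ ≤ _ := by gcongr; exact le_max_right _ _

section Eta2

variable {T K : ℝ → ℝ} {l : ℕ} {ω : ℂ}

theorem eta2_converges (hV : IsShortRange (pertW T K l)) (him : ω.im ≤ 0) {s : ℝ} (hs : 0 < s) :
    (∀ n, IntegrableOn (fun y : ℝ => greenB l ω s y * (pertW T K l y : ℂ)
      * eta2Term T K l ω n y) (Ioi s)) ∧ Summable fun n => eta2Term T K l ω n s := by
  have hs' : s ∈ Ioi (s / 2) := half_lt_self hs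
  rcases eq_or_ne ω 0 with rfl | hω
  · obtain ⟨h1, h2, -⟩ := eta2Series_zero_on_Ioi hV (half_pos hs)
    exact ⟨fun n => h1 n s hs', h2 s hs'⟩
  · obtain ⟨h1, h2, -⟩ := eta2Series_on_Ioi hV hω him (half_pos hs)
    exact ⟨fun n => h1 n s hs', h2 s hs'⟩

theorem eta2Series_isModeSol (hV : IsShortRange (pertW T K l)) (him : ω.im ≤ 0) :
    IsModeSol l ω (pertW T K l) (eta2Series T K l ω) := by
  rcases eq_or_ne ω 0 with rfl | hω
  · exact ⟨fun s hs => (eta2Series_zero_on_Ioi hV (half_pos hs)).2.2.1 s (half_lt_self hs),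
      fun s hs => (eta2Series_zero_on_Ioi hV (half_pos hs)).2.2.2.1 s (half_lt_self hs)⟩
  · exact ⟨fun s hs => (eta2Series_on_Ioi hV hω him (half_pos hs)).2.2.1 s (half_lt_self hs),
      fun s hs => (eta2Series_on_Ioi hV hω him (half_pos hs)).2.2.2.1 s (half_lt_self hs)⟩

/-- The series solution and its derivative behave at infinity as `e^{-iωs}` does. -/
theorem tendsto_eta2Series (hV : IsShortRange (pertW T K l)) (hω : ω ≠ 0) (him : ω.im ≤ 0) :
    Tendsto (fun s : ℝ => eta2Series T K l ω s * Complex.exp (Complex.I * ω * s)) atTop (𝓝 1) ∧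
    Tendsto (fun s : ℝ => deriv (eta2Series T K l ω) s * Complex.exp (Complex.I * ω * s)) atTop
      (𝓝 (-(Complex.I * ω))) := by
  obtain ⟨C, hC⟩ := (eta2Series_on_Ioi hV hω him one_pos).2.2.2.2
  have key : ∀ f g : ℝ → ℂ, ∀ c : ℂ,
      (∀ s ∈ Ioi (1 : ℝ), ‖f s - g s‖ ≤ C * s ^ (-1 / 2 : ℝ) * Real.exp (ω.im * s)) →
      Tendsto (fun s : ℝ => g s * Complex.exp (Complex.I * ω * s)) atTop (𝓝 c) →
      Tendsto (fun s : ℝ => f s * Complex.exp (Complex.I * ω * s)) atTop (𝓝 c) := by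
    intro f g c hfg hg
    have h1 : Tendsto (fun s : ℝ => (f s - g s) * Complex.exp (Complex.I * ω * s)) atTop (𝓝 0) := by
      refine squeeze_zero_norm' (a := fun s : ℝ => C * s ^ (-1 / 2 : ℝ)) ?_
        (tendsto_rpow_neg_half C)
      filter_upwards [eventually_gt_atTop 1] with s hs
      rw [norm_mul, norm_exp_I_mul]
      have h2 := mul_le_mul_of_nonneg_right (hfg s hs) (Real.exp_pos (-(ω.im * s))).le
      rwa [mul_assoc (C * _), ← Real.exp_add, add_neg_cancel, Real.exp_zero, mul_one] at h2
    have h3 := h1.add hg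
    rw [zero_add] at h3
    exact h3.congr fun s => by ring
  exact ⟨key _ _ _ (fun s hs => (hC s hs).1) (tendsto_outSol l hω),
    key _ _ _ (fun s hs => (hC s hs).2) (tendsto_outSolDeriv l hω)⟩

theorem tendsto_eta2Series_zero (hV : IsShortRange (pertW T K l)) :
    Tendsto (fun s : ℝ => eta2Series T K l 0 s * (s : ℂ) ^ (l : ℤ)) atTop (𝓝 (eta2ZeroConst l)) ∧
    Tendsto (fun s : ℝ => deriv (eta2Series T K l 0) s * (s : ℂ) ^ (l + 1 : ℤ)) atTop
      (𝓝 (-(l * eta2ZeroConst l))) := by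
  obtain ⟨C, hC⟩ := (eta2Series_zero_on_Ioi hV one_pos).2.2.2.2
  have key : ∀ (f : ℝ → ℂ) (c : ℂ) (p : ℤ),
      (∀ s ∈ Ioi (1 : ℝ), ‖f s - c * (s : ℂ) ^ (-p)‖ ≤ C * s ^ (-1 / 2 : ℝ) * s ^ (-p)) →
      Tendsto (fun s : ℝ => f s * (s : ℂ) ^ p) atTop (𝓝 c) := by
    intro f c p hf
    rw [tendsto_iff_norm_sub_tendsto_zero]
    refine squeeze_zero' (Eventually.of_forall fun s => norm_nonneg _)
      (g := fun s : ℝ => C * s ^ (-1 / 2 : ℝ)) ?_ (tendsto_rpow_neg_half C)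
    filter_upwards [eventually_gt_atTop 1] with s hs
    have hs0 : 0 < s := one_pos.trans hs
    have hsc : (s : ℂ) ≠ 0 := by exact_mod_cast hs0.ne'
    have h1 : (s : ℂ) ^ (-p) * (s : ℂ) ^ p = 1 := by
      rw [← zpow_add₀ hsc, neg_add_cancel, zpow_zero]
    have h2 : s ^ (-p) * s ^ p = 1 := by
      rw [← zpow_add₀ hs0.ne', neg_add_cancel, zpow_zero]
    have h3 : f s * (s : ℂ) ^ p - c = (f s - c * (s : ℂ) ^ (-p)) * (s : ℂ) ^ p := by
      linear_combination c * h1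
    rw [h3, norm_mul, norm_zpow, Complex.norm_real, Real.norm_of_nonneg hs0.le]
    have h4 := mul_le_mul_of_nonneg_right (hf s hs) (zpow_pos hs0 p).le
    rwa [mul_assoc (C * _), h2, mul_one] at h4
  refine ⟨key _ _ _ fun s hs => (hC s hs).1, key _ _ _ fun s hs => ?_⟩
  have e : -((l : ℤ) + 1) = -l - 1 := by ring
  rw [e]
  convert (hC s hs).2 using 2
  ring

theorem eta2_eq_series (him : ω.im ≤ 0) : eta2 T K l ω = eta2Series T K l ω := by
  funext s; rw [eta2, if_pos him]; rfl

theorem eta2_eq_conj (him : 0 < ω.im) :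
    eta2 T K l ω = fun s => starRingEnd ℂ (eta2Series T K l (starRingEnd ℂ ω) s) := by
  funext s; rw [eta2, if_neg (not_le.2 him)]; rfl

theorem conj_im_nonpos (him : 0 < ω.im) : (starRingEnd ℂ ω).im ≤ 0 := by
  rw [Complex.conj_im]; linarith

theorem conj_ne_zero_of_im_pos (him : 0 < ω.im) : starRingEnd ℂ ω ≠ 0 := by
  rw [Ne, map_eq_zero]
  rintro rfl
  simp at him

theorem eta2_hasDerivAt_conj (hV : IsShortRange (pertW T K l)) (him : 0 < ω.im) {s : ℝ}
    (hs : 0 < s) : HasDerivAt (eta2 T K l ω)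
      (starRingEnd ℂ (deriv (eta2Series T K l (starRingEnd ℂ ω)) s)) s := by
  rw [eta2_eq_conj him]
  exact ((eta2Series_isModeSol hV (conj_im_nonpos him)).hasDerivAt s hs).star

theorem eta2_isModeSol (hV : IsShortRange (pertW T K l)) :
    IsModeSol l ω (pertW T K l) (eta2 T K l ω) := by
  rcases le_or_gt ω.im 0 with him | him
  · rw [eta2_eq_series him]; exact eta2Series_isModeSol hV him
  · have h1 := eta2Series_isModeSol hV (conj_im_nonpos him)
    have hd : ∀ s : ℝ, 0 < s → deriv (eta2 T K l ω) s
        = starRingEnd ℂ (deriv (eta2Series T K l (starRingEnd ℂ ω)) s) :=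
      fun s hs => (eta2_hasDerivAt_conj hV him hs).deriv
    refine ⟨fun s hs => by rw [hd s hs]; exact eta2_hasDerivAt_conj hV him hs, fun s hs => ?_⟩
    refine ((h1.hasDerivAt_deriv s hs).star.congr_of_eventuallyEq ?_).congr_deriv ?_
    · filter_upwards [lt_mem_nhds hs] with y hy using hd y hy
    · rw [eta2_eq_conj him, ← starRingEnd_apply, map_mul]
      simp

theorem tendsto_eta2 (hV : IsShortRange (pertW T K l)) (him : ω.im ≤ 0) (hω : ω ≠ 0) :
    Tendsto (fun s : ℝ => eta2 T K l ω s * Complex.exp (Complex.I * ω * s)) atTop (𝓝 1) := by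
  rw [eta2_eq_series him]; exact (tendsto_eta2Series hV hω him).1

theorem tendsto_eta2_of_im_pos (hV : IsShortRange (pertW T K l)) (him : 0 < ω.im) :
    Tendsto (fun s : ℝ => eta2 T K l ω s * Complex.exp (-(Complex.I * ω * s))) atTop (𝓝 1) := by
  have h1 := (tendsto_eta2Series hV (conj_ne_zero_of_im_pos him) (conj_im_nonpos him)).1
  have h2 := (Complex.continuous_conj.tendsto 1).comp h1
  rw [map_one] at h2
  refine h2.congr fun s => ?_
  rw [eta2_eq_conj him, Function.comp_apply, map_mul, ← Complex.exp_conj]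
  simp

theorem tendsto_eta2_zero (hV : IsShortRange (pertW T K l)) :
    Tendsto (fun s : ℝ => eta2 T K l 0 s * (s : ℂ) ^ l) atTop (𝓝 (eta2ZeroConst l)) := by
  have h := (tendsto_eta2Series_zero hV).1
  simp only [zpow_natCast] at h
  rwa [eta2_eq_series (by simp)]

theorem eta2ZeroConst_ne_zero (l : ℕ) : eta2ZeroConst l ≠ 0 := by
  have h1 : ((2 * l).factorial : ℂ) ≠ 0 := by exact_mod_cast Nat.factorial_ne_zero _
  have h2 : (l.factorial : ℂ) ≠ 0 := by exact_mod_cast Nat.factorial_ne_zero _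
  exact div_ne_zero (mul_ne_zero (pow_ne_zero _ (neg_ne_zero.2 Complex.I_ne_zero)) h1)
    (mul_ne_zero (pow_ne_zero _ two_ne_zero) h2)

theorem tendsto_exp_two_mul {τ : ℝ} (hτ : τ < 0) :
    Tendsto (fun s : ℝ => ((Real.exp (2 * τ * s) : ℝ) : ℂ)) atTop (𝓝 0) := by
  have h1 : Tendsto (fun s : ℝ => 2 * τ * s) atTop atBot :=
    tendsto_id.const_mul_atTop_of_neg (by linarith)
  have h2 := Real.tendsto_exp_atBot.comp h1
  have h3 := (Complex.continuous_ofReal.tendsto 0).comp h2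
  rw [Complex.ofReal_zero] at h3
  exact h3

/-- The quantity `conj(a) b` in terms of `a` and `b` with the factor `e^{-iωs}` taken
out. -/
theorem conj_mul_eq_exp (ω a b : ℂ) (s : ℝ) :
    starRingEnd ℂ a * b = starRingEnd ℂ (a * Complex.exp (Complex.I * ω * s))
      * (b * Complex.exp (Complex.I * ω * s)) * ((Real.exp (2 * ω.im * s) : ℝ) : ℂ) := by
  have h1 : starRingEnd ℂ (Complex.exp (Complex.I * ω * s)) * Complex.exp (Complex.I * ω * s)
      * ((Real.exp (2 * ω.im * s) : ℝ) : ℂ) = 1 := by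
    rw [mul_comm (starRingEnd ℂ _), Complex.mul_conj, Complex.normSq_eq_norm_sq, norm_exp_I_mul,
      ← Real.exp_nat_mul, ← Complex.ofReal_mul, ← Real.exp_add]
    have : ((2 : ℕ) : ℝ) * -(ω.im * s) + 2 * ω.im * s = 0 := by push_cast; ring
    rw [this, Real.exp_zero, Complex.ofReal_one]
  rw [map_mul]
  linear_combination (-(starRingEnd ℂ a * b)) * h1

theorem tendsto_conj_mul_eta2Series (hV : IsShortRange (pertW T K l)) (hω : ω ≠ 0)
    (him : ω.im < 0) : Tendsto (fun s : ℝ => starRingEnd ℂ (eta2Series T K l ω s)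
      * deriv (eta2Series T K l ω) s) atTop (𝓝 0) := by
  obtain ⟨h1, h2⟩ := tendsto_eta2Series hV hω him.le
  have h3 := ((((Complex.continuous_conj.tendsto 1).comp h1).mul h2).mul (tendsto_exp_two_mul him))
  rw [mul_zero] at h3
  exact h3.congr fun s => (conj_mul_eq_exp ω _ _ s).symm

/-- The data for the energy argument at infinity.  The multiplier `κ` makes the energy
`Re (κ conj(γ) γ')` of every solution `γ` nondecreasing; for `η²` it tends to a negative number
(an outgoing flux) if `ω` is real and nonzero, and to zero otherwise. -/
theorem exists_energy_multiplier (hV : IsShortRange (pertW T K l)) (ω : ℂ) :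
    ∃ κ L : ℂ, 0 ≤ κ.re ∧ (κ * ω ^ 2).re ≤ 0 ∧
      Tendsto (fun s : ℝ => starRingEnd ℂ (eta2 T K l ω s) * deriv (eta2 T K l ω) s) atTop (𝓝 L) ∧
      ((κ.re = 0 ∧ (κ * L).re < 0) ∨ (0 < κ.re ∧ L = 0)) := by
  rcases eq_or_ne ω 0 with rfl | hω
  · refine ⟨1, 0, by simp, by simp, ?_, Or.inr ⟨by simp, rfl⟩⟩
    rw [eta2_eq_series (by simp)]
    obtain ⟨h1, h2⟩ := tendsto_eta2Series_zero hV
    have h3 : Tendsto (fun s : ℝ => ((s⁻¹ : ℝ) : ℂ) ^ (2 * l + 1)) atTop (𝓝 0) := by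
      have h4 := ((Complex.continuous_ofReal.tendsto 0).comp tendsto_inv_atTop_zero).pow (2 * l + 1)
      simpa using h4
    have h4 := (((Complex.continuous_conj.tendsto _).comp h1).mul h2).mul h3
    rw [mul_zero] at h4
    refine h4.congr' ?_
    filter_upwards [eventually_gt_atTop 0] with s hs
    have hs0 : (s : ℂ) ≠ 0 := by exact_mod_cast hs.ne'
    have e : (s : ℂ) ^ (l + 1 : ℤ) = (s : ℂ) ^ (l + 1) := by
      exact_mod_cast zpow_natCast (s : ℂ) (l + 1)
    rw [Function.comp_apply, map_mul, zpow_natCast, map_pow, Complex.conj_ofReal, e]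
    have h5 : (s : ℂ) ^ (2 * l + 1) * ((s⁻¹ : ℝ) : ℂ) ^ (2 * l + 1) = 1 := by
      rw [← mul_pow, Complex.ofReal_inv, mul_inv_cancel₀ hs0, one_pow]
    linear_combination (starRingEnd ℂ (eta2Series T K l 0 s) * deriv (eta2Series T K l 0) s) * h5
  have hsq : ∀ z : ℂ, z * starRingEnd ℂ z = (‖z‖ ^ 2 : ℝ) := fun z => by
    rw [Complex.mul_conj, Complex.normSq_eq_norm_sq]
  have hn : 0 < ‖ω‖ ^ 2 := by positivity
  -- `κ = ∓ i conj(ω)` according to the sign of `Im ω`, so that `κ ω² = ∓ i |ω|² ω`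
  rcases lt_trichotomy ω.im 0 with him | him | him
  · refine ⟨-(Complex.I * starRingEnd ℂ ω), 0, ?_, ?_, ?_, Or.inr ⟨?_, rfl⟩⟩
    · simp; linarith
    · have : -(Complex.I * starRingEnd ℂ ω) * ω ^ 2 = -(Complex.I * (ω * starRingEnd ℂ ω) * ω) := by
        ring
      rw [this, hsq]
      simp [-Complex.ofReal_pow]
      nlinarith
    · rw [eta2_eq_series him.le]; exact tendsto_conj_mul_eta2Series hV hω him
    · simp; linarith
  · refine ⟨-(Complex.I * starRingEnd ℂ ω), -(Complex.I * ω), ?_, ?_, ?_, Or.inl ⟨?_, ?_⟩⟩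
    · simp [him]
    · have : -(Complex.I * starRingEnd ℂ ω) * ω ^ 2 = -(Complex.I * (ω * starRingEnd ℂ ω) * ω) := by
        ring
      rw [this, hsq]
      simp [-Complex.ofReal_pow, him]
    · rw [eta2_eq_series him.le]
      obtain ⟨h1, h2⟩ := tendsto_eta2Series hV hω him.le
      have h3 := ((Complex.continuous_conj.tendsto 1).comp h1).mul h2
      rw [map_one, one_mul] at h3
      refine h3.congr fun s => ?_
      rw [conj_mul_eq_exp ω _ (deriv _ _) s, him]
      simp
    · simp [him]
    · have : -(Complex.I * starRingEnd ℂ ω) * -(Complex.I * ω)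
          = (Complex.I * Complex.I) * (ω * starRingEnd ℂ ω) := by ring
      rw [this, hsq, Complex.I_mul_I]
      simp [-Complex.ofReal_pow]
      exact hn
  · refine ⟨Complex.I * starRingEnd ℂ ω, 0, ?_, ?_, ?_, Or.inr ⟨?_, rfl⟩⟩
    · simp; linarith
    · have : Complex.I * starRingEnd ℂ ω * ω ^ 2 = Complex.I * (ω * starRingEnd ℂ ω) * ω := by
        ring
      rw [this, hsq]
      simp [-Complex.ofReal_pow]
      nlinarith
    · have h1 := tendsto_conj_mul_eta2Series hV (conj_ne_zero_of_im_pos him)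
        (by rw [Complex.conj_im]; linarith : (starRingEnd ℂ ω).im < 0)
      have h2 := (Complex.continuous_conj.tendsto 0).comp h1
      rw [map_zero] at h2
      refine h2.congr' ?_
      filter_upwards [eventually_gt_atTop 0] with s hs
      rw [(eta2_hasDerivAt_conj hV him hs).deriv, eta2_eq_conj him, Function.comp_apply, map_mul]
    · simp; linarith

/-- For every `ω`, `η²` is eventually bounded and eventually nonzero. -/
theorem eta2_eventually (hV : IsShortRange (pertW T K l)) (ω : ℂ) :
    (∀ᶠ s in atTop, ‖eta2 T K l ω s‖ ≤ ‖eta2ZeroConst l‖ + 2) ∧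
      ∀ᶠ s in atTop, eta2 T K l ω s ≠ 0 := by
  -- in each case `η²` times a factor `e` of modulus at least one has a nonzero limit `c`
  have key : ∀ (c : ℂ) (e : ℝ → ℂ), c ≠ 0 → ‖c‖ ≤ ‖eta2ZeroConst l‖ + 1 →
      (∀ᶠ s in atTop, 1 ≤ ‖e s‖) → Tendsto (fun s => eta2 T K l ω s * e s) atTop (𝓝 c) →
      (∀ᶠ s in atTop, ‖eta2 T K l ω s‖ ≤ ‖eta2ZeroConst l‖ + 2) ∧
      ∀ᶠ s in atTop, eta2 T K l ω s ≠ 0 := by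
    intro c e hc hc1 he h
    constructor
    · filter_upwards [he, h.norm.eventually_lt_const (by linarith : ‖c‖ < ‖eta2ZeroConst l‖ + 2)]
        with s h1 h2
      rw [norm_mul] at h2
      nlinarith [norm_nonneg (eta2 T K l ω s)]
    · filter_upwards [h.eventually_ne hc] with s hs h0
      exact hs (by rw [h0, zero_mul])
  rcases eq_or_ne ω 0 with rfl | hω
  · refine key (eta2ZeroConst l) _ (eta2ZeroConst_ne_zero l) (by linarith) ?_ (tendsto_eta2_zero hV)
    filter_upwards [eventually_ge_atTop 1] with s hs
    rw [norm_pow, Complex.norm_real, Real.norm_of_nonneg (by linarith)]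
    exact one_le_pow₀ hs
  · have h1 : ‖(1 : ℂ)‖ ≤ ‖eta2ZeroConst l‖ + 1 := by
      rw [norm_one]; linarith [norm_nonneg (eta2ZeroConst l)]
    rcases le_or_gt ω.im 0 with him | him
    · refine key 1 _ one_ne_zero h1 ?_ (tendsto_eta2 hV him hω)
      filter_upwards [eventually_ge_atTop 0] with s hs
      rw [norm_exp_I_mul, Real.one_le_exp_iff]
      nlinarith
    · refine key 1 _ one_ne_zero h1 ?_ (tendsto_eta2_of_im_pos hV him)
      filter_upwards [eventually_ge_atTop 0] with s hs
      rw [Complex.exp_neg, norm_inv, norm_exp_I_mul, Real.exp_neg, inv_inv, Real.one_le_exp_iff]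
      nlinarith

end Eta2

/-! ### The coordinates `r`, `u` and `s` -/

/-- The inverse of an increasing differentiable bijection of `(0, ∞)` onto an open set. -/
theorem invFunOn_Ioi_spec {f f' : ℝ → ℝ} {I : Set ℝ} (hI : IsOpen I)
    (hf : ∀ r, 0 < r → HasDerivAt f (f' r) r) (hpos : ∀ r, 0 < r → 0 < f' r)
    (hmaps : MapsTo f (Ioi 0) I) (hsurj : SurjOn f (Ioi 0) I) :
    (∀ s ∈ I, 0 < Function.invFunOn f (Ioi 0) s ∧ f (Function.invFunOn f (Ioi 0) s) = s ∧
      HasDerivAt (Function.invFunOn f (Ioi 0)) (f' (Function.invFunOn f (Ioi 0) s))⁻¹ s) ∧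
    ∀ r, 0 < r → Function.invFunOn f (Ioi 0) (f r) = r := by
  have hmono : StrictMonoOn f (Ioi 0) := by
    refine strictMonoOn_of_deriv_pos (convex_Ioi 0)
      (fun r hr => (hf r hr).continuousAt.continuousWithinAt) fun r hr => ?_
    rw [interior_Ioi] at hr
    rw [(hf r hr).deriv]; exact hpos r hr
  set g := Function.invFunOn f (Ioi 0) with hg
  have hmem : ∀ s ∈ I, g s ∈ Ioi (0 : ℝ) := fun s hs => Function.invFunOn_mem (hsurj hs)
  have heq : ∀ s ∈ I, f (g s) = s := fun s hs => Function.invFunOn_eq (hsurj hs)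
  have hleft : ∀ r, 0 < r → g (f r) = r := fun r hr =>
    hmono.injOn (hmem _ (hmaps hr)) hr (heq _ (hmaps hr))
  have gmono : StrictMonoOn g I := fun s hs t ht hst => by
    rw [← hmono.lt_iff_lt (hmem s hs) (hmem t ht), heq s hs, heq t ht]; exact hst
  have himg : g '' I = Ioi 0 := by
    ext r
    exact ⟨fun ⟨s, hs, h⟩ => h ▸ hmem s hs, fun hr => ⟨f r, hmaps hr, hleft r hr⟩⟩
  refine ⟨fun s hs => ⟨hmem s hs, heq s hs, ?_⟩, hleft⟩
  have hc : ContinuousAt g s := gmono.continuousAt_of_image_mem_nhds (hI.mem_nhds hs)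
    (by rw [himg]; exact Ioi_mem_nhds (hmem s hs))
  refine HasDerivAt.of_local_left_inverse hc (hf _ (hmem s hs)) (hpos _ (hmem s hs)).ne' ?_
  filter_upwards [hI.mem_nhds hs] with y hy using heq y hy

/-- `∫_0^r K T dx`, which is the coordinate `s` as a function of `r` by `sCoord_eq`. -/
noncomputable def sOfR (T K : ℝ → ℝ) (r : ℝ) : ℝ := ∫ x in (0 : ℝ)..r, K x * T x

section Coordinates

variable {T K : ℝ → ℝ}

theorem IsParticleLike.continuousOn_mul (h : IsParticleLike T K) :
    ContinuousOn (fun x => K x * T x) (Ici 0) :=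
  h.smooth_K.continuousOn.mul h.smooth_T.continuousOn

theorem IsParticleLike.mul_pos (h : IsParticleLike T K) {x : ℝ} (hx : 0 ≤ x) : 0 < K x * T x :=
  _root_.mul_pos (h.K_pos x hx) (h.T_pos x hx)

theorem IsParticleLike.hasDerivAt_T (h : IsParticleLike T K) {r : ℝ} (hr : 0 < r) :
    HasDerivAt T (derivWithin T (Ici 0) r) r :=
  ((h.smooth_T.differentiableOn (by simp)) r hr.le).hasDerivWithinAt.hasDerivAt (Ici_mem_nhds hr)

theorem IsParticleLike.hasDerivAt_K (h : IsParticleLike T K) {r : ℝ} (hr : 0 < r) :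
    HasDerivAt K (derivWithin K (Ici 0) r) r :=
  ((h.smooth_K.differentiableOn (by simp)) r hr.le).hasDerivWithinAt.hasDerivAt (Ici_mem_nhds hr)

theorem inv_isBigO_one : (fun r : ℝ => 1 / r) =O[atTop] (fun _ => (1 : ℝ)) := by
  simp only [one_div]
  exact tendsto_inv_atTop_zero.isBigO_one ℝ

theorem IsParticleLike.mul_far (h : IsParticleLike T K) :
    (fun r => K r * T r - 1) =O[atTop] (fun r : ℝ => 1 / r) := by
  have h1 := h.K_far.mul (h.T_far.trans inv_isBigO_one)
  simp only [mul_one] at h1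
  refine ((h1.add h.K_far).add h.T_far).congr_left fun r => by ring

theorem tendsto_one_of_isBigO {f : ℝ → ℝ}
    (h : (fun r => f r - 1) =O[atTop] (fun r : ℝ => 1 / r)) :
    Tendsto f atTop (𝓝 1) := by
  have h0 : Tendsto (fun r : ℝ => 1 / r) atTop (𝓝 0) := by
    simpa only [one_div] using tendsto_inv_atTop_zero
  have h1 := (h.trans_tendsto h0).add_const 1
  simpa using h1

/-- A positive continuous function on `[0, ∞)` with limit `1` lies between positive constants. -/
theorem exists_two_sided_bound {f : ℝ → ℝ} (hf : ContinuousOn f (Ici 0))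
    (hpos : ∀ x, 0 ≤ x → 0 < f x) (hlim : Tendsto f atTop (𝓝 1)) :
    ∃ a b : ℝ, 0 < a ∧ 0 < b ∧ ∀ x, 0 ≤ x → a ≤ f x ∧ f x ≤ b := by
  have h1 : ∀ᶠ x in atTop, f x ∈ Ioo (1 / 2 : ℝ) 2 :=
    hlim (Ioo_mem_nhds (by norm_num) (by norm_num))
  obtain ⟨R, hR⟩ := eventually_atTop.1 h1
  have hne : (Icc 0 (max R 0)).Nonempty := ⟨0, le_rfl, le_max_right _ _⟩
  have hc : ContinuousOn f (Icc 0 (max R 0)) := hf.mono Icc_subset_Ici_self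
  obtain ⟨x, hx, hxm⟩ := isCompact_Icc.exists_isMinOn hne hc
  obtain ⟨y, hy, hym⟩ := isCompact_Icc.exists_isMaxOn hne hc
  refine ⟨min (f x) (1 / 2), max (f y) 2, lt_min (hpos x hx.1) (by norm_num),
    lt_max_of_lt_right two_pos, fun z hz => ?_⟩
  rcases le_total z (max R 0) with h | h
  · exact ⟨min_le_of_left_le (hxm ⟨hz, h⟩), le_max_of_le_left (hym ⟨hz, h⟩)⟩
  · have := hR z ((le_max_left _ _).trans h)
    exact ⟨min_le_of_right_le this.1.le, le_max_of_le_right this.2.le⟩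

theorem IsParticleLike.exists_bounds (h : IsParticleLike T K) :
    ∃ a b : ℝ, 0 < a ∧ 0 < b ∧ ∀ x, 0 ≤ x → a ≤ K x * T x ∧ K x * T x ≤ b :=
  exists_two_sided_bound h.continuousOn_mul (fun _ hx => h.mul_pos hx)
    (tendsto_one_of_isBigO h.mul_far)

theorem IsParticleLike.intervalIntegrable (h : IsParticleLike T K) {r : ℝ} (hr : 0 ≤ r) :
    IntervalIntegrable (fun x => K x * T x) volume 0 r :=
  (h.continuousOn_mul.mono (by rw [uIcc_of_le hr]; exact Icc_subset_Ici_self)).intervalIntegrable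

theorem IsParticleLike.hasDerivAt_sOfR (h : IsParticleLike T K) {r : ℝ} (hr : 0 < r) :
    HasDerivAt (sOfR T K) (K r * T r) r :=
  intervalIntegral.integral_hasDerivAt_right (h.intervalIntegrable hr.le)
    ((h.continuousOn_mul.mono Ioi_subset_Ici_self).stronglyMeasurableAtFilter isOpen_Ioi r hr)
    (h.continuousOn_mul.continuousAt (Ici_mem_nhds hr))

theorem sOfR_bounds (h : IsParticleLike T K) {a b : ℝ}
    (hab : ∀ x, 0 ≤ x → a ≤ K x * T x ∧ K x * T x ≤ b) {r : ℝ} (hr : 0 < r) :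
    a * r ≤ sOfR T K r ∧ sOfR T K r ≤ b * r := by
  constructor
  · have h1 := intervalIntegral.integral_mono_on hr.le
      (intervalIntegrable_const (c := a)) (h.intervalIntegrable hr.le) fun x hx => (hab x hx.1).1
    rw [intervalIntegral.integral_const, smul_eq_mul, sub_zero, mul_comm] at h1
    exact h1
  · have h1 := intervalIntegral.integral_mono_on hr.le (h.intervalIntegrable hr.le)
      (intervalIntegrable_const (c := b)) fun x hx => (hab x hx.1).2
    rw [intervalIntegral.integral_const, smul_eq_mul, sub_zero, mul_comm] at h1
    exact h1

theorem sOfR_surjOn (h : IsParticleLike T K) : SurjOn (sOfR T K) (Ioi 0) (Ioi 0) := by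
  obtain ⟨a, b, ha, hb, hab⟩ := h.exists_bounds
  intro s hs
  have hs : 0 < s := hs
  have hle : s / b ≤ s / a := by
    have := (hab 0 le_rfl).1.trans (hab 0 le_rfl).2
    gcongr
  have hpos : 0 < s / b := by positivity
  have hc : ContinuousOn (sOfR T K) (Icc (s / b) (s / a)) := fun r hr =>
    (h.hasDerivAt_sOfR (hpos.trans_le hr.1)).continuousAt.continuousWithinAt
  have h1 : sOfR T K (s / b) ≤ s :=
    (sOfR_bounds h hab hpos).2.trans_eq (by field_simp)
  have h2 : s ≤ sOfR T K (s / a) :=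
    Eq.trans_le (by field_simp) (sOfR_bounds h hab (hpos.trans_le hle)).1
  obtain ⟨r, hr, hrs⟩ := intermediate_value_Icc hle hc ⟨h1, h2⟩
  exact ⟨r, hpos.trans_le hr.1, hrs⟩

theorem sOfR_pos (h : IsParticleLike T K) {r : ℝ} (hr : 0 < r) : 0 < sOfR T K r := by
  obtain ⟨a, b, ha, hb, hab⟩ := h.exists_bounds
  exact (_root_.mul_pos ha hr).trans_le (sOfR_bounds h hab hr).1

theorem integral_Ioi_one_div_sq {r : ℝ} (hr : 0 < r) :
    IntegrableOn (fun x : ℝ => 1 / x ^ 2) (Ioi r) ∧ ∫ x in Ioi r, 1 / x ^ 2 = 1 / r := by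
  have e : ∀ x ∈ Ioi r, x ^ (-2 : ℝ) = 1 / x ^ 2 := by
    intro x hx
    have hx0 : 0 < x := hr.trans hx
    rw [Real.rpow_neg hx0.le, one_div]
    norm_num
  constructor
  · exact (integrableOn_Ioi_rpow_of_lt (by norm_num : (-2 : ℝ) < -1) hr).congr_fun e
      measurableSet_Ioi
  · rw [← setIntegral_congr_fun measurableSet_Ioi e,
      integral_Ioi_rpow_of_lt (by norm_num : (-2 : ℝ) < -1) hr]
    norm_num
    rw [Real.rpow_neg_one]

theorem IsParticleLike.integrableOn_uCoord (h : IsParticleLike T K) {r : ℝ} (hr : 0 < r) :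
    IntegrableOn (fun x => K x * T x / x ^ 2) (Ioi r) := by
  obtain ⟨a, b, ha, hb, hab⟩ := h.exists_bounds
  have hsub : Ioi r ⊆ Ici 0 := fun x hx => (hr.trans hx).le
  refine Integrable.mono' ((integral_Ioi_one_div_sq hr).1.const_mul b) ?_ ?_
  · refine ContinuousOn.aestronglyMeasurable ?_ measurableSet_Ioi
    exact (h.continuousOn_mul.mono hsub).div (continuousOn_id.pow 2)
      fun x hx => pow_ne_zero 2 (hr.trans hx).ne'
  · refine (ae_restrict_iff' measurableSet_Ioi).2 (ae_of_all _ fun x hx => ?_)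
    have hx0 := hsub hx
    have h1 := h.mul_pos hx0
    have h2 := (hab x hx0).2
    rw [Real.norm_of_nonneg (by positivity), mul_one_div]
    gcongr

theorem uCoord_bounds (h : IsParticleLike T K) {a b : ℝ}
    (hab : ∀ x, 0 ≤ x → a ≤ K x * T x ∧ K x * T x ≤ b) {r : ℝ} (hr : 0 < r) :
    a / r ≤ -uCoord T K r ∧ -uCoord T K r ≤ b / r := by
  obtain ⟨h1, h2⟩ := integral_Ioi_one_div_sq hr
  have h3 := h.integrableOn_uCoord hr
  rw [uCoord, neg_neg]
  constructor
  · have := setIntegral_mono_on (h1.const_mul a) h3 measurableSet_Ioi fun x hx => by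
      have := (hab x (hr.trans hx).le).1
      rw [mul_one_div]; gcongr
    rwa [integral_const_mul, h2, mul_one_div] at this
  · have := setIntegral_mono_on h3 (h1.const_mul b) measurableSet_Ioi fun x hx => by
      have := (hab x (hr.trans hx).le).2
      rw [mul_one_div]; gcongr
    rwa [integral_const_mul, h2, mul_one_div] at this

theorem IsParticleLike.hasDerivAt_uCoord (h : IsParticleLike T K) {r : ℝ} (hr : 0 < r) :
    HasDerivAt (uCoord T K) (K r * T r / r ^ 2) r := by
  have hc : ContinuousOn (fun x => K x * T x / x ^ 2) (Ioi 0) :=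
    (h.continuousOn_mul.mono Ioi_subset_Ici_self).div (continuousOn_id.pow 2)
      fun x hx => pow_ne_zero 2 (ne_of_gt hx)
  refine (hasDerivAt_integral_Ioi hc (fun s hs => h.integrableOn_uCoord hs) hr).neg.congr_deriv ?_
  rw [neg_neg]

theorem uCoord_neg (h : IsParticleLike T K) {r : ℝ} (hr : 0 < r) : uCoord T K r < 0 := by
  obtain ⟨a, b, ha, hb, hab⟩ := h.exists_bounds
  have h1 := (uCoord_bounds h hab hr).1
  have h2 : 0 < a / r := by positivity
  linarith

theorem uCoord_surjOn (h : IsParticleLike T K) : SurjOn (uCoord T K) (Ioi 0) (Iio 0) := by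
  obtain ⟨a, b, ha, hb, hab⟩ := h.exists_bounds
  intro u hu
  have hu : 0 < -u := neg_pos.2 hu
  have hle : a / (-u) ≤ b / (-u) := by
    have := (hab 0 le_rfl).1.trans (hab 0 le_rfl).2
    gcongr
  have hpos : 0 < a / (-u) := by positivity
  have hc : ContinuousOn (uCoord T K) (Icc (a / (-u)) (b / (-u))) := fun r hr =>
    (h.hasDerivAt_uCoord (hpos.trans_le hr.1)).continuousAt.continuousWithinAt
  have h1 : uCoord T K (a / (-u)) ≤ u := by
    have := (uCoord_bounds h hab hpos).1
    rw [div_div_cancel₀ ha.ne'] at this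
    linarith
  have h2 : u ≤ uCoord T K (b / (-u)) := by
    have := (uCoord_bounds h hab (hpos.trans_le hle)).2
    rw [div_div_cancel₀ hb.ne'] at this
    linarith
  obtain ⟨r, hr, hrs⟩ := intermediate_value_Icc hle hc ⟨h1, h2⟩
  exact ⟨r, hpos.trans_le hr.1, hrs⟩

theorem rOfU_spec (h : IsParticleLike T K) :
    (∀ u ∈ Iio (0 : ℝ), 0 < rOfU T K u ∧ uCoord T K (rOfU T K u) = u ∧
      HasDerivAt (rOfU T K) (K (rOfU T K u) * T (rOfU T K u) / rOfU T K u ^ 2)⁻¹ u) ∧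
    ∀ r, 0 < r → rOfU T K (uCoord T K r) = r :=
  invFunOn_Ioi_spec isOpen_Iio (fun _ hr => h.hasDerivAt_uCoord hr)
    (fun _ hr => div_pos (h.mul_pos hr.le) (pow_pos hr 2)) (fun _ hr => uCoord_neg h hr)
    (uCoord_surjOn h)

theorem rOfU_pos (h : IsParticleLike T K) {u : ℝ} (hu : u < 0) : 0 < rOfU T K u :=
  ((rOfU_spec h).1 u hu).1

theorem hasDerivAt_rOfU (h : IsParticleLike T K) {u : ℝ} (hu : u < 0) :
    HasDerivAt (rOfU T K) (rOfU T K u ^ 2 / (K (rOfU T K u) * T (rOfU T K u))) u := by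
  have := ((rOfU_spec h).1 u hu).2.2
  rwa [inv_div] at this

theorem rOfU_bounds (h : IsParticleLike T K) {a b : ℝ}
    (hab : ∀ x, 0 ≤ x → a ≤ K x * T x ∧ K x * T x ≤ b) {u : ℝ} (hu : u < 0) :
    a / (-u) ≤ rOfU T K u ∧ rOfU T K u ≤ b / (-u) := by
  have hu' : 0 < -u := neg_pos.2 hu
  obtain ⟨h1, h2, -⟩ := (rOfU_spec h).1 u hu
  obtain ⟨h3, h4⟩ := uCoord_bounds h hab h1
  rw [h2] at h3 h4
  exact ⟨(div_le_comm₀ hu' h1).2 h3, (le_div_comm₀ h1 hu').2 h4⟩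

theorem tendsto_rOfU_atBot (h : IsParticleLike T K) :
    Tendsto (rOfU T K) atBot (𝓝[>] 0) := by
  obtain ⟨a, b, ha, hb, hab⟩ := h.exists_bounds
  refine tendsto_nhdsWithin_iff.2 ⟨?_, ?_⟩
  · have h1 : Tendsto (fun u : ℝ => b / (-u)) atBot (𝓝 0) :=
      tendsto_neg_atBot_atTop.const_div_atTop b
    refine squeeze_zero' ?_ ?_ h1
    · filter_upwards [eventually_lt_atBot 0] with u hu using (rOfU_pos h hu).le
    · filter_upwards [eventually_lt_atBot 0] with u hu using (rOfU_bounds h hab hu).2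
  · filter_upwards [eventually_lt_atBot 0] with u hu using rOfU_pos h hu

theorem tendsto_rOfU_zero (h : IsParticleLike T K) :
    Tendsto (rOfU T K) (𝓝[<] 0) atTop := by
  obtain ⟨a, b, ha, hb, hab⟩ := h.exists_bounds
  have h1 : Tendsto (fun u : ℝ => -u) (𝓝[<] 0) (𝓝[>] 0) := by
    simpa using tendsto_neg_nhdsLT (a := (0 : ℝ))
  have h2 := (tendsto_inv_nhdsGT_zero.comp h1).const_mul_atTop ha
  refine tendsto_atTop_mono' _ ?_ h2
  filter_upwards [self_mem_nhdsWithin] with u hu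
  have := (rOfU_bounds h hab hu).1
  rwa [div_eq_mul_inv] at this

theorem hasDerivAt_sOfR_rOfU (h : IsParticleLike T K) {u : ℝ} (hu : u < 0) :
    HasDerivAt (fun u => sOfR T K (rOfU T K u)) (rOfU T K u ^ 2) u := by
  have hr := rOfU_pos h hu
  have h1 := h.mul_pos hr.le
  refine ((h.hasDerivAt_sOfR hr).comp u (hasDerivAt_rOfU h hu)).congr_deriv ?_
  rw [mul_div_cancel₀ _ h1.ne']

theorem tendsto_sOfR_zero (h : IsParticleLike T K) : Tendsto (sOfR T K) (𝓝[>] 0) (𝓝[>] 0) := by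
  obtain ⟨a, b, ha, hb, hab⟩ := h.exists_bounds
  refine tendsto_nhdsWithin_iff.2 ⟨?_, ?_⟩
  · have h1 : Tendsto (fun r : ℝ => b * r) (𝓝[>] 0) (𝓝 0) := by
      have : Tendsto (fun r : ℝ => b * r) (𝓝 0) (𝓝 (b * 0)) := tendsto_id.const_mul b
      rw [mul_zero] at this
      exact this.mono_left nhdsWithin_le_nhds
    refine squeeze_zero' ?_ ?_ h1
    · filter_upwards [self_mem_nhdsWithin] with r hr using (sOfR_pos h hr).le
    · filter_upwards [self_mem_nhdsWithin] with r hr using (sOfR_bounds h hab hr).2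
  · filter_upwards [self_mem_nhdsWithin] with r hr using sOfR_pos h hr

theorem tendsto_sOfR_atTop (h : IsParticleLike T K) : Tendsto (sOfR T K) atTop atTop := by
  obtain ⟨a, b, ha, hb, hab⟩ := h.exists_bounds
  refine tendsto_atTop_mono' _ ?_ (tendsto_id.const_mul_atTop ha)
  filter_upwards [eventually_gt_atTop 0] with r hr using (sOfR_bounds h hab hr).1

/-- The coordinate `s(u)` is `∫_0^{r(u)} K T dx`, by the substitution `x = r(u)`. -/
theorem sCoord_eq (h : IsParticleLike T K) {u : ℝ} (hu : u < 0) :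
    sCoord T K u = sOfR T K (rOfU T K u) := by
  have hlim : Tendsto (fun u => sOfR T K (rOfU T K u)) atBot (𝓝 0) :=
    (tendsto_nhdsWithin_iff.1 ((tendsto_sOfR_zero h).comp (tendsto_rOfU_atBot h))).1
  have hd : ∀ x ∈ Iic u, HasDerivAt (fun u => sOfR T K (rOfU T K u)) (rOfU T K x ^ 2) x :=
    fun x hx => hasDerivAt_sOfR_rOfU h (lt_of_le_of_lt hx hu)
  have hc : ContinuousOn (fun x => rOfU T K x ^ 2) (Iic u) := fun x hx =>
    ((hasDerivAt_rOfU h (lt_of_le_of_lt hx hu)).continuousAt.pow 2).continuousWithinAt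
  have hint : IntegrableOn (fun x => rOfU T K x ^ 2) (Iic u) := by
    refine integrableOn_Iic_of_intervalIntegral_norm_bounded (a := fun i : ℝ => i) (l := atBot)
      (sOfR T K (rOfU T K u)) u (fun i => ?_) tendsto_id ?_
    · exact ((hc.mono Icc_subset_Iic_self).integrableOn_Icc).mono_set Ioc_subset_Icc_self
    · filter_upwards [eventually_le_atBot u] with i hi
      have e : ∀ x, ‖rOfU T K x ^ 2‖ = rOfU T K x ^ 2 := fun x =>
        Real.norm_of_nonneg (sq_nonneg _)
      simp only [e]
      have hsub : uIcc i u ⊆ Iic u := by rw [uIcc_of_le hi]; exact Icc_subset_Iic_self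
      rw [intervalIntegral.integral_eq_sub_of_hasDerivAt (fun x hx => hd x (hsub hx))
        ((hc.mono hsub).intervalIntegrable)]
      have := sOfR_pos h (rOfU_pos h (lt_of_le_of_lt hi hu))
      linarith
  rw [sCoord, integral_Iic_of_hasDerivAt_of_tendsto' hd hint hlim, sub_zero]

theorem sCoord_uCoord (h : IsParticleLike T K) {r : ℝ} (hr : 0 < r) :
    sCoord T K (uCoord T K r) = sOfR T K r := by
  rw [sCoord_eq h (uCoord_neg h hr), (rOfU_spec h).2 r hr]

theorem sCoord_pos (h : IsParticleLike T K) {u : ℝ} (hu : u < 0) : 0 < sCoord T K u := by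
  rw [sCoord_eq h hu]; exact sOfR_pos h (rOfU_pos h hu)

theorem hasDerivAt_sCoord (h : IsParticleLike T K) {u : ℝ} (hu : u < 0) :
    HasDerivAt (sCoord T K) (rOfU T K u ^ 2) u := by
  refine (hasDerivAt_sOfR_rOfU h hu).congr_of_eventuallyEq ?_
  filter_upwards [gt_mem_nhds hu] with x hx using sCoord_eq h hx

theorem rOfS_spec (h : IsParticleLike T K) :
    (∀ s ∈ Ioi (0 : ℝ), 0 < rOfS T K s ∧ sCoord T K (uCoord T K (rOfS T K s)) = s ∧
      HasDerivAt (rOfS T K) (K (rOfS T K s) * T (rOfS T K s))⁻¹ s) ∧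
    ∀ r, 0 < r → rOfS T K (sCoord T K (uCoord T K r)) = r := by
  refine invFunOn_Ioi_spec (f := fun r => sCoord T K (uCoord T K r))
    (f' := fun r => K r * T r) isOpen_Ioi (fun r hr => ?_) (fun r hr => h.mul_pos hr.le)
    (fun r hr => sCoord_pos h (uCoord_neg h hr)) ?_
  · refine (h.hasDerivAt_sOfR hr).congr_of_eventuallyEq ?_
    filter_upwards [lt_mem_nhds hr] with x hx using sCoord_uCoord h hx
  · intro s hs
    obtain ⟨r, hr, hrs⟩ := sOfR_surjOn h hs
    exact ⟨r, hr, by rw [← hrs]; exact sCoord_uCoord h hr⟩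

theorem rOfS_pos (h : IsParticleLike T K) {s : ℝ} (hs : 0 < s) : 0 < rOfS T K s :=
  ((rOfS_spec h).1 s hs).1

theorem sOfR_rOfS (h : IsParticleLike T K) {s : ℝ} (hs : 0 < s) : sOfR T K (rOfS T K s) = s := by
  rw [← sCoord_uCoord h (rOfS_pos h hs)]
  exact ((rOfS_spec h).1 s hs).2.1

theorem rOfS_sCoord (h : IsParticleLike T K) {u : ℝ} (hu : u < 0) :
    rOfS T K (sCoord T K u) = rOfU T K u := by
  have h1 := (rOfS_spec h).2 _ (rOfU_pos h hu)
  rwa [((rOfU_spec h).1 u hu).2.1] at h1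

end Coordinates

/-! ### The perturbation is short range -/

section ShortRange

variable {T K : ℝ → ℝ}

/-- The logarithmic derivative of `K T`, with one-sided derivatives at `0`. -/
noncomputable def logDeriv (T K : ℝ → ℝ) (r : ℝ) : ℝ :=
  derivWithin T (Ici 0) r / T r + derivWithin K (Ici 0) r / K r

theorem continuousOn_logDeriv (h : IsParticleLike T K) : ContinuousOn (logDeriv T K) (Ici 0) := by
  have h1 := h.smooth_T.continuousOn_derivWithin (uniqueDiffOn_Ici 0) (by simp)
  have h2 := h.smooth_K.continuousOn_derivWithin (uniqueDiffOn_Ici 0) (by simp)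
  exact (h1.div h.smooth_T.continuousOn fun x hx => (h.T_pos x hx).ne').add
    (h2.div h.smooth_K.continuousOn fun x hx => (h.K_pos x hx).ne')

/-- The definition of `pertW` with the logarithmic derivative named. -/
theorem pertW_eq (l : ℕ) (s : ℝ) :
    pertW T K l s = (l : ℝ) * (l + 1) * (1 / (rOfS T K s ^ 2 * T (rOfS T K s) ^ 2) - 1 / s ^ 2)
      - 1 / (rOfS T K s * T (rOfS T K s) ^ 2 * K (rOfS T K s) ^ 2) * logDeriv T K (rOfS T K s) :=
  rfl

theorem continuousOn_pertW (h : IsParticleLike T K) (l : ℕ) :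
    ContinuousOn (pertW T K l) (Ioi 0) := by
  have hr : ContinuousOn (rOfS T K) (Ioi 0) := fun s hs =>
    ((rOfS_spec h).1 s hs).2.2.continuousAt.continuousWithinAt
  have hm : MapsTo (rOfS T K) (Ioi 0) (Ici 0) := fun s hs => (rOfS_pos h hs).le
  have hT := h.smooth_T.continuousOn.comp hr hm
  have hK := h.smooth_K.continuousOn.comp hr hm
  have hL := (continuousOn_logDeriv h).comp hr hm
  have hr0 : ∀ s ∈ Ioi (0 : ℝ), rOfS T K s ≠ 0 := fun s hs => (rOfS_pos h hs).ne'
  have hT0 : ∀ s ∈ Ioi (0 : ℝ), T (rOfS T K s) ≠ 0 := fun s hs => (h.T_pos _ (hm hs)).ne'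
  have hK0 : ∀ s ∈ Ioi (0 : ℝ), K (rOfS T K s) ≠ 0 := fun s hs => (h.K_pos _ (hm hs)).ne'
  refine ContinuousOn.congr ?_ fun s hs => pertW_eq l s
  refine (continuousOn_const.mul ((continuousOn_const.div ((hr.pow 2).mul (hT.pow 2)) ?_).sub
    (continuousOn_const.div (continuousOn_id.pow 2) ?_))).sub
    ((continuousOn_const.div ((hr.mul (hT.pow 2)).mul (hK.pow 2)) ?_).mul hL)
  · exact fun s hs => mul_ne_zero (pow_ne_zero 2 (hr0 s hs)) (pow_ne_zero 2 (hT0 s hs))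
  · exact fun s hs => pow_ne_zero 2 (ne_of_gt hs)
  · exact fun s hs => mul_ne_zero (mul_ne_zero (hr0 s hs) (pow_ne_zero 2 (hT0 s hs)))
      (pow_ne_zero 2 (hK0 s hs))

/-- A smooth function on `[0, ∞)` is Lipschitz at `0` on every bounded interval. -/
theorem exists_lipschitz_at_zero {f : ℝ → ℝ}
    (hf : ContDiffOn ℝ ((⊤ : ℕ∞) : WithTop ℕ∞) f (Ici 0)) {R : ℝ} (hR : 0 < R) :
    ∃ L : ℝ, 0 ≤ L ∧ ∀ x ∈ Icc 0 R, |f x - f 0| ≤ L * x := by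
  have h1 : ContDiffOn ℝ ((⊤ : ℕ∞) : WithTop ℕ∞) f (Icc 0 R) := hf.mono Icc_subset_Ici_self
  obtain ⟨L, hL⟩ := isCompact_Icc.exists_bound_of_continuousOn
    (h1.continuousOn_derivWithin (uniqueDiffOn_Icc hR) (by simp))
  refine ⟨L, (norm_nonneg _).trans (hL 0 ⟨le_rfl, hR.le⟩), fun x hx => ?_⟩
  have h2 := (convex_Icc 0 R).norm_image_sub_le_of_norm_derivWithin_le
    (h1.differentiableOn (by simp)) hL (⟨le_rfl, hR.le⟩ : (0 : ℝ) ∈ Icc 0 R) hx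
  rwa [sub_zero, Real.norm_eq_abs, Real.norm_of_nonneg hx.1] at h2

/-- Since `K 0 = 1`, the functions `s` and `r T` of `r` agree to first order at the centre. -/
theorem exists_sOfR_sub_le (h : IsParticleLike T K) {R : ℝ} (hR : 0 < R) :
    ∃ C : ℝ, 0 ≤ C ∧ ∀ r ∈ Ioc 0 R, |sOfR T K r - r * T r| ≤ C * r ^ 2 := by
  obtain ⟨L, hL0, hL⟩ := exists_lipschitz_at_zero h.smooth_T hR
  obtain ⟨L', hL0', hL'⟩ := exists_lipschitz_at_zero (h.smooth_K.mul h.smooth_T) hR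
  refine ⟨L + L', by positivity, fun r hr => ?_⟩
  have e : sOfR T K r - r * T r = ∫ x in (0 : ℝ)..r, (K x * T x - T r) := by
    rw [intervalIntegral.integral_sub (h.intervalIntegrable hr.1.le) intervalIntegrable_const,
      intervalIntegral.integral_const, smul_eq_mul, sub_zero]
    rfl
  rw [e]
  have h1 := intervalIntegral.norm_integral_le_of_norm_le_const (a := 0) (b := r)
    (f := fun x => K x * T x - T r) (C := (L + L') * r) fun x hx => by
      rw [uIoc_of_le hr.1.le] at hx
      have h2 := hL' x ⟨hx.1.le, hx.2.trans hr.2⟩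
      have h3 := hL r ⟨hr.1.le, hr.2⟩
      rw [h.K_zero, one_mul] at h2
      have e2 : K x * T x - T r = (K x * T x - T 0) - (T r - T 0) := by ring
      rw [Real.norm_eq_abs, e2]
      refine (abs_sub _ _).trans ?_
      have h4 : L' * x ≤ L' * r := mul_le_mul_of_nonneg_left hx.2 hL0'
      linarith
  rw [sub_zero, abs_of_pos hr.1, Real.norm_eq_abs] at h1
  exact h1.trans_eq (by ring)

/-- The perturbation is `O(1 / s)` at the centre, since `1 / (r T)² - 1 / s²` is
`(s - r T) (s + r T) / (r T s)²`. -/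
theorem pertW_near (h : IsParticleLike T K) (l : ℕ) (R : ℝ) :
    ∃ M : ℝ, 0 < M ∧ ∀ s, 0 < s → s ≤ R → |pertW T K l s| * s ≤ M := by
  rcases le_or_gt R 0 with hR | hR
  · exact ⟨1, one_pos, fun s hs hsR => absurd (hs.trans_le hsR) (not_lt.2 hR)⟩
  obtain ⟨a, b, ha, hb, hab⟩ := h.exists_bounds
  have hR1 : 0 < R / a := by positivity
  obtain ⟨C, hC0, hC⟩ := exists_sOfR_sub_le h hR1
  have hsub : Icc 0 (R / a) ⊆ Ici 0 := Icc_subset_Ici_self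
  have cT := h.smooth_T.continuousOn.mono hsub
  have cK := h.smooth_K.continuousOn.mono hsub
  have hT0 : ∀ x ∈ Icc 0 (R / a), T x ≠ 0 := fun x hx => (h.T_pos x hx.1).ne'
  have hK0 : ∀ x ∈ Icc 0 (R / a), K x ≠ 0 := fun x hx => (h.K_pos x hx.1).ne'
  obtain ⟨M1, hM1⟩ := isCompact_Icc.exists_bound_of_continuousOn
    ((continuousOn_const (c := (1 : ℝ))).div (cT.pow 2) fun x hx => pow_ne_zero 2 (hT0 x hx))
  obtain ⟨M2, hM2⟩ := isCompact_Icc.exists_bound_of_continuousOn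
    (((continuousOn_logDeriv h).mono hsub).div ((cT.pow 2).mul (cK.pow 2)) fun x hx =>
      mul_ne_zero (pow_ne_zero 2 (hT0 x hx)) (pow_ne_zero 2 (hK0 x hx)))
  obtain ⟨M3, hM3⟩ := isCompact_Icc.exists_bound_of_continuousOn cT
  have hmem : (0 : ℝ) ∈ Icc 0 (R / a) := ⟨le_rfl, hR1.le⟩
  have p1 := (norm_nonneg _).trans (hM1 0 hmem)
  have p2 := (norm_nonneg _).trans (hM2 0 hmem)
  have p3 := (norm_nonneg _).trans (hM3 0 hmem)
  refine ⟨(l : ℝ) * (l + 1) * (C * (1 + M3 / a) * M1) + b * M2 + 1, by positivity,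
    fun s hs hsR => ?_⟩
  set r := rOfS T K s with hr
  have hr0 : 0 < r := rOfS_pos h hs
  have hsr : sOfR T K r = s := sOfR_rOfS h hs
  obtain ⟨hl, hu⟩ := sOfR_bounds h hab hr0
  rw [hsr] at hl hu
  have hrR : r ≤ R / a := by rw [le_div_iff₀ ha]; linarith
  have hrI : r ∈ Icc 0 (R / a) := ⟨hr0.le, hrR⟩
  have hTr := h.T_pos r hr0.le
  have b0 := hC r ⟨hr0, hrR⟩
  rw [hsr] at b0
  have b1 : 1 / T r ^ 2 ≤ M1 := (le_abs_self _).trans (hM1 r hrI)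
  have b2 : |logDeriv T K r / (T r ^ 2 * K r ^ 2)| ≤ M2 := hM2 r hrI
  have b3 : T r ≤ M3 := (le_abs_self _).trans (hM3 r hrI)
  have q1 : |s - r * T r| / r ^ 2 ≤ C := by rw [div_le_iff₀ (by positivity)]; exact b0
  have q2 : (s + r * T r) / s ≤ 1 + M3 / a := by
    rw [add_div, div_self hs.ne']
    gcongr 1 + ?_
    rw [div_le_div_iff₀ hs ha]
    calc r * T r * a = a * r * T r := by ring
      _ ≤ s * M3 := by gcongr
      _ = M3 * s := by ring
  have q3 : s / r ≤ b := by rw [div_le_iff₀ hr0]; exact hu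
  have e : pertW T K l s * s = (l : ℝ) * (l + 1) * ((s - r * T r) / r ^ 2 * ((s + r * T r) / s)
      * (1 / T r ^ 2)) - s / r * (logDeriv T K r / (T r ^ 2 * K r ^ 2)) := by
    rw [pertW_eq, ← hr]
    field_simp
    ring
  have e2 : |(s - r * T r) / r ^ 2 * ((s + r * T r) / s) * (1 / T r ^ 2)|
      = |s - r * T r| / r ^ 2 * ((s + r * T r) / s) * (1 / T r ^ 2) := by
    rw [abs_mul, abs_mul, abs_div, abs_of_pos (by positivity : 0 < r ^ 2),
      abs_of_pos (by positivity : 0 < (s + r * T r) / s),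
      abs_of_pos (by positivity : 0 < 1 / T r ^ 2)]
  calc |pertW T K l s| * s = |pertW T K l s * s| := by rw [abs_mul, abs_of_pos hs]
    _ ≤ (l : ℝ) * (l + 1) * (|s - r * T r| / r ^ 2 * ((s + r * T r) / s) * (1 / T r ^ 2))
        + s / r * |logDeriv T K r / (T r ^ 2 * K r ^ 2)| := by
      rw [e]
      refine (abs_sub _ _).trans_eq ?_
      rw [abs_mul, abs_mul (s / r), e2, abs_of_pos (by positivity : 0 < s / r),
        abs_of_nonneg (by positivity : 0 ≤ (l : ℝ) * (l + 1))]
    _ ≤ (l : ℝ) * (l + 1) * (C * (1 + M3 / a) * M1) + b * M2 := by gcongr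
    _ ≤ _ := by linarith

/-- The functions `s` and `r` differ by `O(√r)`: a bound on `K T - 1` by `x^{-1/2}`, weaker than the
`O(1 / x)` assumed at infinity, holds down to the centre and is integrable there. -/
theorem exists_sOfR_sub_le_sqrt (h : IsParticleLike T K) :
    ∃ C : ℝ, 0 ≤ C ∧ ∀ r, 0 < r → |sOfR T K r - r| ≤ C * Real.sqrt r := by
  -- `|K T - 1|` is at most a multiple of `x^{-1/2}` on all of `(0, ∞)`
  obtain ⟨C, hC0, hC⟩ : ∃ C : ℝ, 0 ≤ C ∧ ∀ x, 0 < x → |K x * T x - 1| ≤ C * x ^ (-1 / 2 : ℝ) := by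
    obtain ⟨c, hc, hc'⟩ := h.mul_far.exists_pos
    obtain ⟨R, hR⟩ := eventually_atTop.1 hc'.bound
    set R' := max R 1 with hR'
    obtain ⟨M, hM⟩ := (isCompact_Icc (a := (0 : ℝ)) (b := R')).exists_bound_of_continuousOn
      ((h.continuousOn_mul.mono Icc_subset_Ici_self).sub continuousOn_const (g := fun _ => (1 : ℝ)))
    have hR1 : 1 ≤ R' := le_max_right _ _
    have hR0 : 0 < R' := one_pos.trans_le hR1
    have hM0 := (norm_nonneg _).trans (hM 0 ⟨le_rfl, hR0.le⟩)
    refine ⟨max c (M * R' ^ (1 / 2 : ℝ)), by positivity, fun x hx => ?_⟩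
    rcases le_total x R' with hxR | hxR
    · have h1 : 1 ≤ R' ^ (1 / 2 : ℝ) * x ^ (-1 / 2 : ℝ) := by
        have e : R' ^ (1 / 2 : ℝ) * x ^ (-1 / 2 : ℝ) = (R' / x) ^ (1 / 2 : ℝ) := by
          rw [Real.div_rpow hR0.le hx.le, show (-1 / 2 : ℝ) = -(1 / 2) by norm_num,
            Real.rpow_neg hx.le, div_eq_mul_inv (R' ^ _)]
        rw [e]
        exact Real.one_le_rpow ((one_le_div hx).2 hxR) (by norm_num)
      calc |K x * T x - 1| ≤ M := hM x ⟨hx.le, hxR⟩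
        _ = M * 1 := (mul_one M).symm
        _ ≤ M * (R' ^ (1 / 2 : ℝ) * x ^ (-1 / 2 : ℝ)) := by gcongr
        _ = M * R' ^ (1 / 2 : ℝ) * x ^ (-1 / 2 : ℝ) := by ring
        _ ≤ _ := by gcongr; exact le_max_right _ _
    · have h1 := hR x ((le_max_left _ _).trans hxR)
      rw [Real.norm_eq_abs, Real.norm_of_nonneg (by positivity)] at h1
      have h2 : 1 / x ≤ x ^ (-1 / 2 : ℝ) := by
        rw [one_div, ← Real.rpow_neg_one]
        exact Real.rpow_le_rpow_of_exponent_le (hR1.trans hxR) (by norm_num)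
      calc |K x * T x - 1| ≤ c * (1 / x) := h1
        _ ≤ c * x ^ (-1 / 2 : ℝ) := by gcongr
        _ ≤ _ := by gcongr; exact le_max_left _ _
  refine ⟨2 * C, by positivity, fun r hr => ?_⟩
  have e : sOfR T K r - r = ∫ x in (0 : ℝ)..r, (K x * T x - 1) := by
    rw [intervalIntegral.integral_sub (h.intervalIntegrable hr.le) intervalIntegrable_const,
      intervalIntegral.integral_const, smul_eq_mul, sub_zero, mul_one]
    rfl
  have h1 := intervalIntegral.norm_integral_le_of_norm_le (μ := volume) hr.le
    (f := fun x => K x * T x - 1) (g := fun x => C * x ^ (-1 / 2 : ℝ))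
    (ae_of_all _ fun x hx => hC x hx.1)
    ((intervalIntegral.intervalIntegrable_rpow' (by norm_num)).const_mul C)
  rw [e, ← Real.norm_eq_abs]
  refine h1.trans_eq ?_
  rw [intervalIntegral.integral_const_mul, integral_rpow (Or.inl (by norm_num)),
    Real.sqrt_eq_rpow]
  norm_num
  ring

theorem tendsto_rOfS_atTop (h : IsParticleLike T K) : Tendsto (rOfS T K) atTop atTop := by
  obtain ⟨a, b, ha, hb, hab⟩ := h.exists_bounds
  refine tendsto_atTop_mono' _ ?_ (tendsto_id.atTop_div_const hb)
  filter_upwards [eventually_gt_atTop 0] with s hs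
  have := (sOfR_bounds h hab (rOfS_pos h hs)).2
  rw [sOfR_rOfS h hs] at this
  rw [id, div_le_iff₀ hb]; linarith

/-- The perturbation is `O(s^{-5/2})`: both `s - r` and `r (T - 1)` are `O(√r)`. -/
theorem pertW_eventually (h : IsParticleLike T K) (l : ℕ) :
    ∃ M : ℝ, ∀ᶠ s in atTop, |pertW T K l s| * (s ^ 2 * Real.sqrt s) ≤ M := by
  obtain ⟨a, b, ha, hb, hab⟩ := h.exists_bounds
  obtain ⟨C, hC0, hC⟩ := exists_sOfR_sub_le_sqrt h
  obtain ⟨c, hc, hc'⟩ := h.T_far.exists_pos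
  obtain ⟨d, hd, hd'⟩ := h.TK_far.exists_pos
  have hT : ∀ᶠ r in atTop, T r ∈ Ioo (1 / 2 : ℝ) 2 :=
    tendsto_one_of_isBigO h.T_far (Ioo_mem_nhds (by norm_num) (by norm_num))
  have hK : ∀ᶠ r in atTop, K r ∈ Ioo (1 / 2 : ℝ) 2 :=
    tendsto_one_of_isBigO h.K_far (Ioo_mem_nhds (by norm_num) (by norm_num))
  refine ⟨b ^ 2 * Real.sqrt b
    * ((l : ℝ) * (l + 1) * ((C + c) * (b + 2) * (4 / a ^ 2)) + 16 * d), ?_⟩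
  filter_upwards [eventually_gt_atTop 0, (tendsto_rOfS_atTop h).eventually
    (hT.and (hK.and (hc'.bound.and (hd'.bound.and (eventually_ge_atTop 1)))))]
    with s hs ⟨hTr, hKr, hcr, hdr, hr1⟩
  set r := rOfS T K s with hr
  have hr0 : 0 < r := rOfS_pos h hs
  have hsr : sOfR T K r = s := sOfR_rOfS h hs
  obtain ⟨hl, hu⟩ := sOfR_bounds h hab hr0
  have b0 := hC r hr0
  rw [hsr] at hl hu b0
  have hT0 := h.T_pos r hr0.le
  have hK0 := h.K_pos r hr0.le
  have hq0 : 0 < Real.sqrt r := Real.sqrt_pos.2 hr0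
  have hqq : Real.sqrt r * Real.sqrt r = r := Real.mul_self_sqrt hr0.le
  have hq1 : 1 ≤ Real.sqrt r := Real.one_le_sqrt.2 hr1
  rw [Real.norm_eq_abs, Real.norm_of_nonneg (by positivity)] at hcr hdr
  change |logDeriv T K r| ≤ _ at hdr
  have k1 : |s - r * T r| ≤ (C + c) * Real.sqrt r := by
    have e : s - r * T r = (s - r) - r * (T r - 1) := by ring
    rw [e]
    refine (abs_sub _ _).trans ?_
    rw [abs_mul, abs_of_pos hr0]
    have h1 : r * |T r - 1| ≤ c := by
      calc r * |T r - 1| ≤ r * (c * (1 / r)) := by gcongr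
        _ = c := by field_simp
    have h2 : c ≤ c * Real.sqrt r := le_mul_of_one_le_right hc.le hq1
    linarith
  have k2 : s + r * T r ≤ (b + 2) * r := by nlinarith [hTr.2]
  have k3 : 1 / (T r ^ 2 * s ^ 2) ≤ 4 / a ^ 2 / r ^ 2 := by
    rw [div_div, div_le_div_iff₀ (by positivity) (by positivity)]
    have h1 : (a * r) ^ 2 ≤ s ^ 2 := by gcongr
    have h2 : (1 / 2 : ℝ) ^ 2 ≤ T r ^ 2 := by have := hTr.1.le; gcongr
    calc 1 * (a ^ 2 * r ^ 2) = 4 * ((1 / 2 : ℝ) ^ 2 * (a * r) ^ 2) := by ring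
      _ ≤ 4 * (T r ^ 2 * s ^ 2) := by gcongr
  have k4 : 1 / (T r ^ 2 * K r ^ 2) ≤ 16 := by
    rw [div_le_iff₀ (by positivity)]
    have h2 : (1 / 2 : ℝ) ^ 2 ≤ T r ^ 2 := by have := hTr.1.le; gcongr
    have h3 : (1 / 2 : ℝ) ^ 2 ≤ K r ^ 2 := by have := hKr.1.le; gcongr
    calc (1 : ℝ) = 16 * ((1 / 2 : ℝ) ^ 2 * (1 / 2 : ℝ) ^ 2) := by norm_num
      _ ≤ 16 * (T r ^ 2 * K r ^ 2) := by gcongr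
  have e : pertW T K l s = (l : ℝ) * (l + 1) * ((s - r * T r) * (s + r * T r)
      * (1 / (T r ^ 2 * s ^ 2)) / r ^ 2) - logDeriv T K r * (1 / (T r ^ 2 * K r ^ 2)) / r := by
    rw [pertW_eq, ← hr]
    field_simp
    ring
  have k5 : |pertW T K l s| ≤ (l : ℝ) * (l + 1) * ((C + c) * Real.sqrt r * ((b + 2) * r)
      * (4 / a ^ 2 / r ^ 2) / r ^ 2) + d * (1 / r ^ 2) * 16 / r := by
    rw [e]
    refine (abs_sub _ _).trans ?_
    rw [abs_mul, abs_of_nonneg (by positivity : 0 ≤ (l : ℝ) * (l + 1)), abs_div, abs_mul, abs_mul,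
      abs_of_pos (by positivity : 0 < r ^ 2), abs_of_pos (by positivity : 0 < s + r * T r),
      abs_of_pos (by positivity : 0 < 1 / (T r ^ 2 * s ^ 2)), abs_div, abs_of_pos hr0, abs_mul,
      abs_of_pos (by positivity : 0 < 1 / (T r ^ 2 * K r ^ 2))]
    gcongr
  have k6 : s ^ 2 * Real.sqrt s ≤ b ^ 2 * Real.sqrt b * (r ^ 2 * Real.sqrt r) := by
    calc s ^ 2 * Real.sqrt s ≤ (b * r) ^ 2 * Real.sqrt (b * r) := by gcongr
      _ = _ := by rw [Real.sqrt_mul hb.le]; ring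
  have k7 : ((l : ℝ) * (l + 1) * ((C + c) * Real.sqrt r * ((b + 2) * r)
      * (4 / a ^ 2 / r ^ 2) / r ^ 2) + d * (1 / r ^ 2) * 16 / r) * (r ^ 2 * Real.sqrt r)
      ≤ (l : ℝ) * (l + 1) * ((C + c) * (b + 2) * (4 / a ^ 2)) + 16 * d := by
    have e1 : ((l : ℝ) * (l + 1) * ((C + c) * Real.sqrt r * ((b + 2) * r)
      * (4 / a ^ 2 / r ^ 2) / r ^ 2) + d * (1 / r ^ 2) * 16 / r) * (r ^ 2 * Real.sqrt r)
      = (l : ℝ) * (l + 1) * ((C + c) * (b + 2) * (4 / a ^ 2)) * ((Real.sqrt r * Real.sqrt r) / r)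
        + 16 * d * (Real.sqrt r / r) := by
      field_simp
    rw [e1, hqq, div_self hr0.ne', mul_one]
    have h1 : Real.sqrt r / r ≤ 1 := by
      rw [div_le_one hr0]
      exact (le_mul_of_one_le_right hq0.le hq1).trans_eq hqq
    have h2 : 16 * d * (Real.sqrt r / r) ≤ 16 * d := mul_le_of_le_one_right (by positivity) h1
    linarith
  calc |pertW T K l s| * (s ^ 2 * Real.sqrt s)
      ≤ |pertW T K l s| * (b ^ 2 * Real.sqrt b * (r ^ 2 * Real.sqrt r)) := by gcongr
    _ = b ^ 2 * Real.sqrt b * (|pertW T K l s| * (r ^ 2 * Real.sqrt r)) := by ring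
    _ ≤ b ^ 2 * Real.sqrt b * (((l : ℝ) * (l + 1) * ((C + c) * Real.sqrt r * ((b + 2) * r)
      * (4 / a ^ 2 / r ^ 2) / r ^ 2) + d * (1 / r ^ 2) * 16 / r) * (r ^ 2 * Real.sqrt r)) := by
      gcongr
    _ ≤ _ := by gcongr

theorem pertW_far (h : IsParticleLike T K) (l : ℕ) {s₀ : ℝ} (hs₀ : 0 < s₀) :
    ∃ M : ℝ, 0 < M ∧ ∀ s, s₀ ≤ s → |pertW T K l s| * s ≤ M * s ^ (-3 / 2 : ℝ) := by
  obtain ⟨M, hM⟩ := pertW_eventually h l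
  obtain ⟨R, hR⟩ := eventually_atTop.1 hM
  have hc : ContinuousOn (fun s => pertW T K l s * (s ^ 2 * Real.sqrt s)) (Icc s₀ R) :=
    ((continuousOn_pertW h l).mono fun s hs => hs₀.trans_le hs.1).mul (by fun_prop)
  obtain ⟨M', hM'⟩ := isCompact_Icc.exists_bound_of_continuousOn hc
  refine ⟨max 1 (max M M'), by positivity, fun s hs => ?_⟩
  have hs0 : 0 < s := hs₀.trans_le hs
  have key : |pertW T K l s| * (s ^ 2 * Real.sqrt s) ≤ max 1 (max M M') := by
    rcases le_total s R with h1 | h1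
    · have h2 := hM' s ⟨hs, h1⟩
      rw [Real.norm_eq_abs, abs_mul, abs_of_pos (by positivity : 0 < s ^ 2 * Real.sqrt s)] at h2
      exact h2.trans (by simp)
    · exact (hR s h1).trans (by simp)
  have e : s ^ (-3 / 2 : ℝ) = (s * Real.sqrt s)⁻¹ := by
    rw [show (-3 / 2 : ℝ) = -(1 + 1 / 2) by norm_num, Real.rpow_neg hs0.le, Real.rpow_add hs0,
      Real.rpow_one, ← Real.sqrt_eq_rpow]
  rw [e, ← div_eq_mul_inv, le_div_iff₀ (by positivity)]
  exact Eq.trans_le (by ring) key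

theorem isShortRange_pertW (h : IsParticleLike T K) (l : ℕ) : IsShortRange (pertW T K l) :=
  ⟨continuousOn_pertW h l, pertW_near h l, fun _ hs₀ => pertW_far h l hs₀⟩

end ShortRange

/-! ### The mode equation in the variable `u` -/

/-- The potential of the mode equation `γ'' = modePot γ` in the variable `u`. -/
noncomputable def modePot (T K : ℝ → ℝ) (l : ℕ) (ω : ℂ) (u : ℝ) : ℂ :=
  ((rOfU T K u ^ 2 / T (rOfU T K u) ^ 2 : ℝ) : ℂ) * ((l : ℂ) * (l + 1))
    - (rOfU T K u : ℂ) ^ 4 * ω ^ 2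

/-- `f` solves the mode equation on `(-∞, 0)` and has derivative `f'` there.  Carrying `f'` along
avoids `deriv` in computations. -/
structure IsRadialSol (T K : ℝ → ℝ) (l : ℕ) (ω : ℂ) (f f' : ℝ → ℂ) : Prop where
  hasDerivAt : ∀ u, u < 0 → HasDerivAt f (f' u) u
  hasDerivAt' : ∀ u, u < 0 → HasDerivAt f' (modePot T K l ω u * f u) u

/-- The function `η(s(u)) / r(u)`. -/
noncomputable def radial (T K : ℝ → ℝ) (η : ℝ → ℂ) (u : ℝ) : ℂ :=
  η (sCoord T K u) / (rOfU T K u : ℂ)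

/-- The derivative of `radial T K η` on `(-∞, 0)`. -/
noncomputable def radialDeriv (T K : ℝ → ℝ) (η : ℝ → ℂ) (u : ℝ) : ℂ :=
  (rOfU T K u : ℂ) * deriv η (sCoord T K u)
    - η (sCoord T K u) / ((K (rOfU T K u) * T (rOfU T K u) : ℝ) : ℂ)

section Radial

variable {T K : ℝ → ℝ} {l : ℕ} {ω : ℂ}

/-- The substitution `γ(u) = η(s(u)) / r(u)` turns the mode equation in `s` into the one in `u`. -/
theorem isRadialSol_radial (h : IsParticleLike T K) {η : ℝ → ℂ}
    (hη : IsModeSol l ω (pertW T K l) η) :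
    IsRadialSol T K l ω (radial T K η) (radialDeriv T K η) := by
  have hchain : ∀ (f : ℝ → ℂ) (f' : ℂ) (u : ℝ), u < 0 → HasDerivAt f f' (sCoord T K u) →
      HasDerivAt (fun u => f (sCoord T K u)) ((rOfU T K u : ℂ) ^ 2 * f') u := by
    intro f f' u hu hf
    refine (hf.scomp u (hasDerivAt_sCoord h hu)).congr_deriv ?_
    rw [Complex.real_smul]; push_cast; rfl
  refine ⟨fun u hu => ?_, fun u hu => ?_⟩
  · have hr := rOfU_pos h hu
    have hrc : (rOfU T K u : ℂ) ≠ 0 := by exact_mod_cast hr.ne'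
    have hk := h.mul_pos hr.le
    have hkc : ((K (rOfU T K u) * T (rOfU T K u) : ℝ) : ℂ) ≠ 0 := by exact_mod_cast hk.ne'
    have h1 := hchain _ _ u hu (hη.hasDerivAt _ (sCoord_pos h hu))
    refine (h1.fun_div (hasDerivAt_rOfU h hu).ofReal_comp hrc).congr_deriv ?_
    rw [radialDeriv, Complex.ofReal_div, Complex.ofReal_pow]
    field_simp
  · have hr := rOfU_pos h hu
    have hs := sCoord_pos h hu
    have hT := h.T_pos _ hr.le
    have hK := h.K_pos _ hr.le
    have h1 := hchain _ _ u hu (hη.hasDerivAt _ hs)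
    have h2 := hchain _ _ u hu (hη.hasDerivAt_deriv _ hs)
    have hd := hasDerivAt_rOfU h hu
    have h3 : HasDerivAt (fun u => K (rOfU T K u) * T (rOfU T K u))
        ((derivWithin K (Ici 0) (rOfU T K u) * T (rOfU T K u)
          + K (rOfU T K u) * derivWithin T (Ici 0) (rOfU T K u))
          * (rOfU T K u ^ 2 / (K (rOfU T K u) * T (rOfU T K u)))) u :=
      ((h.hasDerivAt_K hr).mul (h.hasDerivAt_T hr)).comp u hd
    have hkc : ((K (rOfU T K u) * T (rOfU T K u) : ℝ) : ℂ) ≠ 0 := by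
      exact_mod_cast (h.mul_pos hr.le).ne'
    refine ((hd.ofReal_comp.mul h2).sub (h1.fun_div h3.ofReal_comp hkc)).congr_deriv ?_
    rw [modePot, radial, pertW_eq, rOfS_sCoord h hu, logDeriv]
    set r := rOfU T K u
    set s := sCoord T K u
    have c1 : (r : ℂ) ≠ 0 := by exact_mod_cast hr.ne'
    have c3 : (T r : ℂ) ≠ 0 := by exact_mod_cast hT.ne'
    have c4 : (K r : ℂ) ≠ 0 := by exact_mod_cast hK.ne'
    push_cast
    field_simp
    ring

theorem IsRadialSol.deriv_eq {f f' : ℝ → ℂ} (hf : IsRadialSol T K l ω f f') {u : ℝ} (hu : u < 0) :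
    deriv f u = f' u :=
  (hf.hasDerivAt u hu).deriv

theorem IsRadialSol.deriv_deriv_eq {f f' : ℝ → ℂ} (hf : IsRadialSol T K l ω f f') {u : ℝ}
    (hu : u < 0) : deriv (deriv f) u = modePot T K l ω u * f u := by
  have h1 : deriv f =ᶠ[𝓝 u] f' := by
    filter_upwards [gt_mem_nhds hu] with v hv using hf.deriv_eq hv
  rw [h1.deriv_eq, (hf.hasDerivAt' u hu).deriv]

theorem continuousOn_modePot (h : IsParticleLike T K) :
    ContinuousOn (modePot T K l ω) (Iio 0) := by
  have hr : ContinuousOn (rOfU T K) (Iio 0) := fun u hu =>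
    (hasDerivAt_rOfU h hu).continuousAt.continuousWithinAt
  have hT : ContinuousOn (fun u => T (rOfU T K u)) (Iio 0) :=
    h.smooth_T.continuousOn.comp hr fun u hu => (rOfU_pos h hu).le
  have h1 : ContinuousOn (fun u => rOfU T K u ^ 2 / T (rOfU T K u) ^ 2) (Iio 0) :=
    (hr.pow 2).div (hT.pow 2) fun u hu => pow_ne_zero 2 (h.T_pos _ (rOfU_pos h hu).le).ne'
  exact ((Complex.continuous_ofReal.comp_continuousOn h1).mul continuousOn_const).sub
    (((Complex.continuous_ofReal.comp_continuousOn hr).pow 4).mul continuousOn_const)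

theorem IsRadialSol.continuousOn {f f' : ℝ → ℂ} (hf : IsRadialSol T K l ω f f') :
    ContinuousOn f (Iio 0) :=
  fun u hu => (hf.hasDerivAt u hu).continuousAt.continuousWithinAt

theorem IsRadialSol.contDiffOn (h : IsParticleLike T K) {f f' : ℝ → ℂ}
    (hf : IsRadialSol T K l ω f f') : ContDiffOn ℝ 2 f (Iio 0) := by
  have e2 : (2 : WithTop ℕ∞) = 1 + 1 := by norm_num
  have e1 : (1 : WithTop ℕ∞) = 0 + 1 := by norm_num
  rw [e2, contDiffOn_succ_iff_deriv_of_isOpen isOpen_Iio]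
  refine ⟨fun u hu => (hf.hasDerivAt u hu).differentiableAt.differentiableWithinAt,
    fun hn => absurd hn (by simp), ?_⟩
  rw [e1, contDiffOn_succ_iff_deriv_of_isOpen isOpen_Iio]
  refine ⟨fun u hu => DifferentiableWithinAt.congr
      (hf.hasDerivAt' u hu).differentiableAt.differentiableWithinAt
      (fun v hv => hf.deriv_eq hv) (hf.deriv_eq hu), fun hn => absurd hn (by simp), ?_⟩
  rw [contDiffOn_zero]
  exact ((continuousOn_modePot h).mul hf.continuousOn).congr fun u hu => hf.deriv_deriv_eq hu

theorem modeOp_eq (f : ℝ → ℂ) (u : ℝ) :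
    modeOp T K l ω f u = modePot T K l ω u * f u - deriv (deriv f) u := by
  rw [modeOp, modePot]; ring

theorem IsRadialSol.modeOp_eq_zero {f f' : ℝ → ℂ} (hf : IsRadialSol T K l ω f f') {u : ℝ}
    (hu : u < 0) : modeOp T K l ω f u = 0 := by
  rw [modeOp_eq, hf.deriv_deriv_eq hu, sub_self]

theorem IsRadialSol.wronskian_eq {f f' g g' : ℝ → ℂ} (hf : IsRadialSol T K l ω f f')
    (hg : IsRadialSol T K l ω g g') {u v : ℝ} (hu : u < 0) (hv : v < 0) :
    wronskian f g u = wronskian f g v := by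
  have h1 : ∀ x ∈ Iio (0 : ℝ), HasDerivAt (fun x => g' x * f x - g x * f' x) 0 x := fun x hx =>
    hasDerivAt_wronskian_zero (hg.hasDerivAt x hx) (hg.hasDerivAt' x hx) (hf.hasDerivAt x hx)
      (hf.hasDerivAt' x hx)
  have h2 := eq_of_hasDerivAt_zero isOpen_Iio (convex_Iio 0) h1 hu hv
  rw [wronskian, wronskian, hf.deriv_eq hu, hf.deriv_eq hv, hg.deriv_eq hu, hg.deriv_eq hv]
  linear_combination h2

/-! ### The energy argument -/

/-- The energy `Re (κ conj(f) f')` of a solution `f` with derivative `f'`. -/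
noncomputable def energy (κ : ℂ) (f f' : ℝ → ℂ) (u : ℝ) : ℝ :=
  (κ * (starRingEnd ℂ (f u) * f' u)).re

/-- The derivative of the energy of a solution; both terms are nonnegative for a suitable `κ`. -/
theorem IsRadialSol.hasDerivAt_energy {f f' : ℝ → ℂ} (hf : IsRadialSol T K l ω f f') (κ : ℂ)
    {u : ℝ} (hu : u < 0) :
    HasDerivAt (energy κ f f') (κ.re * ‖f' u‖ ^ 2 + (κ * modePot T K l ω u).re * ‖f u‖ ^ 2) u := by
  have h1 := ((hf.hasDerivAt u hu).star.mul (hf.hasDerivAt' u hu)).const_mul κ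
  have h2 := Complex.reCLM.hasFDerivAt.comp_hasDerivAt u h1
  refine h2.congr_deriv ?_
  have hn : ∀ z : ℂ, star z * z = (‖z‖ ^ 2 : ℝ) := fun z => by
    rw [mul_comm, ← starRingEnd_apply, Complex.mul_conj, Complex.normSq_eq_norm_sq]
  have e : κ * (star (f' u) * f' u + star (f u) * (modePot T K l ω u * f u))
      = κ * (‖f' u‖ ^ 2 : ℝ) + κ * modePot T K l ω u * (‖f u‖ ^ 2 : ℝ) := by
    rw [← hn, ← hn]; ring
  change (κ * (star (f' u) * f' u + star (f u) * (modePot T K l ω u * f u))).re = _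
  rw [e, Complex.add_re, Complex.re_mul_ofReal, Complex.re_mul_ofReal]

theorem modePot_re_nonneg {κ : ℂ} (hκ : 0 ≤ κ.re) (hω : (κ * ω ^ 2).re ≤ 0) (u : ℝ) :
    0 ≤ (κ * modePot T K l ω u).re := by
  set A : ℝ := rOfU T K u ^ 2 / T (rOfU T K u) ^ 2 * (l * (l + 1)) with hA
  have hA0 : 0 ≤ A := by positivity
  have e : κ * modePot T K l ω u
      = κ * (A : ℝ) - κ * ω ^ 2 * ((rOfU T K u ^ 4 : ℝ) : ℂ) := by
    rw [modePot, hA]; push_cast; ring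
  rw [e, Complex.sub_re, Complex.re_mul_ofReal, Complex.re_mul_ofReal]
  have h1 : 0 ≤ κ.re * A := mul_nonneg hκ hA0
  have h2 : (κ * ω ^ 2).re * rOfU T K u ^ 4 ≤ 0 :=
    mul_nonpos_of_nonpos_of_nonneg hω (by positivity)
  linarith

theorem IsRadialSol.energy_monotoneOn {f f' : ℝ → ℂ} (hf : IsRadialSol T K l ω f f') {κ : ℂ}
    (hκ : 0 ≤ κ.re) (hω : (κ * ω ^ 2).re ≤ 0) : MonotoneOn (energy κ f f') (Iio 0) := by
  refine monotoneOn_of_deriv_nonneg (convex_Iio 0)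
    (fun u hu => (hf.hasDerivAt_energy κ hu).continuousAt.continuousWithinAt) ?_ ?_
  · rw [interior_Iio]
    exact fun u hu => (hf.hasDerivAt_energy κ hu).differentiableAt.differentiableWithinAt
  · rw [interior_Iio]
    intro u hu
    rw [(hf.hasDerivAt_energy κ hu).deriv]
    have := modePot_re_nonneg (T := T) (K := K) (l := l) hκ hω u
    positivity

/-- The flux `conj(γ) γ'` of `γ = radial T K η` is that of `η` up to a real term. -/
theorem conj_radial_mul (h : IsParticleLike T K) (η : ℝ → ℂ) {u : ℝ} (hu : u < 0) :
    starRingEnd ℂ (radial T K η u) * radialDeriv T K η u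
      = starRingEnd ℂ (η (sCoord T K u)) * deriv η (sCoord T K u)
        - ((‖η (sCoord T K u)‖ ^ 2 / (rOfU T K u * (K (rOfU T K u) * T (rOfU T K u))) : ℝ) : ℂ) := by
  have hr := rOfU_pos h hu
  have c1 : (rOfU T K u : ℂ) ≠ 0 := by exact_mod_cast hr.ne'
  have hn : ((‖η (sCoord T K u)‖ : ℝ) : ℂ) ^ 2
      = η (sCoord T K u) * starRingEnd ℂ (η (sCoord T K u)) := by
    rw [Complex.mul_conj, Complex.normSq_eq_norm_sq]; push_cast; rfl
  rw [radial, radialDeriv, map_div₀, Complex.conj_ofReal]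
  push_cast
  rw [hn]
  field_simp

theorem tendsto_sCoord_atBot (h : IsParticleLike T K) :
    Tendsto (sCoord T K) atBot (𝓝[>] 0) := by
  refine ((tendsto_sOfR_zero h).comp (tendsto_rOfU_atBot h)).congr' ?_
  filter_upwards [eventually_lt_atBot 0] with u hu using (sCoord_eq h hu).symm

theorem tendsto_sCoord_zero (h : IsParticleLike T K) :
    Tendsto (sCoord T K) (𝓝[<] 0) atTop := by
  refine ((tendsto_sOfR_atTop h).comp (tendsto_rOfU_zero h)).congr' ?_
  filter_upwards [self_mem_nhdsWithin] with u hu using (sCoord_eq h hu).symm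

/-- The energy of `γ¹` tends to zero at the centre, `u → -∞`. -/
theorem tendsto_energy_gamma1 (h : IsParticleLike T K) (l : ℕ) (ω κ : ℂ) :
    Tendsto (energy κ (radial T K (eta1 T K l ω)) (radialDeriv T K (eta1 T K l ω))) atBot
      (𝓝 0) := by
  obtain ⟨C, hC⟩ := exists_bound_eta1 (isShortRange_pertW h l) ω
  obtain ⟨a, b, ha, hb, hab⟩ := h.exists_bounds
  have hs := tendsto_sCoord_atBot h
  have h1 : Tendsto (fun u => starRingEnd ℂ (radial T K (eta1 T K l ω) u)
      * radialDeriv T K (eta1 T K l ω) u) atBot (𝓝 0) := by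
    refine squeeze_zero_norm' (a := fun u => (C ^ 2 + C ^ 2 * (b / a)) * sCoord T K u) ?_ ?_
    · filter_upwards [eventually_lt_atBot 0, hs.eventually (Ioo_mem_nhdsGT one_pos)] with u hu hsu
      obtain ⟨h2, h3⟩ := hC _ hsu
      have hs0 := hsu.1
      have hr := rOfU_pos h hu
      have hk := (hab _ hr.le).1
      have hsr := (sOfR_bounds h hab hr).2
      rw [← sCoord_eq h hu] at hsr
      have hC0 : 0 ≤ C := (norm_nonneg _).trans h3
      rw [conj_radial_mul h _ hu]
      refine (norm_sub_le _ _).trans ?_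
      rw [norm_mul, RCLike.norm_conj, Complex.norm_real, Real.norm_of_nonneg (by
        have := h.mul_pos hr.le
        positivity)]
      have h4 : ‖eta1 T K l ω (sCoord T K u)‖ ^ 2
          / (rOfU T K u * (K (rOfU T K u) * T (rOfU T K u)))
          ≤ C ^ 2 * (b / a) * sCoord T K u := by
        rw [div_le_iff₀ (mul_pos hr (h.mul_pos hr.le))]
        calc ‖eta1 T K l ω (sCoord T K u)‖ ^ 2 ≤ (C * sCoord T K u) ^ 2 := by gcongr
          _ = C ^ 2 * sCoord T K u * sCoord T K u := by ring
          _ ≤ C ^ 2 * sCoord T K u * (b * rOfU T K u) := by gcongr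
          _ = C ^ 2 * (b / a) * sCoord T K u * (rOfU T K u * a) := by field_simp
          _ ≤ _ := by gcongr
      calc _ ≤ C * sCoord T K u * C + C ^ 2 * (b / a) * sCoord T K u := by gcongr
        _ = _ := by ring
    · have := (tendsto_nhdsWithin_iff.1 hs).1.const_mul (C ^ 2 + C ^ 2 * (b / a))
      rwa [mul_zero] at this
  have h2 := (Complex.continuous_re.tendsto 0).comp (by simpa using h1.const_mul κ :
    Tendsto (fun u => κ * (starRingEnd ℂ (radial T K (eta1 T K l ω) u)
      * radialDeriv T K (eta1 T K l ω) u)) atBot (𝓝 0))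
  exact h2

/-- The energy of `γ²` at infinity, `u → 0`, is given by the flux of `η²`. -/
theorem tendsto_energy_gamma2 (h : IsParticleLike T K) {l : ℕ} {ω κ L : ℂ}
    (hL : Tendsto (fun s : ℝ => starRingEnd ℂ (eta2 T K l ω s) * deriv (eta2 T K l ω) s) atTop
      (𝓝 L)) :
    Tendsto (energy κ (radial T K (eta2 T K l ω)) (radialDeriv T K (eta2 T K l ω))) (𝓝[<] 0)
      (𝓝 (κ * L).re) := by
  obtain ⟨a, b, ha, hb, hab⟩ := h.exists_bounds
  have hs := tendsto_sCoord_zero h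
  have hB := (eta2_eventually (isShortRange_pertW h l) ω).1
  set B := ‖eta2ZeroConst l‖ + 2
  have h1 : Tendsto (fun u => ((‖eta2 T K l ω (sCoord T K u)‖ ^ 2
      / (rOfU T K u * (K (rOfU T K u) * T (rOfU T K u))) : ℝ) : ℂ)) (𝓝[<] 0) (𝓝 0) := by
    refine squeeze_zero_norm' (a := fun u => B ^ 2 / a * (rOfU T K u)⁻¹) ?_ ?_
    · filter_upwards [self_mem_nhdsWithin, hs.eventually hB] with u hu hBu
      have hr := rOfU_pos h hu
      have hk := (hab _ hr.le).1
      rw [Complex.norm_real, Real.norm_of_nonneg (by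
        have := h.mul_pos hr.le
        positivity), ← div_eq_mul_inv, div_div, mul_comm a]
      gcongr
    · have := (tendsto_inv_atTop_zero.comp (tendsto_rOfU_zero h)).const_mul (B ^ 2 / a)
      rwa [mul_zero] at this
  have h2 := ((hL.comp hs).sub h1).const_mul κ
  rw [sub_zero] at h2
  refine ((Complex.continuous_re.tendsto _).comp h2).congr' ?_
  filter_upwards [self_mem_nhdsWithin] with u hu
  rw [energy, conj_radial_mul h _ hu]
  rfl

theorem tendsto_gamma2_zero (h : IsParticleLike T K) (l : ℕ) (ω : ℂ) :
    Tendsto (radial T K (eta2 T K l ω)) (𝓝[<] 0) (𝓝 0) := by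
  have hs := tendsto_sCoord_zero h
  have hB := (eta2_eventually (isShortRange_pertW h l) ω).1
  refine squeeze_zero_norm' (a := fun u => (‖eta2ZeroConst l‖ + 2) * (rOfU T K u)⁻¹) ?_ ?_
  · filter_upwards [self_mem_nhdsWithin, hs.eventually hB] with u hu hBu
    have hr := rOfU_pos h hu
    rw [radial, norm_div, Complex.norm_real, Real.norm_of_nonneg hr.le, div_eq_mul_inv]
    gcongr
  · have := (tendsto_inv_atTop_zero.comp (tendsto_rOfU_zero h)).const_mul (‖eta2ZeroConst l‖ + 2)
    rwa [mul_zero] at this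

/-- For a suitable multiplier `κ` the energy is nondecreasing along solutions and that of `γ²` is
negative. -/
theorem exists_energy_gamma2_neg (h : IsParticleLike T K) (l : ℕ) (ω : ℂ) :
    ∃ κ : ℂ, 0 ≤ κ.re ∧ (κ * ω ^ 2).re ≤ 0 ∧ ∀ u, u < 0 →
      energy κ (radial T K (eta2 T K l ω)) (radialDeriv T K (eta2 T K l ω)) u < 0 := by
  obtain ⟨κ, L, hκ, hω, hL, hcase⟩ := exists_energy_multiplier (isShortRange_pertW h l) ω
  refine ⟨κ, hκ, hω, fun u hu => ?_⟩
  have hsol := isRadialSol_radial h (eta2_isModeSol (l := l) (ω := ω) (isShortRange_pertW h l))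
  have hmono := hsol.energy_monotoneOn hκ hω
  have hlim := tendsto_energy_gamma2 h (κ := κ) hL
  set N := energy κ (radial T K (eta2 T K l ω)) (radialDeriv T K (eta2 T K l ω))
  have hle : ∀ v, v < 0 → N v ≤ (κ * L).re := by
    intro v hv
    refine ge_of_tendsto hlim ?_
    filter_upwards [Ioo_mem_nhdsLT hv] with w hw using hmono hv hw.2 hw.1.le
  rcases hcase with ⟨-, hneg⟩ | ⟨hpos, rfl⟩
  · exact (hle u hu).trans_lt hneg
  · rw [mul_zero, Complex.zero_re] at hle
    refine lt_of_le_of_ne (hle u hu) fun h0 => ?_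
    -- otherwise the energy vanishes identically on `(u, 0)`, where `γ²` is then constant and, as it
    -- tends to zero, vanishes
    have hN0 : ∀ v ∈ Ioo u 0, N v = 0 := fun v hv =>
      le_antisymm (hle v hv.2) (h0 ▸ hmono hu hv.2 hv.1.le)
    have hd0 : ∀ v ∈ Ioo u 0, HasDerivAt (radial T K (eta2 T K l ω)) 0 v := by
      intro v hv
      have h1 : HasDerivAt N 0 v := by
        refine (hasDerivAt_const v (0 : ℝ)).congr_of_eventuallyEq ?_
        filter_upwards [isOpen_Ioo.mem_nhds hv] with w hw using hN0 w hw
      have h2 := h1.unique (hsol.hasDerivAt_energy κ hv.2)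
      have h3 := modePot_re_nonneg (T := T) (K := K) (l := l) hκ hω v
      have h4 : κ.re * ‖radialDeriv T K (eta2 T K l ω) v‖ ^ 2 ≤ 0 := by
        have : 0 ≤ (κ * modePot T K l ω v).re * ‖radial T K (eta2 T K l ω) v‖ ^ 2 := by positivity
        linarith
      have h5 : ‖radialDeriv T K (eta2 T K l ω) v‖ ^ 2 = 0 :=
        le_antisymm (nonpos_of_mul_nonpos_right h4 hpos) (sq_nonneg _)
      have h6 : radialDeriv T K (eta2 T K l ω) v = 0 := by simpa using h5
      have h7 := hsol.hasDerivAt v hv.2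
      rwa [h6] at h7
    have hzero : ∀ v ∈ Ioo u 0, radial T K (eta2 T K l ω) v = 0 := by
      intro v hv
      have h1 : Tendsto (radial T K (eta2 T K l ω)) (𝓝[<] 0)
          (𝓝 (radial T K (eta2 T K l ω) v)) := by
        refine tendsto_const_nhds.congr' ?_
        filter_upwards [Ioo_mem_nhdsLT hu] with w hw
        exact eq_of_hasDerivAt_zero isOpen_Ioo (convex_Ioo u 0) hd0 hv hw
      exact tendsto_nhds_unique h1 (tendsto_gamma2_zero h l ω)
    have hne := (tendsto_sCoord_zero h).eventually
      (eta2_eventually (isShortRange_pertW h l) ω).2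
    have hmem : ∀ᶠ v in 𝓝[<] (0 : ℝ), v ∈ Ioo u 0 := Ioo_mem_nhdsLT hu
    obtain ⟨v, hv, hv0⟩ := (hmem.and hne).exists
    have h8 := hzero v hv
    rw [radial, div_eq_zero_iff] at h8
    rcases h8 with h8 | h8
    · exact hv0 h8
    · exact (rOfU_pos h hv.2).ne' (by exact_mod_cast h8)

/-- Solutions proportional to `γ¹` have nonnegative energy, while `γ²` has negative energy. -/
theorem wronskian_gamma_ne_zero (h : IsParticleLike T K) (l : ℕ) (ω : ℂ) :
    ∃ c : ℂ, c ≠ 0 ∧ ∀ u : ℝ, u < 0 →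
      wronskian (gamma1 T K l ω) (gamma2 T K l ω) u = c := by
  have hV := isShortRange_pertW h l
  have hs1 : IsRadialSol T K l ω (gamma1 T K l ω) (radialDeriv T K (eta1 T K l ω)) :=
    isRadialSol_radial h (eta1_isModeSol hV ω)
  have hs2 : IsRadialSol T K l ω (gamma2 T K l ω) (radialDeriv T K (eta2 T K l ω)) :=
    isRadialSol_radial h (eta2_isModeSol hV)
  obtain ⟨κ, hκ, hω, hneg⟩ := exists_energy_gamma2_neg h l ω
  have h1 : ∀ᶠ u in atBot, eta1 T K l ω (sCoord T K u) ≠ 0 := by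
    filter_upwards [(tendsto_sCoord_atBot h).eventually
      ((tendsto_eta1_zpow hV ω).eventually_ne one_ne_zero)] with u hu h0
    exact hu (by rw [h0, zero_mul])
  obtain ⟨u, hu, hne⟩ := ((eventually_lt_atBot (0 : ℝ)).and h1).exists
  have hf1 : gamma1 T K l ω u ≠ 0 :=
    div_ne_zero hne (by exact_mod_cast (rOfU_pos h hu).ne')
  have hN1 : 0 ≤ energy κ (gamma1 T K l ω) (radialDeriv T K (eta1 T K l ω)) u := by
    refine le_of_tendsto (tendsto_energy_gamma1 h l ω κ) ?_
    filter_upwards [eventually_le_atBot u] with v hv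
    exact hs1.energy_monotoneOn hκ hω (lt_of_le_of_lt hv hu) hu hv
  refine ⟨wronskian (gamma1 T K l ω) (gamma2 T K l ω) u, fun h0 => ?_,
    fun v hv => hs1.wronskian_eq hs2 hv hu⟩
  -- if the Wronskian vanished, the energy of `γ²` would be a nonnegative multiple of that of `γ¹`
  have hN2 := hneg u hu
  rw [wronskian, hs1.deriv_eq hu, hs2.deriv_eq hu] at h0
  set t := gamma2 T K l ω u / gamma1 T K l ω u with ht
  have e1 : gamma2 T K l ω u = t * gamma1 T K l ω u := by rw [ht]; field_simp
  have e2 : radialDeriv T K (eta2 T K l ω) u = t * radialDeriv T K (eta1 T K l ω) u := by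
    rw [ht]; field_simp; linear_combination h0
  have e3 : energy κ (radial T K (eta2 T K l ω)) (radialDeriv T K (eta2 T K l ω)) u
      = ‖t‖ ^ 2 * energy κ (gamma1 T K l ω) (radialDeriv T K (eta1 T K l ω)) u := by
    have e4 : κ * (starRingEnd ℂ (gamma2 T K l ω u) * radialDeriv T K (eta2 T K l ω) u)
        = ((‖t‖ ^ 2 : ℝ) : ℂ) * (κ * (starRingEnd ℂ (gamma1 T K l ω u)
          * radialDeriv T K (eta1 T K l ω) u)) := by
      rw [← Complex.normSq_eq_norm_sq, ← Complex.mul_conj, e1, e2, map_mul]; ring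
    change (κ * (starRingEnd ℂ (gamma2 T K l ω u) * radialDeriv T K (eta2 T K l ω) u)).re = _
    rw [e4, Complex.re_ofReal_mul, energy]
  rw [e3] at hN2
  have : 0 ≤ ‖t‖ ^ 2 * energy κ (gamma1 T K l ω) (radialDeriv T K (eta1 T K l ω)) u :=
    mul_nonneg (sq_nonneg _) hN1
  linarith

/-! ### The kernel -/

theorem kernelH_of_le {u v : ℝ} (hvu : v ≤ u) :
    kernelH T K l ω u v = -(1 / wronskian (gamma1 T K l ω) (gamma2 T K l ω) u)
      * gamma2 T K l ω u * gamma1 T K l ω v := by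
  rw [kernelH]
  rcases hvu.eq_or_lt with rfl | hlt
  · rw [if_pos le_rfl]; ring
  · rw [if_neg (not_le.2 hlt)]; ring

theorem kernelH_of_ge {u v : ℝ} (huv : u ≤ v) :
    kernelH T K l ω u v = -(1 / wronskian (gamma1 T K l ω) (gamma2 T K l ω) u)
      * gamma1 T K l ω u * gamma2 T K l ω v := by
  rw [kernelH, if_pos huv]; ring

/-- Integration by parts against a solution `f`: the integrand is the derivative of
`f' γ - f γ'`. -/
theorem IsRadialSol.integral_modeOp (h : IsParticleLike T K) {f f' : ℝ → ℂ}
    (hf : IsRadialSol T K l ω f f') {γ : ℝ → ℂ}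
    (hγ : ContDiff ℝ ((⊤ : ℕ∞) : WithTop ℕ∞) γ) {a b : ℝ} (hab : a ≤ b) (hb : b < 0) :
    ContinuousOn (fun v => f v * modeOp T K l ω γ v) (Icc a b) ∧
    ∫ v in a..b, f v * modeOp T K l ω γ v
      = (f' b * γ b - f b * deriv γ b) - (f' a * γ a - f a * deriv γ a) := by
  have hsub : Icc a b ⊆ Iio 0 := fun x hx => lt_of_le_of_lt hx.2 hb
  have h1 := contDiff_infty_iff_deriv.1 hγ
  have h2 := contDiff_infty_iff_deriv.1 h1.2
  have hc : ContinuousOn (fun v => f v * modeOp T K l ω γ v) (Icc a b) := by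
    simp only [modeOp_eq]
    exact (hf.continuousOn.mono hsub).mul ((((continuousOn_modePot h).mono hsub).mul
      hγ.continuous.continuousOn).sub h2.2.continuous.continuousOn)
  refine ⟨hc, intervalIntegral.integral_eq_sub_of_hasDerivAt
    (f := fun v => f' v * γ v - f v * deriv γ v) (fun v hv => ?_)
    (ContinuousOn.intervalIntegrable (by rwa [uIcc_of_le hab]))⟩
  rw [uIcc_of_le hab] at hv
  refine (((hf.hasDerivAt' v (hsub hv)).mul (h1.1 v).hasDerivAt).sub
    ((hf.hasDerivAt v (hsub hv)).mul (h2.1 v).hasDerivAt)).congr_deriv ?_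
  rw [modeOp_eq]; ring

/-- The kernel `h` is a fundamental solution of the mode operator: on either side of `u` the
integrand is an exact derivative, and the boundary terms at `u` add up to the Wronskian. -/
theorem kernelH_reproduces (h : IsParticleLike T K) (l : ℕ) (ω : ℂ) {γ : ℝ → ℂ}
    (hγ : ContDiff ℝ ((⊤ : ℕ∞) : WithTop ℕ∞) γ) (hcs : HasCompactSupport γ)
    (hsupp : tsupport γ ⊆ Iio 0) {u : ℝ} (hu : u < 0) :
    IntegrableOn (fun v : ℝ => kernelH T K l ω u v * modeOp T K l ω γ v) (Iio 0) ∧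
      ∫ v in Iio 0, kernelH T K l ω u v * modeOp T K l ω γ v = γ u := by
  have hV := isShortRange_pertW h l
  have hs1 : IsRadialSol T K l ω (gamma1 T K l ω) (radialDeriv T K (eta1 T K l ω)) :=
    isRadialSol_radial h (eta1_isModeSol hV ω)
  have hs2 : IsRadialSol T K l ω (gamma2 T K l ω) (radialDeriv T K (eta2 T K l ω)) :=
    isRadialSol_radial h (eta2_isModeSol hV)
  obtain ⟨c, hc0, hc⟩ := wronskian_gamma_ne_zero h l ω
  have hw := hc u hu
  -- an interval around `u` and the support of `γ`
  obtain ⟨a, b, hau, hub, hb, hsub⟩ : ∃ a b : ℝ, a < u ∧ u < b ∧ b < 0 ∧ tsupport γ ⊆ Ioo a b := by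
    have hK : IsCompact (insert u (tsupport γ)) := IsCompact.insert hcs u
    have hne : (insert u (tsupport γ)).Nonempty := ⟨u, mem_insert _ _⟩
    obtain ⟨m, hm, hmin⟩ := hK.exists_isLeast hne
    obtain ⟨M, hM, hmax⟩ := hK.exists_isGreatest hne
    have hM0 : M < 0 := by
      rcases hM with rfl | hM
      · exact hu
      · exact hsupp hM
    have h1 := hmin (mem_insert u _)
    have h2 := hmax (mem_insert u _)
    refine ⟨m - 1, M / 2, by linarith, by linarith, by linarith, fun x hx => ⟨?_, ?_⟩⟩
    · have := hmin (mem_insert_of_mem u hx); linarith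
    · have := hmax (mem_insert_of_mem u hx); linarith
  have hout : ∀ v, v ∉ Ioo a b → γ v = 0 ∧ deriv γ v = 0 ∧ deriv (deriv γ) v = 0 := by
    intro v hv
    have h1 : v ∉ tsupport γ := fun hx => hv (hsub hx)
    have h2 : v ∉ tsupport (deriv γ) := fun hx => h1 (closure_minimal support_deriv_subset
      (isClosed_tsupport γ) hx)
    have h3 : v ∉ tsupport (deriv (deriv γ)) := fun hx => h2 (closure_minimal support_deriv_subset
      (isClosed_tsupport (deriv γ)) hx)
    exact ⟨image_eq_zero_of_notMem_tsupport h1, image_eq_zero_of_notMem_tsupport h2,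
      image_eq_zero_of_notMem_tsupport h3⟩
  have hzero : ∀ v, v ∉ Ioo a b → kernelH T K l ω u v * modeOp T K l ω γ v = 0 := by
    intro v hv
    obtain ⟨h1, -, h3⟩ := hout v hv
    rw [modeOp_eq, h1, h3, mul_zero, sub_zero, mul_zero]
  obtain ⟨hc1, hI1⟩ := hs1.integral_modeOp h hγ hau.le hu
  obtain ⟨hc2, hI2⟩ := hs2.integral_modeOp h hγ hub.le hb
  obtain ⟨ha1, ha2, -⟩ := hout a (fun hx => lt_irrefl _ hx.1)
  obtain ⟨hb1, hb2, -⟩ := hout b (fun hx => lt_irrefl _ hx.2)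
  set H := fun v : ℝ => kernelH T K l ω u v * modeOp T K l ω γ v with hH
  have e1 : ∀ v ∈ Icc a u, H v = -(1 / c) * gamma2 T K l ω u
      * (gamma1 T K l ω v * modeOp T K l ω γ v) := by
    intro v hv
    simp only [hH]
    rw [kernelH_of_le hv.2, hw]; ring
  have e2 : ∀ v ∈ Icc u b, H v = -(1 / c) * gamma1 T K l ω u
      * (gamma2 T K l ω v * modeOp T K l ω γ v) := by
    intro v hv
    simp only [hH]
    rw [kernelH_of_ge hv.1, hw]; ring
  have i1 : IntervalIntegrable H volume a u := by
    refine ContinuousOn.intervalIntegrable ?_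
    rw [uIcc_of_le hau.le]
    exact (continuousOn_const.mul hc1).congr e1
  have i2 : IntervalIntegrable H volume u b := by
    refine ContinuousOn.intervalIntegrable ?_
    rw [uIcc_of_le hub.le]
    exact (continuousOn_const.mul hc2).congr e2
  have hle := hau.le.trans hub.le
  have hsubset : Ioc a b ⊆ Iio 0 := fun x hx => lt_of_le_of_lt hx.2 hb
  have hz : ∀ x ∈ Iio 0 \ Ioc a b, H x = 0 := fun x hx =>
    hzero x fun hx' => hx.2 ⟨hx'.1, hx'.2.le⟩
  refine ⟨((intervalIntegrable_iff_integrableOn_Ioc_of_le hle).1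
    (i1.trans i2)).of_forall_sdiff_eq_zero measurableSet_Iio hz, ?_⟩
  rw [setIntegral_eq_of_subset_of_forall_sdiff_eq_zero measurableSet_Iio hsubset hz,
    ← intervalIntegral.integral_of_le hle, ← intervalIntegral.integral_add_adjacent_intervals i1 i2,
    intervalIntegral.integral_congr (g := fun v => -(1 / c) * gamma2 T K l ω u
      * (gamma1 T K l ω v * modeOp T K l ω γ v)) (by rw [uIcc_of_le hau.le]; exact e1),
    intervalIntegral.integral_congr (a := u) (g := fun v => -(1 / c) * gamma1 T K l ω u
      * (gamma2 T K l ω v * modeOp T K l ω γ v)) (by rw [uIcc_of_le hub.le]; exact e2),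
    intervalIntegral.integral_const_mul, intervalIntegral.integral_const_mul, hI1, hI2, ha1, ha2,
    hb1, hb2]
  rw [wronskian, hs1.deriv_eq hu, hs2.deriv_eq hu] at hw
  field_simp
  linear_combination (γ u) * hw

end Radial

end ParticleLike

theorem mainTheorem6 (T K : ℝ → ℝ) (hTK : ParticleLike.IsParticleLike T K) (l : ℕ) (ω : ℂ) :
    -- the perturbation series of `η¹` is well defined and converges
    (∀ s : ℝ, 0 < s →
      (∀ n : ℕ, IntegrableOn (fun y : ℝ => ParticleLike.greenG l ω s y *
        (ParticleLike.pertW T K l y : ℂ) * ParticleLike.eta1Term T K l ω n y) (Ioo 0 s)) ∧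
      Summable (fun n : ℕ => ParticleLike.eta1Term T K l ω n s)) ∧
    -- the perturbation series of `η²` is well defined and converges
    (ω.im ≤ 0 → ∀ s : ℝ, 0 < s →
      (∀ n : ℕ, IntegrableOn (fun y : ℝ => ParticleLike.greenB l ω s y *
        (ParticleLike.pertW T K l y : ℂ) * ParticleLike.eta2Term T K l ω n y) (Ioi s)) ∧
      Summable (fun n : ℕ => ParticleLike.eta2Term T K l ω n s)) ∧
    -- the boundary conditions at `s = 0` and at `s = ∞`
    Tendsto (fun s : ℝ => ParticleLike.eta1 T K l ω s * (s : ℂ) ^ (-ParticleLike.lam l - 1 / 2))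
      (𝓝[>] 0) (𝓝 1) ∧
    (ω.im ≤ 0 → ω ≠ 0 → Tendsto
      (fun s : ℝ => ParticleLike.eta2 T K l ω s * Complex.exp (Complex.I * ω * s)) atTop (𝓝 1)) ∧
    (0 < ω.im → Tendsto
      (fun s : ℝ => ParticleLike.eta2 T K l ω s * Complex.exp (-(Complex.I * ω * s)))
        atTop (𝓝 1)) ∧
    (ω = 0 → Tendsto (fun s : ℝ => ParticleLike.eta2 T K l ω s * (s : ℂ) ^ l) atTop
      (𝓝 (ParticleLike.eta2ZeroConst l))) ∧
    -- `γ¹` and `γ²` solve the mode equation on `(-∞, 0)`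
    ContDiffOn ℝ 2 (ParticleLike.gamma1 T K l ω) (Iio 0) ∧
    ContDiffOn ℝ 2 (ParticleLike.gamma2 T K l ω) (Iio 0) ∧
    (∀ u : ℝ, u < 0 →
      ParticleLike.modeOp T K l ω (ParticleLike.gamma1 T K l ω) u = 0 ∧
      ParticleLike.modeOp T K l ω (ParticleLike.gamma2 T K l ω) u = 0) ∧
    -- their Wronskian is a nonzero constant
    (∃ c : ℂ, c ≠ 0 ∧ ∀ u : ℝ, u < 0 →
      ParticleLike.wronskian (ParticleLike.gamma1 T K l ω) (ParticleLike.gamma2 T K l ω) u = c) ∧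
    -- `h` reproduces every test function on `(-∞, 0)`
    (∀ γ : ℝ → ℂ, ContDiff ℝ ((⊤ : ℕ∞) : WithTop ℕ∞) γ → HasCompactSupport γ → tsupport γ ⊆ Iio 0 →
      ∀ u : ℝ, u < 0 →
        IntegrableOn
          (fun v : ℝ => ParticleLike.kernelH T K l ω u v * ParticleLike.modeOp T K l ω γ v)
          (Iio 0) ∧
        ∫ v in Iio 0, ParticleLike.kernelH T K l ω u v * ParticleLike.modeOp T K l ω γ v
          = γ u) := by
  have hV := ParticleLike.isShortRange_pertW hTK l
  have h1 := ParticleLike.isRadialSol_radial hTK (ParticleLike.eta1_isModeSol hV ω)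
  have h2 := ParticleLike.isRadialSol_radial hTK (ParticleLike.eta2_isModeSol (ω := ω) hV)
  refine ⟨fun s hs => ParticleLike.eta1_converges hV ω hs,
    fun him s hs => ParticleLike.eta2_converges hV him hs,
    ParticleLike.tendsto_eta1 hV ω,
    fun him hω => ParticleLike.tendsto_eta2 hV him hω,
    fun him => ParticleLike.tendsto_eta2_of_im_pos hV him,
    ?_, h1.contDiffOn hTK, h2.contDiffOn hTK,
    fun u hu => ⟨h1.modeOp_eq_zero hu, h2.modeOp_eq_zero hu⟩,
    ParticleLike.wronskian_gamma_ne_zero hTK l ω,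
    fun γ hγ hc hsupp u hu => ParticleLike.kernelH_reproduces hTK l ω hγ hc hsupp hu⟩
  rintro rfl
  exact ParticleLike.tendsto_eta2_zero hV
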